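/- Let $\widehat{\mathbb C}$ be the Riemann sphere and let $F$ be a holomorphic or antiholomorphic correspondence on it: for a nonzero polynomial $P(z,w)$ over $\mathbb C$, let $\Gamma\subseteq\widehat{\mathbb C}\times\widehat{\mathbb C}$ be the curve $P(z,w)=0$ (respectively $P(\bar z,w)=0$), extended to $\infty$ by bihomogenisation, and put $F(z)=\{w:(z,w)\in\Gamma\}$. Let $F^0=\mathrm{id}$, let $F^{n+1}(z)=\bigcup_{y\in F^n(z)}F(y)$, and let $F^{-n}(S)=\{z: F^n(z)\cap S\neq\emptyset\}$. For $x\in\widehat{\mathbb C}$ let $\Lambda_+(x)=\bigcap_{n\ge 0}\overline{\bigcup_{k\ge n}F^k(x)}$. *Definitions.* * All branches of $F^n$ are defined on an open set $W$ if there are finitely many (anti)holomorphic functions $f_j:W\to\widehat{\mathbb C}$ with $F^n(z)=\{f_j(z)\}_j$ for all $z\in W$; the $f_j$ are then the branches of $F^n$ on $W$. (Antiholomorphic is meant when $F$ is antiholomorphic and $n$ is odd, holomorphic otherwise.) * $\mathcal{CV}_{F^{-1}}$ is the set of first coordinates of those $a\in\Gamma$ such that, for each neighbourhood $W$ of $a$,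 the first projection is not injective on some irreducible component of $\Gamma\cap W$. $\mathrm{Sing}_F$ is the set of first coordinates of those $a\in\Gamma$ such that, for each neighbourhood $W$ of $a$, the first projection is not injective on $\Gamma\cap W$. Put $\mathcal{PC}_{F^{-1}}=\overline{\bigcup_{i\ge0}F^{-i}(\mathcal{CV}_{F^{-1}})}$. * $\Omega_+(x)$ is the set of parabolic periodic points in $\Lambda_+(x)$, i.e. of those $\omega\in\Lambda_+(x)$ for which, for some $q\ge1$, a branch $f$ of $F^q$ defined near $\omega$ satisfies $f(\omega)=\omega$ and $D(f^n)(\omega)=1$ for some $n\ge1$. * $F$ is invariantly inverse-like on $S$ if $F(S)\subseteq S$ and each $w\in F(S)$ lies in $F(z)$ for exactly one $z\in S$; then $g_{F,S}:F(S)\to S$ sends $w$ to this $z$. * $F$ is locally $\Omega_+(x)$-attracting on $\Lambda_+(x)$ if, for each $\omega\in\Omega_+(x)$, each $q\ge1$ and each germ $T$ at $\omega$ of a branch of $F^q$ with $T(\omega)=\omega$, there is a set $U$ that is the closure of an open set with finitely many connected components, the closure of each of which contains $\omega$, such that $\Lambda_+(x)\cap V=\Lambda_+(x)\cap V\cap U$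 for all sufficiently small neighbourhoods $V$ of $\omega$, all iterates $T^n$ (of a suitable representative of $T$ as a branch of $F^q$) are defined on $U$, and $T^n(z)\to\omega$ as $n\to\infty$ for each $z\in U$. * $F$ is relatively hyperbolic on $\Lambda_+(x)$ if it is invariantly inverse-like on $\Lambda_+(x)$, $\Lambda_+(x)\cap\mathcal{CV}_{F^{-1}}=\emptyset$, $F$ is locally $\Omega_+(x)$-attracting on $\Lambda_+(x)$, and $\Lambda_+(x)\cap\mathcal{PC}_{F^{-1}}\subseteq\Omega_+(x)$. * $\Lambda_+(x)$ is minimal if $F$ is invariantly inverse-like on $\Lambda:=\Lambda_+(x)$ and: (1) $\Lambda$ has empty interior, has no nonempty proper closed subset $A$ with $F(A)\subseteq A$, and satisfies $\Lambda\cap(\mathrm{Sing}_F\smallsetminus\mathcal{CV}_{F^{-1}})=\emptyset$; (2) each $z\in\Lambda\smallsetminus\Omega_+(x)$ has a neighbourhood $U_z$ such that, for each $n\ge0$, $g_{F,\Lambda}^n$ extends to a map on $F^n(U_z\cup\Lambda)$ with $g_{F,\Lambda}^n(F^n(y))=\{y\}$ for each $y\in U_z$, moreover $\Lambda_+(y)\subseteq\Lambda$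 for each $y\in U_z$, and at least three points of $\widehat{\mathbb C}$ lie outside $\bigcup_{n\ge0}F^n(U_z)$; (3) $\Omega_+(x)$ is finite. **Proposition.** Suppose that $F$ is relatively hyperbolic on $\Lambda_+(x)$ and that $\Lambda_+(x)$ is minimal. Then the area (two-dimensional Lebesgue measure) of $\Lambda_+(x)$ is zero. Moreover, $\Lambda_+(x)$ is porous at each point $z$ of $$X=\Lambda_+(x)\smallsetminus\bigcup_{n\ge0}F^n(\Omega_+(x)),$$ i.e., in a local coordinate at $z$ (the coordinate $z$ at finite points, $1/z$ at $\infty$), there is $c>0$ such that for arbitrarily small $r>0$ the disc of radius $r$ around $z$ contains a disc of radius $cr$ disjoint from $\Lambda_+(x)$. -/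

import Mathlib

open Set Filter Topology MeasureTheory

noncomputable section

/-! ## The Riemann sphere -/

/-- The Riemann sphere `ℂ ∪ {∞}`, with its usual compact topology. -/
abbrev Sphere : Type := OnePoint ℂ

namespace Sphere

/-- Homogeneous coordinates: `z = [z : 1]` and `∞ = [1 : 0]`. -/
def hom (p : Sphere) : ℂ × ℂ := OnePoint.elim p (1, 0) (fun z => (z, 1))

/-- The affine coordinate of a finite point; the value at `∞` is never used. -/
def toC (p : Sphere) : ℂ := OnePoint.elim p 0 id

open Classical in
/-- The inversion `z ↦ 1 / z`, exchanging `0` and `∞`. -/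
def inv (p : Sphere) : Sphere :=
  OnePoint.elim p ((0 : ℂ) : Sphere)
    (fun z => if z = 0 then OnePoint.infty else ((z⁻¹ : ℂ) : Sphere))

open Classical in
/-- The coordinate used near `p`: it is `z` if `p` is finite and `1 / z` if `p = ∞`. -/
def coord (p : Sphere) : Sphere → ℂ :=
  if p = OnePoint.infty then fun q => toC (inv q) else toC

open Classical in
/-- The local parametrisation of the sphere that is inverse to `coord p`. -/
def param (p : Sphere) : ℂ → Sphere :=
  if p = OnePoint.infty then fun t => inv (t : Sphere) else fun t => (t : Sphere)

end Sphere

/-- Complex conjugation if `anti` is true, the identity otherwise. -/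
def conjIf (anti : Bool) (z : ℂ) : ℂ := if anti then (starRingEnd ℂ) z else z

/-- `f` is holomorphic (antiholomorphic, if `anti` is true) on the open set `U` of the sphere, as
a map into the sphere: it is continuous, and it is (anti)holomorphic when written in the
coordinates around `z` and `f z`. -/
def HoloOn (anti : Bool) (f : Sphere → Sphere) (U : Set Sphere) : Prop :=
  IsOpen U ∧ ∀ z ∈ U, ContinuousAt f z ∧
    DifferentiableAt ℂ (fun t => conjIf anti (Sphere.coord (f z) (f (Sphere.param z t))))
      (Sphere.coord z z)

/-! ## (Anti)holomorphic correspondences -/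

/-- The data of a holomorphic (if `anti = false`) or antiholomorphic (if `anti = true`)
correspondence: a nonzero polynomial `P`. The variable `0` of `P` is `z` (or `conj z`), the
variable `1` is `w`. -/
structure Correspondence where
  P : MvPolynomial (Fin 2) ℂ
  ne_zero : P ≠ 0
  anti : Bool

namespace Correspondence

variable (F : Correspondence)

/-- The bihomogenisation of `P`, with respect to its degrees in `z` and in `w`. -/
def bihom (a b : ℂ × ℂ) : ℂ :=
  ∑ m ∈ F.P.support, F.P.coeff m *
    (a.1 ^ (m 0) * a.2 ^ (F.P.degreeOf 0 - m 0)) * (b.1 ^ (m 1) * b.2 ^ (F.P.degreeOf 1 - m 1))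

/-- The curve `Γ` in the product of two spheres given by `P(z, w) = 0` (or `P(conj z, w) = 0`). -/
def graph : Set (Sphere × Sphere) :=
  {p | F.bihom (conjIf F.anti (Sphere.hom p.1).1, conjIf F.anti (Sphere.hom p.1).2)
    (Sphere.hom p.2) = 0}

/-- The set of values `F(z)`. -/
def val (z : Sphere) : Set Sphere := {w | (z, w) ∈ F.graph}

/-- The set of values `Fⁿ(z)` of the `n`-th iterate; `F⁰` is the identity. -/
def iter : ℕ → Sphere → Set Sphere
  | 0, z => {z}
  | n + 1, z => ⋃ y ∈ iter n z, F.val y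

/-- The image `Fⁿ(S)`. -/
def image (n : ℕ) (S : Set Sphere) : Set Sphere := ⋃ z ∈ S, F.iter n z

/-- The preimage `F⁻ⁿ(S)`. -/
def preimage (n : ℕ) (S : Set Sphere) : Set Sphere := {z | (F.iter n z ∩ S).Nonempty}

/-- The forward limit set `Λ₊(x)`. -/
def limitSet (x : Sphere) : Set Sphere := ⋂ n : ℕ, closure (⋃ k ≥ n, F.iter k x)

/-- Whether the branches of `Fⁿ` are antiholomorphic. -/
def antiIter (n : ℕ) : Bool := F.anti && decide (Odd n)

/-- All branches of `Fⁿ` are defined in the open set `W`, and `f` is one of them. -/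
def IsBranch (n : ℕ) (W : Set Sphere) (f : Sphere → Sphere) : Prop :=
  ∃ (M : ℕ) (fs : Fin M → Sphere → Sphere),
    (∀ j, HoloOn (F.antiIter n) (fs j) W) ∧
    (∀ z ∈ W, F.iter n z = range (fun j => fs j z)) ∧
    ∃ j, EqOn f (fs j) W

/-! ## Critical values, postcritical set, singular points -/

/-- The regular points of `Γ`: near such a point `Γ` is a smooth curve, i.e. the graph of an
(anti)holomorphic function of `z` or of `w`. -/
def regularPoints : Set (Sphere × Sphere) :=
  {a | a ∈ F.graph ∧ ∃ (A B : Set Sphere) (h : Sphere → Sphere),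
    IsOpen A ∧ IsOpen B ∧ a.1 ∈ A ∧ a.2 ∈ B ∧
    ((HoloOn F.anti h A ∧ ∀ z ∈ A, ∀ w ∈ B, ((z, w) ∈ F.graph ↔ w = h z)) ∨
     (HoloOn F.anti h B ∧ ∀ z ∈ A, ∀ w ∈ B, ((z, w) ∈ F.graph ↔ z = h w)))}

/-- `C` is an irreducible component of `Γ ∩ W` (with `W` open): the closure in `Γ ∩ W` of a
connected component of the set of regular points of `Γ ∩ W`. -/
def IsIrredComponent (W C : Set (Sphere × Sphere)) : Prop :=
  ∃ p ∈ F.regularPoints ∩ W,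
    C = closure (connectedComponentIn (F.regularPoints ∩ W) p) ∩ (F.graph ∩ W)

/-- The critical values of `F⁻¹`: the projections to the first coordinate of the points `a` of `Γ`
such that, for each open neighbourhood `W` of `a`, this projection is not injective on
some irreducible component of `Γ ∩ W`. -/
def critValInv : Set Sphere :=
  Prod.fst '' {a | a ∈ F.graph ∧ ∀ W : Set (Sphere × Sphere), IsOpen W → a ∈ W →
    ∃ C, F.IsIrredComponent W C ∧ ¬ InjOn Prod.fst C}

/-- The postcritical set of `F⁻¹`. -/
def postcritInv : Set Sphere := closure (⋃ i : ℕ, F.preimage i F.critValInv)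

/-- The singular points of `F`. -/
def sing : Set Sphere :=
  Prod.fst '' {a | a ∈ F.graph ∧ ∀ W ∈ 𝓝 a, ¬ InjOn Prod.fst (F.graph ∩ W)}

/-! ## Parabolic periodic points -/

/-- `ω` is a parabolic periodic point: some branch `f` of some `F^q`, `q ≥ 1`, near `ω` fixes `ω`,
and some iterate `fⁿ`, `n ≥ 1`, has derivative `1` at `ω`. -/
def IsParabolic (ω : Sphere) : Prop :=
  ∃ q ≥ 1, ∃ (W : Set Sphere) (f : Sphere → Sphere), ω ∈ W ∧ F.IsBranch q W f ∧ f ω = ω ∧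
    ∃ n ≥ 1, HasDerivAt (fun t => Sphere.coord ω (f^[n] (Sphere.param ω t))) 1 (Sphere.coord ω ω)

/-- The set `Ω₊(x)` of parabolic periodic points in `Λ₊(x)`. -/
def parabolicSet (x : Sphere) : Set Sphere := {ω | ω ∈ F.limitSet x ∧ F.IsParabolic ω}

/-- `U` is a pinched neighbourhood of `ω`: the closure of an open set with finitely many connected
components, the closure of each of which contains `ω`. -/
def IsPinchedNhd (ω : Sphere) (U : Set Sphere) : Prop :=
  ∃ V : Set Sphere, IsOpen V ∧ U = closure V ∧
    {K | ∃ z ∈ V, K = connectedComponentIn V z}.Finite ∧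
    ∀ z ∈ V, ω ∈ closure (connectedComponentIn V z)

/-- `F` is locally `Ω₊(x)`-attracting on `Λ₊(x)`. A branch of `F^q` fixing `ω` is understood as a
germ at `ω`, so it may be represented on any domain `W'` on which it is a branch. -/
def IsLocallyAttracting (x : Sphere) : Prop :=
  ∀ ω ∈ F.parabolicSet x, ∀ q ≥ 1, ∀ (W : Set Sphere) (T : Sphere → Sphere),
    ω ∈ W → F.IsBranch q W T → T ω = ω →
    ∃ (W' : Set Sphere) (T' : Sphere → Sphere) (U : Set Sphere),
      ω ∈ W' ∧ F.IsBranch q W' T' ∧ T' =ᶠ[𝓝 ω] T ∧ IsPinchedNhd ω U ∧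
      (∀ᶠ V in (𝓝 ω).smallSets, F.limitSet x ∩ V = F.limitSet x ∩ V ∩ U) ∧
      ∀ z ∈ U, (∀ n : ℕ, T'^[n] z ∈ W') ∧ Tendsto (fun n : ℕ => T'^[n] z) atTop (𝓝 ω)

/-! ## Relative hyperbolicity and minimality -/

/-- `F` is invariantly inverse-like on `S`. -/
def IsInverseLike (S : Set Sphere) : Prop :=
  F.image 1 S ⊆ S ∧ ∀ w ∈ F.image 1 S, ∃! z, z ∈ S ∧ w ∈ F.val z

/-- For `F` invariantly inverse-like on `S`, the map `g : F(S) → S` sending `w` to the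
unique `z ∈ S` with `w ∈ F(z)` (arbitrary outside `F(S)`). -/
def invMap (S : Set Sphere) (w : Sphere) : Sphere :=
  Classical.epsilon fun z => z ∈ S ∧ w ∈ F.val z

/-- `F` is relatively hyperbolic on `Λ₊(x)`. -/
structure IsRelativelyHyperbolic (x : Sphere) : Prop where
  inverseLike : F.IsInverseLike (F.limitSet x)
  nonbranched : F.limitSet x ∩ F.critValInv = ∅
  attracting : F.IsLocallyAttracting x
  postcrit : F.limitSet x ∩ F.postcritInv ⊆ F.parabolicSet x

/-- `Λ₊(x)` is minimal. -/
structure IsMinimalLimitSet (x : Sphere) : Prop where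
  inverseLike : F.IsInverseLike (F.limitSet x)
  interior_eq : interior (F.limitSet x) = ∅
  closed_invariant : ∀ A : Set Sphere, A ⊆ F.limitSet x → IsClosed A → A.Nonempty →
    F.image 1 A ⊆ A → A = F.limitSet x
  nonsingular : F.limitSet x ∩ (F.sing \ F.critValInv) = ∅
  extension : ∀ z ∈ F.limitSet x \ F.parabolicSet x, ∃ U ∈ 𝓝 z,
    (∀ n : ℕ, ∃ G : Sphere → Sphere,
      EqOn G ((F.invMap (F.limitSet x))^[n]) (F.image n (F.limitSet x)) ∧
      ∀ y ∈ U, G '' F.iter n y = {y}) ∧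
    (∀ y ∈ U, F.limitSet y ⊆ F.limitSet x) ∧
    3 ≤ (⋃ n : ℕ, F.image n U)ᶜ.encard
  finite_parabolic : (F.parabolicSet x).Finite

/-- The set `X` of the points of `Λ₊(x)` that do not lie in the forward orbit of `Ω₊(x)`. -/
def nonParabolicPart (x : Sphere) : Set Sphere :=
  F.limitSet x \ ⋃ n : ℕ, F.image n (F.parabolicSet x)

end Correspondence

/-- The area of a subset of the sphere: the two-dimensional Lebesgue measure of its finite part. -/
def area (S : Set Sphere) : ENNReal := volume {z : ℂ | (z : Sphere) ∈ S}

/-- `S` is porous at `z`: for some `c > 0` there are arbitrarily small discs around `z`, of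
radius `r`, that contain a disc of radius `c * r` disjoint from `S`. Discs are taken in the local
coordinate at `z`, which is bi-Lipschitz for the spherical metric near `z`. -/
def PorousAt (S : Set Sphere) (z : Sphere) : Prop :=
  ∃ c > 0, ∀ ε > 0, ∃ r > 0, r < ε ∧ ∃ t : ℂ,
    Metric.ball t (c * r) ⊆ Metric.ball (Sphere.coord z z) r ∧
    ∀ s ∈ Metric.ball t (c * r), Sphere.param z s ∉ S

end

/-! ## Univalent functions -/

section Univalent

open Metric

/-! On Λ = Λ₊(x) the correspondence has a continuous inverse map g = `F.invMap Λ`, defined on all of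
Λ because F(Λ) is closed, nonempty and forward invariant, hence equal to Λ by minimality. A point z
of Λ is studied along its backward orbit gⁿ(z), and branches of Fⁿ transport geometry from gⁿ(z)
back to z.

Suppose gⁿ(z) accumulates at some y in Λ outside Ω₊(x). Near y all forward orbits avoid the critical
values of F⁻¹, different starting points have disjoint orbits at each time n, and two points of the
sphere are never reached. So over a fixed disc around y every orbit extends to a tower of univalent
curves (`IsUnbranchedDisc.exists_tower`), obtained by lifting the disc through Γ. Curves omitting
two points are equicontinuous (`tendsto_of_tendsto_univalentCurve`). The branches that send gⁿ(z) to
z must shrink (`eventually_mapsTo_of_isUnivalentCurve`): otherwise their images would contain a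
fixed disc around z, each point of which is a limit of points of Fⁿ(b) for some b near y, so that Λ
would have interior. Since Λ has empty interior there is a hole of Λ near y; Koebe distortion turns
it into holes near z whose size is comparable to their distance from z, at arbitrarily small scales.
This is porosity at z.

It remains to exclude that the backward orbit of a point of X accumulates only on the finite set
Ω₊(x) (`exists_mapClusterPt`). In that case a subsequence g^{Mk}(z) converges to one ω in Ω₊(x), and
`HasAttractingInverse.exists_iterate_eq` shows that it then reaches ω, so z lies in the forward
orbit of ω. The reason: if a tail point p ≠ ω had its whole backward orbit close to ω, approximate p
by points of the forward orbit of ω, which is dense. Their backward orbits leave the neighbourhood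
of ω, after longer and longer times, at exit points accumulating at a nonparabolic ys. Following
branches forward from ys gives iterates of the local attracting branch T, which tend to ω;
equicontinuity says that they tend to p. Hence p = ω, a contradiction.

Finally Λ without X is countable, and a set has no density points where it is porous, so Λ is null.
The Koebe theorem is needed only with crude constants, and it is derived from the Borel–Carathéodory
inequality. -/

theorem nhds_le_map_of_injOn {f : ℂ → ℂ} {U : Set ℂ} (hU : IsOpen U) (hf : DifferentiableOn ℂ f U)
    (hinj : InjOn f U) {z : ℂ} (hz : z ∈ U) : 𝓝 (f z) ≤ map f (𝓝 z) := by
  have han : AnalyticAt ℂ f z := hf.analyticAt (hU.mem_nhds hz)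
  rcases han.eventually_constant_or_nhds_le_map_nhds with h | h
  · exfalso
    have h1 : ∀ᶠ w in 𝓝[≠] z, f w = f z ∧ w ∈ U :=
      (h.and (hU.mem_nhds hz)).filter_mono nhdsWithin_le_nhds
    obtain ⟨w, ⟨hw, hwU⟩, hne⟩ := (h1.and self_mem_nhdsWithin).exists
    exact hne (hinj hwU hz hw)
  · exact h

theorem isOpen_image_of_injOn {f : ℂ → ℂ} {U : Set ℂ} (hU : IsOpen U)
    (hf : DifferentiableOn ℂ f U) (hinj : InjOn f U) : IsOpen (f '' U) := by
  rw [isOpen_iff_mem_nhds]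
  rintro _ ⟨z, hz, rfl⟩
  exact nhds_le_map_of_injOn hU hf hinj hz (image_mem_map (hU.mem_nhds hz))

theorem continuousAt_invFunOn {f : ℂ → ℂ} {U : Set ℂ} (hU : IsOpen U)
    (hf : DifferentiableOn ℂ f U) (hinj : InjOn f U) {z : ℂ} (hz : z ∈ U) :
    ContinuousAt (Function.invFunOn f U) (f z) := by
  rw [ContinuousAt, hinj.leftInvOn_invFunOn hz]
  refine (map_mono (nhds_le_map_of_injOn hU hf hinj hz)).trans ?_
  rw [Filter.map_map]
  refine (tendsto_id.congr' ?_ : Tendsto (Function.invFunOn f U ∘ f) (𝓝 z) (𝓝 z))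
  filter_upwards [hU.mem_nhds hz] with w hw
  exact (hinj.leftInvOn_invFunOn hw).symm

theorem eventually_right_inverse_invFunOn {f : ℂ → ℂ} {U : Set ℂ} (hU : IsOpen U)
    (hf : DifferentiableOn ℂ f U) (hinj : InjOn f U) {z : ℂ} (hz : z ∈ U) :
    ∀ᶠ w in 𝓝 (f z), f (Function.invFunOn f U w) = w := by
  filter_upwards [(isOpen_image_of_injOn hU hf hinj).mem_nhds (mem_image_of_mem f hz)] with w hw
  exact Function.invFunOn_eq hw

/-- Zeros of f' are isolated, since otherwise f would be locally constant. Away from them the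
inverse is differentiable; at f(z) it is continuous, so the singularity is removable, and the chain
rule applied to the identity forbids f'(z) = 0. -/
theorem deriv_ne_zero_of_injOn {f : ℂ → ℂ} {U : Set ℂ} (hU : IsOpen U)
    (hf : DifferentiableOn ℂ f U) (hinj : InjOn f U) {z : ℂ} (hz : z ∈ U) : deriv f z ≠ 0 := by
  set ψ := Function.invFunOn f U with hψ
  have han : AnalyticAt ℂ (deriv f) z := (hf.analyticAt (hU.mem_nhds hz)).deriv
  have hne : ∀ᶠ w in 𝓝[≠] z, deriv f w ≠ 0 := by
    rcases han.eventually_eq_zero_or_eventually_ne_zero with h | h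
    · exfalso
      obtain ⟨ε, hε, hb⟩ := Metric.eventually_nhds_iff_ball.1 (h.and (hU.mem_nhds hz))
      have hconst : ∀ w ∈ ball z ε, f w = f z := fun w hw =>
        isOpen_ball.is_const_of_deriv_eq_zero (convex_ball z ε).isPreconnected
          (hf.mono fun w hw => (hb w hw).2) (fun w hw => (hb w hw).1) hw (mem_ball_self hε)
      have : ∀ᶠ w in 𝓝[≠] z, w ∈ ball z ε := nhdsWithin_le_nhds (ball_mem_nhds z hε)
      obtain ⟨w, hw, hwz⟩ := (this.and self_mem_nhdsWithin).exists
      exact hwz (hinj (hb w hw).2 hz (hconst w hw))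
    · exact h
  have hd : ∀ᶠ w in 𝓝[≠] (f z), DifferentiableAt ℂ ψ w := by
    have hcont : Tendsto ψ (𝓝[≠] (f z)) (𝓝[≠] z) := by
      refine tendsto_nhdsWithin_iff.2 ⟨?_, ?_⟩
      · have := continuousAt_invFunOn hU hf hinj hz
        rw [ContinuousAt, hinj.leftInvOn_invFunOn hz] at this
        exact this.mono_left nhdsWithin_le_nhds
      · filter_upwards [nhdsWithin_le_nhds (eventually_right_inverse_invFunOn hU hf hinj hz),
          self_mem_nhdsWithin] with w hw hwne h
        exact hwne (by rw [← hw]; exact congrArg f h)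
    filter_upwards [hcont.eventually hne, nhdsWithin_le_nhds
      ((isOpen_image_of_injOn hU hf hinj).mem_nhds (mem_image_of_mem f hz))] with w hw hwU
    obtain ⟨v, hv, rfl⟩ := hwU
    have hψv : ψ (f v) = v := hinj.leftInvOn_invFunOn hv
    have hc := continuousAt_invFunOn hU hf hinj hv
    refine (HasDerivAt.of_local_left_inverse hc (f' := deriv f v) ?_ ?_
      (eventually_right_inverse_invFunOn hU hf hinj hv)).differentiableAt
    · rw [← hψ, hψv]
      exact (hf.differentiableAt (hU.mem_nhds hv)).hasDerivAt
    · rwa [hψv] at hw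
  have hψd : DifferentiableAt ℂ ψ (f z) :=
    (Complex.analyticAt_of_differentiable_on_punctured_nhds_of_continuousAt hd
      (continuousAt_invFunOn hU hf hinj hz)).differentiableAt
  have hcomp : HasDerivAt (ψ ∘ f) (deriv ψ (f z) * deriv f z) z :=
    hψd.hasDerivAt.comp z (hf.differentiableAt (hU.mem_nhds hz)).hasDerivAt
  have hid : HasDerivAt (ψ ∘ f) 1 z := by
    refine (hasDerivAt_id z).congr_of_eventuallyEq ?_
    filter_upwards [hU.mem_nhds hz] with w hw
    exact hinj.leftInvOn_invFunOn hw
  intro h0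
  have := hcomp.unique hid
  rw [h0, mul_zero] at this
  exact zero_ne_one this

theorem hasDerivAt_invFunOn {f : ℂ → ℂ} {U : Set ℂ} (hU : IsOpen U)
    (hf : DifferentiableOn ℂ f U) (hinj : InjOn f U) {z : ℂ} (hz : z ∈ U) :
    HasDerivAt (Function.invFunOn f U) (deriv f z)⁻¹ (f z) := by
  refine HasDerivAt.of_local_left_inverse (continuousAt_invFunOn hU hf hinj hz) ?_
    (deriv_ne_zero_of_injOn hU hf hinj hz) (eventually_right_inverse_invFunOn hU hf hinj hz)
  rw [hinj.leftInvOn_invFunOn hz]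
  exact (hf.differentiableAt (hU.mem_nhds hz)).hasDerivAt

/-- A nonvanishing holomorphic function on a disc has a holomorphic logarithm. -/
theorem exists_log_of_ne_zero {g : ℂ → ℂ} {c : ℂ} {R : ℝ} (hR : 0 < R)
    (hg : DifferentiableOn ℂ g (ball c R)) (h0 : ∀ z ∈ ball c R, g z ≠ 0) :
    ∃ L : ℂ → ℂ, DifferentiableOn ℂ L (ball c R) ∧ L c = 0 ∧
      ∀ z ∈ ball c R, g z = g c * Complex.exp (L z) := by
  have hd : DifferentiableOn ℂ (fun z => deriv g z / g z) (ball c R) :=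
    (hg.deriv isOpen_ball).div hg h0
  obtain ⟨L, hLc, hL⟩ := hd.isExactOn_ball.with_val_at c 0
  refine ⟨L, fun z hz => (hL z hz).differentiableAt.differentiableWithinAt, hLc, fun z hz => ?_⟩
  have hder : ∀ w ∈ ball c R, HasDerivAt (fun w => g w * Complex.exp (-L w)) 0 w := by
    intro w hw
    have h1 := (hg.differentiableAt (isOpen_ball.mem_nhds hw)).hasDerivAt.mul (hL w hw).neg.cexp
    convert! h1 using 1
    have := h0 w hw
    field_simp
    ring
  have hc := isOpen_ball.is_const_of_deriv_eq_zero (convex_ball c R).isPreconnected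
    (fun w hw => (hder w hw).differentiableAt.differentiableWithinAt)
    (fun w hw => (hder w hw).deriv) hz (mem_ball_self hR)
  simp only [hLc, neg_zero, Complex.exp_zero, mul_one] at hc
  rw [← hc, mul_assoc, ← Complex.exp_add]
  simp

/-- The square root h of 1 - f omits a disc around -1. Over the part where |f| < 1, the square of h
has positive real part, so Re h never vanishes there and keeps the sign it has at 0. If h(w) were
near -1, then f(w) = 1 - h(w)² would be small, and w would lie in that part with Re h(w) < 0. -/
theorem norm_add_one_ge_of_sq_eq {f h : ℂ → ℂ} (hf : DifferentiableOn ℂ f (ball 0 1))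
    (hinj : InjOn f (ball 0 1)) (h0 : f 0 = 0) (hsub : ball (0 : ℂ) 1 ⊆ f '' ball 0 1)
    (hh : ContinuousOn h (ball 0 1)) (hh0 : h 0 = 1)
    (hsq : ∀ z ∈ ball (0 : ℂ) 1, h z ^ 2 = 1 - f z) {w : ℂ} (hw : w ∈ ball (0 : ℂ) 1) :
    1 / 4 ≤ ‖h w + 1‖ := by
  by_contra! hlt
  set ψ := Function.invFunOn f (ball (0 : ℂ) 1) with hψ
  have hψm : ∀ u ∈ ball (0 : ℂ) 1, ψ u ∈ ball (0 : ℂ) 1 ∧ f (ψ u) = u := fun u hu =>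
    ⟨Function.invFunOn_mem (hsub hu), Function.invFunOn_eq (hsub hu)⟩
  have hψc : ContinuousOn ψ (ball 0 1) := by
    intro u hu
    obtain ⟨v, hv, rfl⟩ := hsub hu
    exact (continuousAt_invFunOn isOpen_ball hf hinj hv).continuousWithinAt
  have hc : ContinuousOn (fun u => (h (ψ u)).re) (ball 0 1) :=
    Complex.continuous_re.comp_continuousOn (hh.comp hψc fun u hu => (hψm u hu).1)
  have hne : ∀ u ∈ ball (0 : ℂ) 1, (h (ψ u)).re ≠ 0 := by
    intro u hu hre
    have h1 := hsq _ (hψm u hu).1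
    rw [(hψm u hu).2] at h1
    have h2 := congrArg Complex.re h1
    simp only [sq, Complex.mul_re, hre, Complex.sub_re, Complex.one_re] at h2
    have h3 : u.re < 1 := (Complex.re_le_norm u).trans_lt (by simpa using hu)
    nlinarith [mul_self_nonneg (h (ψ u)).im]
  have hψ0 : ψ 0 = 0 := by
    have := hinj.leftInvOn_invFunOn (mem_ball_self (x := (0 : ℂ)) one_pos)
    rwa [h0] at this
  have hpos : ∀ u ∈ ball (0 : ℂ) 1, 0 < (h (ψ u)).re := by
    intro u hu
    by_contra! hle
    have hpre := (convex_ball (0 : ℂ) 1).isPreconnected.image _ hc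
    have hmem : (0 : ℝ) ∈ (fun u => (h (ψ u)).re) '' ball 0 1 :=
      hpre.Icc_subset (mem_image_of_mem _ hu) (mem_image_of_mem _ (mem_ball_self one_pos))
        ⟨hle, by simp [hψ0, hh0]⟩
    obtain ⟨v, hv, hv0⟩ := hmem
    exact hne v hv hv0
  -- Here |f(w)| = |1 + h||1 - h| < (1/4)(2 + 1/4) < 1.
  have hfw : f w ∈ ball (0 : ℂ) 1 := by
    have h1 : f w = (1 + h w) * (1 - h w) := by linear_combination hsq w hw
    have h2 : ‖1 - h w‖ ≤ 2 + ‖h w + 1‖ := by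
      calc ‖1 - h w‖ = ‖2 - (h w + 1)‖ := by ring_nf
        _ ≤ ‖(2 : ℂ)‖ + ‖h w + 1‖ := norm_sub_le _ _
        _ = _ := by simp
    rw [mem_ball_zero_iff, h1, norm_mul, add_comm 1]
    nlinarith [norm_nonneg (h w + 1), norm_nonneg (1 - h w)]
  have h5 := hpos _ hfw
  rw [hψ, hinj.leftInvOn_invFunOn hw] at h5
  have h6 := (Complex.abs_re_le_norm (h w + 1)).trans_lt hlt
  rw [abs_lt, Complex.add_re, Complex.one_re] at h6
  linarith [h6.2]

/-- Since h + 1 stays away from 0, it has a logarithm whose real part is bounded below;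
Borel–Carathéodory converts this into a two-sided bound on the half disc, and f = 1 - h² is bounded
there. -/
theorem norm_le_of_injOn_unit_ball {f : ℂ → ℂ} (hf : DifferentiableOn ℂ f (ball 0 1))
    (hinj : InjOn f (ball 0 1)) (h0 : f 0 = 0) (h1 : ∀ z ∈ ball (0 : ℂ) 1, f z ≠ 1)
    (hsub : ball (0 : ℂ) 1 ⊆ f '' ball 0 1) {w : ℂ} (hw : ‖w‖ ≤ 1 / 2) : ‖f w‖ ≤ 20000 := by
  have hw1 : w ∈ ball (0 : ℂ) 1 := by rw [mem_ball_zero_iff]; linarith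
  have z1 : (0 : ℂ) ∈ ball (0 : ℂ) 1 := mem_ball_self one_pos
  obtain ⟨L, hL, hL0, hLe⟩ := exists_log_of_ne_zero one_pos (g := fun z => 1 - f z)
    (hf.const_sub 1) fun z hz => sub_ne_zero.2 (h1 z hz).symm
  simp only [h0, sub_zero, one_mul] at hLe
  set h : ℂ → ℂ := fun z => Complex.exp (L z / 2) with hh
  have hhd : DifferentiableOn ℂ h (ball 0 1) := (hL.div_const 2).cexp
  have hsq : ∀ z ∈ ball (0 : ℂ) 1, h z ^ 2 = 1 - f z := by
    intro z hz
    rw [hLe z hz, hh, ← Complex.exp_nat_mul]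
    congr 1
    push_cast
    ring
  have hh0 : h 0 = 1 := by simp [hh, hL0]
  have hge : ∀ z ∈ ball (0 : ℂ) 1, 1 / 4 ≤ ‖h z + 1‖ := fun z hz =>
    norm_add_one_ge_of_sq_eq hf hinj h0 hsub hhd.continuousOn hh0 hsq hz
  have hne : ∀ z ∈ ball (0 : ℂ) 1, h z + 1 ≠ 0 := fun z hz hz0 => by
    have := hge z hz
    rw [hz0, norm_zero] at this
    linarith
  obtain ⟨Q, hQ, hQ0, hQe⟩ := exists_log_of_ne_zero one_pos (g := fun z => h z + 1)
    (hhd.add_const 1) hne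
  simp only [hh0] at hQe
  -- As h(0) + 1 = 2, the bound 1/4 ≤ |h + 1| reads exp(Re Q) ≥ 1/8.
  have hre : MapsTo (fun z => -Q z) (ball (0 : ℂ) 1) {z | z.re ≤ Real.log 8} := by
    intro z hz
    have h2 := hge z hz
    rw [hQe z hz, norm_mul, Complex.norm_exp] at h2
    have h3 : (1 : ℝ) / 8 ≤ Real.exp (Q z).re := by
      norm_num at h2 ⊢
      linarith
    have h4 := Real.log_le_log (by norm_num) h3
    rw [Real.log_exp, one_div, Real.log_inv] at h4
    simp only [mem_ofPred_eq, Complex.neg_re]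
    linarith
  have hlog : 0 < Real.log 8 := Real.log_pos (by norm_num)
  have hQb := Complex.borelCaratheodory_zero hlog hQ.neg hre one_pos hw1 (by simp [hQ0])
  have hQb2 : ‖Q w‖ ≤ 2 * Real.log 8 := by
    rw [Pi.neg_apply, norm_neg] at hQb
    refine hQb.trans ?_
    rw [div_le_iff₀ (by linarith)]
    nlinarith
  -- 128 = 2 · 8², and 1 + 129² < 20000 below.
  have hb : ‖h w + 1‖ ≤ 128 := by
    rw [hQe w hw1, norm_mul, Complex.norm_exp]
    have h5 : Real.exp (Q w).re ≤ Real.exp (2 * Real.log 8) :=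
      Real.exp_le_exp.2 ((Complex.re_le_norm _).trans hQb2)
    rw [mul_comm 2, Real.exp_mul, Real.exp_log (by norm_num)] at h5
    norm_num at h5 ⊢
    linarith
  have hhw : ‖h w‖ ≤ 129 := by
    calc ‖h w‖ = ‖(h w + 1) - 1‖ := by ring_nf
      _ ≤ ‖h w + 1‖ + ‖(1 : ℂ)‖ := norm_sub_le _ _
      _ ≤ 129 := by rw [norm_one]; linarith
  have hfw : f w = 1 - h w ^ 2 := by rw [hsq w hw1]; ring
  calc ‖f w‖ ≤ ‖(1 : ℂ)‖ + ‖h w ^ 2‖ := by rw [hfw]; exact norm_sub_le _ _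
    _ ≤ 20000 := by
      rw [norm_one, norm_pow]
      nlinarith [norm_nonneg (h w)]

/-- Growth of a univalent function in terms of the inner radius of its image. -/
theorem exists_innerRadius_of_injOn {f : ℂ → ℂ} {c a : ℂ} {R : ℝ} (hR : 0 < R)
    (hf : DifferentiableOn ℂ f (ball c R)) (hinj : InjOn f (ball c R)) (ha : a ∉ f '' ball c R) :
    ∃ δ > 0, ball (f c) δ ⊆ f '' ball c R ∧
      ∀ w ∈ closedBall c (R / 2), ‖f w - f c‖ ≤ 20000 * δ := by
  have hopen := isOpen_image_of_injOn isOpen_ball hf hinj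
  -- The nearest omitted value b is sent to 1 by the normalisation `k` below, which makes the image
  -- contain the unit disc.
  obtain ⟨b, hb, hbd⟩ := hopen.isClosed_compl.exists_infDist_eq_dist ⟨a, ha⟩ (f c)
  have hcb : f c ≠ b := fun h => hb (h ▸ mem_image_of_mem f (mem_ball_self hR))
  set δ := dist (f c) b with hδ
  have hδ0 : 0 < δ := dist_pos.2 hcb
  have hsub : ball (f c) δ ⊆ f '' ball c R := by
    intro v hv
    by_contra hv'
    have := Metric.infDist_le_dist_of_mem (x := f c) (mem_compl hv')
    rw [hbd, dist_comm (f c) v] at this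
    exact absurd (mem_ball.1 hv) (not_lt.2 this)
  refine ⟨δ, hδ0, hsub, fun w hw => ?_⟩
  have hbc : b - f c ≠ 0 := sub_ne_zero.2 hcb.symm
  have hRc : (R : ℂ) ≠ 0 := by exact_mod_cast hR.ne'
  have hm : ∀ ζ ∈ ball (0 : ℂ) 1, c + R * ζ ∈ ball c R := by
    intro ζ hζ
    rw [mem_ball_iff_norm, add_sub_cancel_left, norm_mul, Complex.norm_real, Real.norm_of_nonneg hR.le]
    rw [mem_ball_zero_iff] at hζ
    nlinarith
  set k : ℂ → ℂ := fun ζ => (f (c + R * ζ) - f c) / (b - f c) with hk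
  have hnb : ‖b - f c‖ = δ := by rw [hδ, dist_eq_norm, norm_sub_rev]
  have key : ‖k ((w - c) / R)‖ ≤ 20000 := by
    refine norm_le_of_injOn_unit_ball ?_ ?_ ?_ ?_ ?_ ?_
    · refine DifferentiableOn.div_const (DifferentiableOn.sub_const ?_ _) _
      refine hf.comp ?_ hm
      fun_prop
    · intro x hx y hy hxy
      simp only [hk] at hxy
      rw [div_left_inj' hbc, sub_left_inj] at hxy
      have := hinj (hm x hx) (hm y hy) hxy
      exact mul_left_cancel₀ hRc (add_left_cancel this)
    · simp [hk]
    · intro z hz h1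
      simp only [hk] at h1
      rw [div_eq_one_iff_eq hbc, sub_left_inj] at h1
      exact hb (h1 ▸ mem_image_of_mem f (hm z hz))
    · intro u hu
      have hmem : f c + (b - f c) * u ∈ ball (f c) δ := by
        rw [mem_ball_iff_norm, add_sub_cancel_left, norm_mul, hnb]
        rw [mem_ball_zero_iff] at hu
        nlinarith
      obtain ⟨v, hv, hvu⟩ := hsub hmem
      refine ⟨(v - c) / R, ?_, ?_⟩
      · rw [mem_ball_zero_iff, norm_div, Complex.norm_real, Real.norm_of_nonneg hR.le,
          div_lt_one hR]
        exact mem_ball_iff_norm.1 hv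
      · simp only [hk]
        rw [mul_div_cancel₀ _ hRc, add_sub_cancel, hvu, add_sub_cancel_left, mul_div_cancel_left₀ _ hbc]
    · rw [norm_div, Complex.norm_real, Real.norm_of_nonneg hR.le, div_le_iff₀ hR]
      have := mem_closedBall_iff_norm.1 hw
      linarith
  simp only [hk] at key
  rw [mul_div_cancel₀ _ hRc, add_sub_cancel, norm_div, hnb, div_le_iff₀ hδ0] at key
  exact key

/-- Koebe distortion for univalent functions omitting a value, with unspecified constants. -/
theorem koebe_distortion {f : ℂ → ℂ} {c a : ℂ} {R : ℝ} (hR : 0 < R)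
    (hf : DifferentiableOn ℂ f (ball c R)) (hinj : InjOn f (ball c R)) (ha : a ∉ f '' ball c R) :
    ball (f c) (R * ‖deriv f c‖ / 40000) ⊆ f '' ball c R ∧
      ∀ w ∈ closedBall c (R / 2), ‖f w - f c‖ ≤ 20000 * (R * ‖deriv f c‖) := by
  obtain ⟨δ, hδ, hsub, hgr⟩ := exists_innerRadius_of_injOn hR hf hinj ha
  have hcm : c ∈ ball c R := mem_ball_self hR
  -- Schwarz-type estimate for the inverse, which maps the disc of radius δ around f(c) into the
  -- disc of radius R around c.
  have h1 : δ ≤ R * ‖deriv f c‖ := by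
    have hψc : Function.invFunOn f (ball c R) (f c) = c := hinj.leftInvOn_invFunOn hcm
    have hd : DifferentiableOn ℂ (Function.invFunOn f (ball c R)) (ball (f c) δ) := by
      intro u hu
      obtain ⟨v, hv, rfl⟩ := hsub hu
      exact (hasDerivAt_invFunOn isOpen_ball hf hinj hv).differentiableAt.differentiableWithinAt
    have hmaps : MapsTo (Function.invFunOn f (ball c R)) (ball (f c) δ)
        (closedBall (Function.invFunOn f (ball c R) (f c)) R) := by
      intro u hu
      rw [hψc]
      exact ball_subset_closedBall (Function.invFunOn_mem (hsub hu))
    have := Complex.norm_deriv_le_div_of_mapsTo_ball hd hmaps hδ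
    rw [(hasDerivAt_invFunOn isOpen_ball hf hinj hcm).deriv, norm_inv] at this
    have hpos : 0 < ‖deriv f c‖ := norm_pos_iff.2 (deriv_ne_zero_of_injOn isOpen_ball hf hinj hcm)
    rw [le_div_iff₀ hδ, inv_mul_le_iff₀ hpos] at this
    linarith
  -- Cauchy's estimate on the circle of radius R/2, using the growth bound.
  have h2 : ‖deriv f c‖ ≤ 20000 * δ / (R / 2) := by
    have hs : closedBall c (R / 2) ⊆ ball c R := closedBall_subset_ball (by linarith)
    have := Complex.norm_deriv_le_of_forall_mem_sphere_norm_le (f := fun z => f z - f c)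
      (half_pos hR) (((hf.mono hs).sub_const (f c)).diffContOnCl_ball subset_rfl)
      (fun z hz => hgr z (sphere_subset_closedBall hz))
    rwa [deriv_sub_const] at this
  refine ⟨(ball_subset_ball ?_).trans hsub, fun w hw => (hgr w hw).trans (by gcongr)⟩
  rw [le_div_iff₀ (by positivity)] at h2
  linarith

end Univalent

/-! ## Zero sets of polynomials in two variables that are graphs -/

section BivariatePolynomial

open Polynomial Metric

/-- Evaluation of a bivariate polynomial. -/
noncomputable def biEval (p : ℂ[X][X]) (s t : ℂ) : ℂ := (p.map (evalRingHom s)).eval t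

theorem biEval_eq_sum (p : ℂ[X][X]) (s t : ℂ) :
    biEval p s t = ∑ i ∈ p.support, (p.coeff i).eval s * t ^ i := by
  rw [biEval, eval_map, eval₂_eq_sum, Polynomial.sum]
  rfl

theorem contDiff_biEval (p : ℂ[X][X]) : ContDiff ℂ 1 fun x : ℂ × ℂ => biEval p x.1 x.2 := by
  simp only [biEval_eq_sum]
  refine ContDiff.sum fun i _ => ?_
  exact ((p.coeff i).contDiff_aeval 1 |>.comp contDiff_fst).mul (contDiff_snd.pow i)

theorem continuous_biEval (p : ℂ[X][X]) : Continuous fun x : ℂ × ℂ => biEval p x.1 x.2 :=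
  (contDiff_biEval p).continuous

theorem biEval_iterate_derivative (p : ℂ[X][X]) (k : ℕ) (s t : ℂ) :
    biEval (derivative^[k] p) s t = (derivative^[k] (p.map (evalRingHom s))).eval t := by
  rw [biEval, iterate_derivative_map]

/-- Minimum modulus principle on a disc. -/
theorem le_norm_eval_of_forall_sphere {u : ℂ[X]} {c : ℂ} {r b : ℝ} (hr : 0 < r) (hb : 0 < b)
    (hne : ∀ t ∈ closedBall c r, u.eval t ≠ 0) (hs : ∀ t ∈ sphere c r, b ≤ ‖u.eval t‖)
    {t : ℂ} (ht : t ∈ closedBall c r) : b ≤ ‖u.eval t‖ := by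
  have hd : DiffContOnCl ℂ (fun t => (u.eval t)⁻¹) (ball c r) := by
    refine DifferentiableOn.diffContOnCl ?_
    rw [closure_ball c hr.ne']
    exact (u.differentiable.differentiableOn).inv hne
  have := Complex.norm_le_of_forall_mem_frontier_norm_le (C := b⁻¹) isBounded_ball hd ?_
    (z := t) ?_
  · rw [norm_inv] at this
    exact (inv_le_inv₀ (norm_pos_iff.2 (hne t ht)) hb).1 this
  · rw [frontier_ball c hr.ne']
    intro z hz
    rw [norm_inv]
    exact inv_anti₀ hb (hs z hz)
  · rwa [closure_ball c hr.ne']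

/-- The implicit function theorem at a simple root; continuity of h places its graph in the
neighbourhood where the implicit function is the only solution. -/
theorem exists_differentiableAt_of_biEval_eq_zero {q : ℂ[X][X]} {h : ℂ → ℂ} {s₀ : ℂ}
    (hh : ContinuousAt h s₀) (hq : ∀ᶠ s in 𝓝 s₀, biEval q s (h s) = 0)
    (hd : biEval (derivative q) s₀ (h s₀) ≠ 0) : DifferentiableAt ℂ h s₀ := by
  set f : ℂ × ℂ → ℂ := fun x => biEval q x.1 x.2 with hf
  have hst : HasStrictFDerivAt f (fderiv ℂ f (s₀, h s₀)) (s₀, h s₀) :=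
    (contDiff_biEval q).contDiffAt.hasStrictFDerivAt one_ne_zero
  have hval : (fderiv ℂ f (s₀, h s₀) ∘L .inr ℂ ℂ ℂ) 1 = biEval (derivative q) s₀ (h s₀) := by
    have h1 : HasFDerivAt (f ∘ fun t => (s₀, t)) (fderiv ℂ f (s₀, h s₀) ∘L .inr ℂ ℂ ℂ) (h s₀) :=
      hst.hasFDerivAt.comp (h s₀) (hasFDerivAt_prodMk_right s₀ (h s₀))
    have h2 : HasDerivAt (f ∘ fun t => (s₀, t)) (biEval (derivative q) s₀ (h s₀)) (h s₀) := by
      have := (q.map (evalRingHom s₀)).hasDerivAt (h s₀)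
      rw [biEval, ← Polynomial.derivative_map]
      exact this
    exact h1.hasDerivAt.unique h2
  have hinv : (fderiv ℂ f (s₀, h s₀) ∘L .inr ℂ ℂ ℂ).IsInvertible := by
    refine ⟨ContinuousLinearEquiv.unitsEquivAut ℂ (Units.mk0 _ hd), ?_⟩
    ext
    simp only [ContinuousLinearEquiv.coe_coe, ContinuousLinearEquiv.unitsEquivAut_apply]
    rw [hval]
    simp
  have hiff := hst.eventually_apply_eq_iff_implicitFunctionOfProdDomain hinv
  have hdiff := (hst.hasStrictFDerivAt_implicitFunctionOfProdDomain hinv).hasFDerivAt.differentiableAt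
  refine hdiff.congr_of_eventuallyEq ?_
  have ht : Tendsto (fun s => (s, h s)) (𝓝 s₀) (𝓝 (s₀, h s₀)) := (continuousAt_id.prodMk hh)
  filter_upwards [ht.eventually hiff, hq] with s hs hs0
  exact (hs.1 (by simp only [hf]; rw [hs0, hq.self_of_nhds])).symm

/-- If near `(s₀, t₀)` the polynomial `p (s, ·)` has at most one root for each `s`, then its zero
set near `(s₀, t₀)` is the graph of a function which is differentiable at `s₀`. -/
theorem exists_graph_of_unique_root {p : ℂ[X][X]} {s₀ t₀ : ℂ} (h0 : biEval p s₀ t₀ = 0)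
    (huniq : ∀ᶠ x : ℂ × ℂ × ℂ in 𝓝 (s₀, t₀, t₀),
      biEval p x.1 x.2.1 = 0 → biEval p x.1 x.2.2 = 0 → x.2.1 = x.2.2) :
    ∃ h : ℂ → ℂ, h s₀ = t₀ ∧ DifferentiableAt ℂ h s₀ ∧
      ∀ᶠ x : ℂ × ℂ in 𝓝 (s₀, t₀), biEval p x.1 x.2 = 0 ↔ x.2 = h x.1 := by
  classical
  obtain ⟨δ, hδ, hu⟩ : ∃ δ > 0, ∀ s ∈ ball s₀ δ, ∀ t ∈ ball t₀ δ, ∀ t' ∈ ball t₀ δ,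
      biEval p s t = 0 → biEval p s t' = 0 → t = t' := by
    obtain ⟨δ, hδ, hb⟩ := Metric.eventually_nhds_iff_ball.1 huniq
    refine ⟨δ, hδ, fun s hs t ht t' ht' => hb (s, t, t') ?_⟩
    rw [← ball_prod_same, ← ball_prod_same]
    exact ⟨hs, ht, ht'⟩
  -- By uniqueness t₀ is the only root over s₀ in the δ-disc, so p(s₀, ·) is bounded below on each
  -- smaller circle, and the bound persists for nearby s.
  have hsphere : ∀ ε, 0 < ε → ε < δ → ∃ b > 0, ∀ᶠ s in 𝓝 s₀, ∀ t ∈ sphere t₀ ε,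
      b ≤ ‖biEval p s t‖ := by
    intro ε hε hεδ
    have hcomp : IsCompact (sphere t₀ ε) := isCompact_sphere _ _
    have hcont : Continuous fun t => ‖biEval p s₀ t‖ :=
      ((continuous_biEval p).comp (Continuous.prodMk_right s₀)).norm
    obtain ⟨t₁, ht₁, hmin⟩ := hcomp.exists_isMinOn (NormedSpace.sphere_nonempty.2 hε.le)
      hcont.continuousOn
    have hpos : 0 < ‖biEval p s₀ t₁‖ := by
      refine norm_pos_iff.2 fun hz => ?_
      have := hu s₀ (mem_ball_self hδ) t₁ (sphere_subset_ball hεδ ht₁) t₀ (mem_ball_self hδ) hz h0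
      rw [this, mem_sphere, dist_self] at ht₁
      exact hε.ne ht₁
    refine ⟨‖biEval p s₀ t₁‖ / 2, half_pos hpos, ?_⟩
    refine hcomp.eventually_forall_of_forall_eventually
      (P := fun s t => ‖biEval p s₀ t₁‖ / 2 ≤ ‖biEval p s t‖) fun t ht => ?_
    have h1 : Tendsto (fun x : ℂ × ℂ => ‖biEval p x.1 x.2‖) (𝓝 (s₀, t)) (𝓝 ‖biEval p s₀ t‖) :=
      ((continuous_biEval p).norm).tendsto (s₀, t)
    have h2 : ‖biEval p s₀ t₁‖ / 2 < ‖biEval p s₀ t‖ :=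
      (half_lt_self hpos).trans_le (hmin ht)
    filter_upwards [h1.eventually (lt_mem_nhds h2)] with x hx using hx.le
  -- Without a root in the disc, the minimum modulus principle would give |p(s, t₀)| ≥ b, although
  -- p(s, t₀) tends to 0.
  have hexists : ∀ ε, 0 < ε → ε < δ → ∀ᶠ s in 𝓝 s₀, ∃ t ∈ ball t₀ ε, biEval p s t = 0 := by
    intro ε hε hεδ
    obtain ⟨b, hb, hev⟩ := hsphere ε hε hεδ
    have hsmall : ∀ᶠ s in 𝓝 s₀, ‖biEval p s t₀‖ < b := by
      have h1 : Tendsto (fun s => ‖biEval p s t₀‖) (𝓝 s₀) (𝓝 ‖biEval p s₀ t₀‖) :=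
        (((continuous_biEval p).comp (Continuous.prodMk_left t₀)).norm).tendsto s₀
      rw [h0, norm_zero] at h1
      exact h1.eventually (gt_mem_nhds hb)
    filter_upwards [hev, hsmall] with s hs hs'
    by_contra! hno
    refine absurd (le_norm_eval_of_forall_sphere (u := p.map (evalRingHom s)) hε hb ?_ hs
      (mem_closedBall_self hε.le)) (not_le.2 hs')
    intro t ht
    rcases (mem_closedBall.1 ht).lt_or_eq with h | h
    · exact hno t h
    · exact norm_pos_iff.1 (hb.trans_le (hs t h))
  set h : ℂ → ℂ := fun s => Classical.epsilon fun t => t ∈ ball t₀ (δ / 2) ∧ biEval p s t = 0 with hh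
  have hδ2 : 0 < δ / 2 := half_pos hδ
  have hspec : ∀ᶠ s in 𝓝 s₀, h s ∈ ball t₀ (δ / 2) ∧ biEval p s (h s) = 0 := by
    filter_upwards [hexists (δ / 2) hδ2 (half_lt_self hδ)] with s hs
    obtain ⟨t, ht⟩ := hs
    exact Classical.epsilon_spec (p := fun t => t ∈ ball t₀ (δ / 2) ∧ biEval p s t = 0) ⟨t, ht⟩
  have hsub : ball t₀ (δ / 2) ⊆ ball t₀ δ := ball_subset_ball (half_le_self hδ.le)
  have hs₀ : h s₀ = t₀ :=
    hu s₀ (mem_ball_self hδ) _ (hsub hspec.self_of_nhds.1) _ (mem_ball_self hδ)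
      hspec.self_of_nhds.2 h0
  have hcont : ContinuousAt h s₀ := by
    rw [ContinuousAt, hs₀, Metric.tendsto_nhds]
    intro ε hε
    have hm : 0 < min ε (δ / 2) := lt_min hε hδ2
    filter_upwards [hspec, hexists (min ε (δ / 2)) hm ((min_le_right _ _).trans_lt (half_lt_self hδ)),
      ball_mem_nhds s₀ hδ] with s hs hs' hsb
    obtain ⟨t, ht, ht0⟩ := hs'
    have : h s = t := hu s hsb _ (hsub hs.1) _
      (hsub (ball_subset_ball (min_le_right _ _) ht)) hs.2 ht0
    rw [this]
    exact (mem_ball.1 ht).trans_le (min_le_left _ _)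
  refine ⟨h, hs₀, ?_, ?_⟩
  swap
  · have h1 : Tendsto Prod.fst (𝓝 (s₀, t₀)) (𝓝 s₀) := continuousAt_fst
    have h2 : Tendsto Prod.snd (𝓝 (s₀, t₀)) (𝓝 t₀) := continuousAt_snd
    filter_upwards [h1.eventually hspec, h1.eventually (ball_mem_nhds s₀ hδ),
      h2.eventually (ball_mem_nhds t₀ hδ)] with x hx1 hx2 hx3
    exact ⟨fun hz => hu _ hx2 _ hx3 _ (hsub hx1.1) hz hx1.2, fun he => he ▸ hx1.2⟩
  -- the multiplicity of the root does not drop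
  set P : ℂ → ℂ[X] := fun s => p.map (evalRingHom s) with hP
  obtain ⟨b, hb, hev⟩ := hsphere (δ / 2) hδ2 (half_lt_self hδ)
  have hPne : ∀ᶠ s in 𝓝 s₀, P s ≠ 0 := by
    filter_upwards [hev] with s hs h0
    obtain ⟨t, ht⟩ := NormedSpace.sphere_nonempty (x := t₀).2 hδ2.le
    have := hs t ht
    simp only [hP] at h0
    rw [biEval, h0, eval_zero, norm_zero] at this
    exact absurd hb (not_lt.2 this)
  set m := (P s₀).rootMultiplicity t₀ with hm
  have hm0 : 0 < m := (rootMultiplicity_pos hPne.self_of_nhds).2 h0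
  have hsmall : ∀ᶠ s in 𝓝 s₀, ∀ k < m,
      ‖biEval (derivative^[k] p) s (h s)‖ < b / δ ^ k := by
    refine (eventually_all_finite (finite_lt_nat m)).2 fun k hk => ?_
    have h1 : Tendsto (fun s => ‖biEval (derivative^[k] p) s (h s)‖) (𝓝 s₀)
        (𝓝 ‖biEval (derivative^[k] p) s₀ (h s₀)‖) :=
      ((continuous_biEval (derivative^[k] p)).norm.tendsto (s₀, h s₀)).comp
        (continuousAt_id.prodMk hcont)
    have h2 : biEval (derivative^[k] p) s₀ (h s₀) = 0 := by
      rw [biEval_iterate_derivative, hs₀]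
      exact isRoot_iterate_derivative_of_lt_rootMultiplicity hk
    rw [h2, norm_zero] at h1
    exact h1.eventually (gt_mem_nhds (by positivity))
  -- If the multiplicity k at h(s) were below m, the cofactor u would have no zero in the closed
  -- disc (its zeros are roots of P s, hence equal to h(s), where u does not vanish). So |u(h s)| ≥
  -- b/δᵏ by minimum modulus, but k! · u(h s) is the k-th derivative at h(s), which is smaller than
  -- that.
  have hmult : ∀ᶠ s in 𝓝 s₀, m ≤ (P s).rootMultiplicity (h s) := by
    filter_upwards [hsmall, hev, hspec, ball_mem_nhds s₀ hδ, hPne] with s hs1 hs2 hs3 hs4 hs5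
    by_contra! hlt
    set k := (P s).rootMultiplicity (h s) with hk
    set u := P s /ₘ (X - C (h s)) ^ k with hu'
    have hfac : ∀ t, (P s).eval t = (t - h s) ^ k * u.eval t := by
      intro t
      conv_lhs => rw [← pow_mul_divByMonic_rootMultiplicity_eq (P s) (h s)]
      simp [hu', hk]
    have hcb : closedBall t₀ (δ / 2) ⊆ ball t₀ δ := closedBall_subset_ball (half_lt_self hδ)
    have hune : ∀ t ∈ closedBall t₀ (δ / 2), u.eval t ≠ 0 := by
      intro t ht hz
      have h1 : biEval p s t = 0 := by
        change (P s).eval t = 0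
        rw [hfac, hz, mul_zero]
      have h2 := hu s hs4 t (hcb ht) (h s) (hsub hs3.1) h1 hs3.2
      rw [h2] at hz
      exact eval_divByMonic_pow_rootMultiplicity_ne_zero (h s) hs5 hz
    have husph : ∀ t ∈ sphere t₀ (δ / 2), b / δ ^ k ≤ ‖u.eval t‖ := by
      intro t ht
      have h1 : b ≤ ‖(P s).eval t‖ := hs2 t ht
      rw [hfac, norm_mul, norm_pow] at h1
      have h2 : ‖t - h s‖ ≤ δ := by
        rw [← dist_eq_norm]
        have := dist_triangle_right t (h s) t₀
        have h3 := mem_ball.1 hs3.1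
        rw [mem_sphere] at ht
        linarith
      rw [div_le_iff₀ (pow_pos hδ k), mul_comm]
      exact h1.trans (by gcongr)
    have h3 := le_norm_eval_of_forall_sphere hδ2 (by positivity) hune husph
      (ball_subset_closedBall hs3.1)
    have h4 := hs1 k hlt
    rw [biEval_iterate_derivative] at h4
    change ‖(derivative^[k] (P s)).eval (h s)‖ < _ at h4
    rw [hk, eval_iterate_derivative_rootMultiplicity, ← hk, nsmul_eq_mul, norm_mul] at h4
    have h5 : (1 : ℝ) ≤ ‖((k.factorial : ℕ) : ℂ)‖ := by
      rw [Complex.norm_natCast]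
      exact_mod_cast k.factorial_pos
    have h6 := le_mul_of_one_le_left (norm_nonneg (u.eval (h s))) h5
    exact absurd (h3.trans h6) (not_le.2 h4)
  -- With constant multiplicity m, the root h(s) is a root of the (m-1)-st derivative in t, and a
  -- simple one at s₀.
  refine exists_differentiableAt_of_biEval_eq_zero (q := derivative^[m - 1] p) hcont ?_ ?_
  · filter_upwards [hmult] with s hs
    rw [biEval_iterate_derivative]
    exact isRoot_iterate_derivative_of_lt_rootMultiplicity (lt_of_lt_of_le (by omega) hs)
  · rw [← Function.iterate_succ_apply' (⇑derivative), Nat.succ_eq_add_one, Nat.sub_add_cancel hm0,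
      biEval_iterate_derivative, hs₀]
    change (derivative^[m] (P s₀)).eval t₀ ≠ 0
    rw [hm, eval_iterate_derivative_rootMultiplicity, nsmul_eq_mul]
    exact mul_ne_zero (by exact_mod_cast Nat.factorial_ne_zero _)
      (eval_divByMonic_pow_rootMultiplicity_ne_zero _ hPne.self_of_nhds)

end BivariatePolynomial

/-! ## Affine charts of the sphere -/

namespace Sphere

/-- The affine chart of the sphere with pole at `a`: it is `z ↦ z` if `a = ∞`, and
`z ↦ 1 / (z - a)` otherwise. -/
noncomputable def chart (a : Sphere) : Sphere → ℂ :=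
  OnePoint.elim a toC fun c w => OnePoint.elim w 0 fun z => (z - c)⁻¹

open Classical in
/-- The parametrisation of the complement of `a` that is inverse to `chart a`. -/
noncomputable def chartInv (a : Sphere) : ℂ → Sphere :=
  OnePoint.elim a (fun t => (t : Sphere))
    fun c t => if t = 0 then OnePoint.infty else ((c + t⁻¹ : ℂ) : Sphere)

open Classical in
/-- The pole of the coordinate used near `p`. -/
noncomputable def pole (p : Sphere) : Sphere :=
  if p = OnePoint.infty then ((0 : ℂ) : Sphere) else OnePoint.infty

@[simp] theorem chart_infty_coe (z : ℂ) : chart OnePoint.infty (z : Sphere) = z := rfl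

@[simp] theorem chart_coe_coe (c z : ℂ) : chart (c : Sphere) (z : Sphere) = (z - c)⁻¹ := rfl

@[simp] theorem chart_coe_infty (c : ℂ) : chart (c : Sphere) OnePoint.infty = 0 := rfl

@[simp] theorem chartInv_infty (t : ℂ) : chartInv OnePoint.infty t = (t : Sphere) := rfl

@[simp] theorem chartInv_coe_zero (c : ℂ) : chartInv (c : Sphere) 0 = OnePoint.infty := by
  simp [chartInv]

theorem chartInv_coe_of_ne (c : ℂ) {t : ℂ} (ht : t ≠ 0) :
    chartInv (c : Sphere) t = ((c + t⁻¹ : ℂ) : Sphere) := by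
  simp [chartInv, ht]

theorem chart_chartInv (a : Sphere) (t : ℂ) : chart a (chartInv a t) = t := by
  induction a using OnePoint.rec with
  | infty => rfl
  | coe c =>
    by_cases ht : t = 0
    · simp [ht]
    · simp [chartInv_coe_of_ne c ht]

theorem chartInv_ne (a : Sphere) (t : ℂ) : chartInv a t ≠ a := by
  induction a using OnePoint.rec with
  | infty => exact OnePoint.coe_ne_infty t
  | coe c =>
    by_cases ht : t = 0
    · simp [ht]
    · simp [chartInv_coe_of_ne c ht, ht]

theorem chartInv_chart {a w : Sphere} (h : w ≠ a) : chartInv a (chart a w) = w := by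
  induction a using OnePoint.rec with
  | infty =>
    induction w using OnePoint.rec with
    | infty => exact absurd rfl h
    | coe z => rfl
  | coe c =>
    induction w using OnePoint.rec with
    | infty => simp
    | coe z =>
      have hz : z - c ≠ 0 := sub_ne_zero.2 fun h' => h (by rw [h'])
      rw [chart_coe_coe, chartInv_coe_of_ne c (inv_ne_zero hz), inv_inv, add_sub_cancel]

theorem chartInv_injective (a : Sphere) : Function.Injective (chartInv a) :=
  Function.LeftInverse.injective (chart_chartInv a)

theorem continuous_chartInv (a : Sphere) : Continuous (chartInv a) := by
  induction a using OnePoint.rec with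
  | infty => exact OnePoint.continuous_coe
  | coe c =>
    refine continuous_iff_continuousAt.2 fun t => ?_
    by_cases ht : t = 0
    · subst ht
      rw [continuousAt_iff_punctured_nhds, chartInv_coe_zero]
      have h1 : Tendsto (fun t : ℂ => c + t⁻¹) (𝓝[≠] 0) (Bornology.cobounded ℂ) :=
        (tendsto_const_add_cobounded c).comp tendsto_inv₀_nhdsNE_zero
      rw [Metric.cobounded_eq_cocompact, ← coclosedCompact_eq_cocompact] at h1
      refine (OnePoint.tendsto_coe_infty.comp h1).congr' ?_
      filter_upwards [self_mem_nhdsWithin] with t ht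
      exact (chartInv_coe_of_ne c ht).symm
    · have h1 : ContinuousAt (fun t : ℂ => ((c + t⁻¹ : ℂ) : Sphere)) t :=
        OnePoint.continuous_coe.continuousAt.comp
          (continuousAt_const.add (continuousAt_inv₀ ht))
      refine h1.congr ?_
      filter_upwards [isOpen_ne.mem_nhds ht] with s hs
      exact (chartInv_coe_of_ne c hs).symm

theorem continuousAt_chart {a w : Sphere} (h : w ≠ a) : ContinuousAt (chart a) w := by
  induction a using OnePoint.rec with
  | infty =>
    induction w using OnePoint.rec with
    | infty => exact absurd rfl h
    | coe z => exact OnePoint.continuousAt_coe.2 continuousAt_id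
  | coe c =>
    induction w using OnePoint.rec with
    | infty =>
      refine OnePoint.continuousAt_infty'.2 ?_
      rw [coclosedCompact_eq_cocompact, ← Metric.cobounded_eq_cocompact, chart_coe_infty]
      have h1 : Tendsto (fun z : ℂ => (z - c)⁻¹) (Bornology.cobounded ℂ) (𝓝 0) := by
        simp_rw [sub_eq_add_neg]
        exact tendsto_inv₀_cobounded.comp (tendsto_add_const_cobounded (-c))
      exact h1
    | coe z =>
      have hz : z - c ≠ 0 := sub_ne_zero.2 fun h' => h (by rw [h'])
      refine OnePoint.continuousAt_coe.2 ?_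
      exact (continuousAt_id.sub continuousAt_const).inv₀ hz

theorem isOpenEmbedding_chartInv (a : Sphere) : IsOpenEmbedding (chartInv a) := by
  refine .of_continuous_injective_isOpenMap (continuous_chartInv a) (chartInv_injective a) ?_
  intro U hU
  have h1 : ContinuousOn (chart a) {a}ᶜ := fun w hw => (continuousAt_chart hw).continuousWithinAt
  have h2 := h1.isOpen_inter_preimage isOpen_compl_singleton hU
  convert h2 using 1
  ext w
  constructor
  · rintro ⟨t, ht, rfl⟩
    exact ⟨chartInv_ne a t, by rwa [mem_preimage, chart_chartInv]⟩
  · rintro ⟨hw, hwU⟩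
    exact ⟨_, hwU, chartInv_chart hw⟩

/-- The transition maps between affine charts are holomorphic. -/
theorem differentiableAt_chart_chartInv {a b : Sphere} {t : ℂ} (h : chartInv a t ≠ b) :
    DifferentiableAt ℂ (fun s => chart b (chartInv a s)) t := by
  induction a using OnePoint.rec with
  | infty =>
    induction b using OnePoint.rec with
    | infty => exact differentiableAt_id
    | coe c =>
      have ht : t - c ≠ 0 := sub_ne_zero.2 fun h' => h (by rw [chartInv_infty, h'])
      exact (differentiableAt_id.sub_const c).inv ht
  | coe c =>
    induction b using OnePoint.rec with
    | infty =>
      have ht : t ≠ 0 := fun h' => h (by rw [h', chartInv_coe_zero])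
      have h1 : DifferentiableAt ℂ (fun s : ℂ => c + s⁻¹) t := (differentiableAt_inv ht).const_add c
      refine h1.congr_of_eventuallyEq ?_
      filter_upwards [isOpen_ne.mem_nhds ht] with s hs
      rw [chartInv_coe_of_ne c hs, chart_infty_coe]
    | coe c' =>
      have heq : (fun s => chart (c' : Sphere) (chartInv (c : Sphere) s)) =
          fun s => s / (1 + (c - c') * s) := by
        funext s
        by_cases hs : s = 0
        · simp [hs]
        · rw [chartInv_coe_of_ne c hs, chart_coe_coe,
            show c + s⁻¹ - c' = (1 + (c - c') * s) / s by field_simp; ring, inv_div]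
      rw [heq]
      refine DifferentiableAt.div differentiableAt_id (by fun_prop) fun h0 => h ?_
      have ht : t ≠ 0 := by
        rintro rfl
        simp at h0
      rw [chartInv_coe_of_ne c ht]
      congr 1
      field_simp
      linear_combination h0

theorem pole_ne (p : Sphere) : p ≠ pole p := by
  unfold pole
  split_ifs with h
  · rw [h]
    exact OnePoint.infty_ne_coe 0
  · exact h

theorem inv_coe_eq (t : ℂ) : inv (t : Sphere) = chartInv ((0 : ℂ) : Sphere) t := by
  by_cases ht : t = 0
  · simp [inv, ht]
  · simp [inv, ht, chartInv_coe_of_ne]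

theorem param_eq (p : Sphere) : param p = chartInv (pole p) := by
  unfold param pole
  split_ifs with h
  · exact funext inv_coe_eq
  · rfl

theorem toC_inv_eq (w : Sphere) : toC (inv w) = chart ((0 : ℂ) : Sphere) w := by
  induction w using OnePoint.rec with
  | infty => simp [inv, toC]
  | coe z =>
    by_cases hz : z = 0
    · simp [inv, hz, toC]
    · simp [inv, hz, toC]

theorem coord_eq (p : Sphere) : coord p = chart (pole p) := by
  unfold coord pole
  split_ifs with h
  · exact funext toC_inv_eq
  · rfl

theorem param_coord_self (p : Sphere) : param p (coord p p) = p := by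
  rw [param_eq, coord_eq, chartInv_chart (pole_ne p)]

theorem coord_param (p : Sphere) (t : ℂ) : coord p (param p t) = t := by
  rw [param_eq, coord_eq, chart_chartInv]

theorem isOpenEmbedding_param (p : Sphere) : IsOpenEmbedding (param p) := by
  rw [param_eq]
  exact isOpenEmbedding_chartInv _

theorem map_param_nhds (p : Sphere) : map (param p) (𝓝 (coord p p)) = 𝓝 p := by
  rw [(isOpenEmbedding_param p).map_nhds_eq, param_coord_self]

theorem continuousAt_coord (p : Sphere) : ContinuousAt (coord p) p := by
  rw [coord_eq]
  exact continuousAt_chart (pole_ne p)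

theorem eventually_param_coord (p : Sphere) : ∀ᶠ q in 𝓝 p, param p (coord p q) = q := by
  filter_upwards [isOpen_ne.mem_nhds (pole_ne p)] with q hq
  rw [param_eq, coord_eq, chartInv_chart hq]

end Sphere

@[simp] theorem conjIf_conjIf (anti : Bool) (z : ℂ) : conjIf anti (conjIf anti z) = z := by
  cases anti <;> simp [conjIf]

theorem continuous_conjIf (anti : Bool) : Continuous (conjIf anti) := by
  cases anti
  · exact continuous_id
  · exact Complex.continuous_conj

theorem dist_conjIf (anti : Bool) (z w : ℂ) : dist (conjIf anti z) (conjIf anti w) = dist z w := by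
  cases anti
  · rfl
  · exact Complex.dist_conj_conj z w

theorem conjIf_mul (anti : Bool) (z w : ℂ) :
    conjIf anti (z * w) = conjIf anti z * conjIf anti w := by
  cases anti <;> simp [conjIf]

@[simp] theorem conjIf_one (anti : Bool) : conjIf anti 1 = 1 := by cases anti <;> simp [conjIf]

@[simp] theorem conjIf_zero (anti : Bool) : conjIf anti 0 = 0 := by cases anti <;> simp [conjIf]

theorem conjIf_injective (anti : Bool) : Function.Injective (conjIf anti) :=
  Function.LeftInverse.injective (conjIf_conjIf anti)

/-! ## The curve in affine charts -/

namespace Correspondence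

open Polynomial in
/-- The polynomial `∑ c_m X ^ e₁(m) Y ^ e₂(m)`, with `c_m` the coefficients of `P`. -/
noncomputable def chartPoly (F : Correspondence) (e₁ e₂ : (Fin 2 →₀ ℕ) → ℕ) : ℂ[X][X] :=
  ∑ m ∈ F.P.support, C (C (F.P.coeff m) * X ^ e₁ m) * X ^ e₂ m

variable (F : Correspondence)

theorem biEval_chartPoly (e₁ e₂ : (Fin 2 →₀ ℕ) → ℕ) (s t : ℂ) :
    biEval (F.chartPoly e₁ e₂) s t = ∑ m ∈ F.P.support, F.P.coeff m * s ^ e₁ m * t ^ e₂ m := by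
  simp [biEval, chartPoly, Polynomial.map_sum, Polynomial.eval_finsetSum]

theorem biEval_chartPoly_swap (e₁ e₂ : (Fin 2 →₀ ℕ) → ℕ) (s t : ℂ) :
    biEval (F.chartPoly e₂ e₁) t s = biEval (F.chartPoly e₁ e₂) s t := by
  simp only [biEval_chartPoly]
  exact Finset.sum_congr rfl fun m _ => by ring

open Classical in
/-- The exponents of the `i`-th variable in the coordinate used near `p`. -/
noncomputable def chartExp (i : Fin 2) (p : Sphere) (m : Fin 2 →₀ ℕ) : ℕ :=
  if p = OnePoint.infty then F.P.degreeOf i - m i else m i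

theorem bihom_smul_left (l a₁ a₂ : ℂ) (b : ℂ × ℂ) :
    F.bihom (l * a₁, l * a₂) b = l ^ F.P.degreeOf 0 * F.bihom (a₁, a₂) b := by
  unfold bihom
  rw [Finset.mul_sum]
  refine Finset.sum_congr rfl fun m hm => ?_
  have h1 : m 0 + (F.P.degreeOf 0 - m 0) = F.P.degreeOf 0 :=
    Nat.add_sub_cancel' (MvPolynomial.monomial_le_degreeOf 0 hm)
  conv_rhs => rw [← h1, pow_add]
  simp only [mul_pow, Nat.add_sub_cancel_left]
  ring

theorem bihom_smul_right (l b₁ b₂ : ℂ) (a : ℂ × ℂ) :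
    F.bihom a (l * b₁, l * b₂) = l ^ F.P.degreeOf 1 * F.bihom a (b₁, b₂) := by
  unfold bihom
  rw [Finset.mul_sum]
  refine Finset.sum_congr rfl fun m hm => ?_
  have h1 : m 1 + (F.P.degreeOf 1 - m 1) = F.P.degreeOf 1 :=
    Nat.add_sub_cancel' (MvPolynomial.monomial_le_degreeOf 1 hm)
  conv_rhs => rw [← h1, pow_add]
  simp only [mul_pow, Nat.add_sub_cancel_left]
  ring

open Classical in
/-- Homogeneous coordinates of `param p t`. -/
noncomputable def paramHom (p : Sphere) (t : ℂ) : ℂ × ℂ := if p = OnePoint.infty then (1, t) else (t, 1)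

theorem exists_hom_param (p : Sphere) (t : ℂ) :
    ∃ l ≠ 0, Sphere.hom (Sphere.param p t) = (l * (paramHom p t).1, l * (paramHom p t).2) := by
  by_cases hp : p = OnePoint.infty
  · by_cases ht : t = 0
    · exact ⟨1, one_ne_zero, by simp [Sphere.param, hp, paramHom, Sphere.hom, Sphere.inv, ht]⟩
    · exact ⟨t⁻¹, inv_ne_zero ht, by simp [Sphere.param, hp, paramHom, Sphere.hom, Sphere.inv, ht]⟩
  · exact ⟨1, one_ne_zero, by simp [Sphere.param, hp, paramHom, Sphere.hom]⟩

theorem bihom_paramHom (p q : Sphere) (s t : ℂ) :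
    F.bihom (paramHom p s) (paramHom q t) =
      biEval (F.chartPoly (F.chartExp 0 p) (F.chartExp 1 q)) s t := by
  rw [biEval_chartPoly, bihom]
  refine Finset.sum_congr rfl fun m _ => ?_
  by_cases hp : p = OnePoint.infty <;> by_cases hq : q = OnePoint.infty <;>
    simp [paramHom, chartExp, hp, hq]

/-- The homogeneous coordinates of a parametrised point are a nonzero multiple of `paramHom`, and
bihomogeneity makes the vanishing insensitive to the factor. Thus Γ is an affine algebraic curve in
every pair of charts, ∞ included. -/
theorem mem_graph_param (p q : Sphere) (s t : ℂ) :
    (Sphere.param p s, Sphere.param q t) ∈ F.graph ↔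
      biEval (F.chartPoly (F.chartExp 0 p) (F.chartExp 1 q)) (conjIf F.anti s) t = 0 := by
  obtain ⟨l, hl, h1⟩ := exists_hom_param p s
  obtain ⟨l', hl', h2⟩ := exists_hom_param q t
  have hc : conjIf F.anti l ≠ 0 := fun h => hl (conjIf_injective F.anti (by simpa using h))
  have h3 : (conjIf F.anti (paramHom p s).1, conjIf F.anti (paramHom p s).2) =
      paramHom p (conjIf F.anti s) := by
    by_cases hp : p = OnePoint.infty <;> simp [paramHom, hp]
  simp only [graph, mem_ofPred_eq, h1, h2, conjIf_mul, bihom_smul_left, bihom_smul_right]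
  rw [← bihom_paramHom, ← h3]
  simp [hc, hl']

theorem map_param_nhds_prod (u w : Sphere) :
    map (Prod.map (Sphere.param u) (Sphere.param w)) (𝓝 (Sphere.coord u u, Sphere.coord w w)) =
      𝓝 (u, w) := by
  rw [((Sphere.isOpenEmbedding_param u).prodMap (Sphere.isOpenEmbedding_param w)).map_nhds_eq,
    Prod.map_apply, Sphere.param_coord_self, Sphere.param_coord_self]

theorem isClosed_graph : IsClosed F.graph := by
  rw [← isOpen_compl_iff, isOpen_iff_mem_nhds]
  rintro ⟨u, w⟩ hx
  rw [← map_param_nhds_prod, mem_map]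
  have hopen : IsOpen {x : ℂ × ℂ |
      biEval (F.chartPoly (F.chartExp 0 u) (F.chartExp 1 w)) (conjIf F.anti x.1) x.2 ≠ 0} :=
    isOpen_ne_fun ((continuous_biEval _).comp
      (((continuous_conjIf F.anti).comp continuous_fst).prodMk continuous_snd)) continuous_const
  have heq : Prod.map (Sphere.param u) (Sphere.param w) ⁻¹' F.graphᶜ = {x : ℂ × ℂ |
      biEval (F.chartPoly (F.chartExp 0 u) (F.chartExp 1 w)) (conjIf F.anti x.1) x.2 ≠ 0} := by
    ext x
    simp [Prod.map, mem_graph_param]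
  rw [heq]
  refine hopen.mem_nhds ?_
  rw [← heq, mem_preimage, Prod.map_apply, Sphere.param_coord_self, Sphere.param_coord_self]
  exact hx

/-- Where the first projection of `Γ` is injective, `Γ` is locally the graph of a function
continuous at the base point. -/
theorem exists_graph_of_injOn_fst {u w : Sphere} (ha : (u, w) ∈ F.graph)
    {W : Set (Sphere × Sphere)} (hW : W ∈ 𝓝 (u, w)) (hinj : InjOn Prod.fst (F.graph ∩ W)) :
    ∃ h : Sphere → Sphere, h u = w ∧ ContinuousAt h u ∧
      ∀ᶠ x in 𝓝 (u, w), x ∈ F.graph ↔ x.2 = h x.1 := by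
  set s₀ := Sphere.coord u u with hs₀
  set t₀ := Sphere.coord w w with ht₀
  set p := F.chartPoly (F.chartExp 0 u) (F.chartExp 1 w) with hp
  have hmem : ∀ s t, (Sphere.param u s, Sphere.param w t) ∈ F.graph ↔
      biEval p (conjIf F.anti s) t = 0 := F.mem_graph_param u w
  have h0 : biEval p (conjIf F.anti s₀) t₀ = 0 := by
    rw [← hmem, Sphere.param_coord_self, Sphere.param_coord_self]
    exact ha
  have hWp : ∀ᶠ x : ℂ × ℂ in 𝓝 (s₀, t₀), (Sphere.param u x.1, Sphere.param w x.2) ∈ W := by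
    have := hW
    rw [← map_param_nhds_prod] at this
    exact this
  have huniq : ∀ᶠ x : ℂ × ℂ × ℂ in 𝓝 (conjIf F.anti s₀, t₀, t₀),
      biEval p x.1 x.2.1 = 0 → biEval p x.1 x.2.2 = 0 → x.2.1 = x.2.2 := by
    have T1 : Tendsto (fun x : ℂ × ℂ × ℂ => (conjIf F.anti x.1, x.2.1))
        (𝓝 (conjIf F.anti s₀, t₀, t₀)) (𝓝 (s₀, t₀)) :=
      (((continuous_conjIf F.anti).comp continuous_fst).prodMk
        (continuous_fst.comp continuous_snd)).tendsto' _ _ (by simp)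
    have T2 : Tendsto (fun x : ℂ × ℂ × ℂ => (conjIf F.anti x.1, x.2.2))
        (𝓝 (conjIf F.anti s₀, t₀, t₀)) (𝓝 (s₀, t₀)) :=
      (((continuous_conjIf F.anti).comp continuous_fst).prodMk
        (continuous_snd.comp continuous_snd)).tendsto' _ _ (by simp)
    filter_upwards [T1.eventually hWp, T2.eventually hWp] with x h1 h2 h3 h4
    have e1 := (hmem (conjIf F.anti x.1) x.2.1).2 (by rwa [conjIf_conjIf])
    have e2 := (hmem (conjIf F.anti x.1) x.2.2).2 (by rwa [conjIf_conjIf])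
    have := hinj ⟨e1, h1⟩ ⟨e2, h2⟩ rfl
    exact (Sphere.isOpenEmbedding_param w).injective (congrArg Prod.snd this)
  obtain ⟨η, hη0, hηd, hη⟩ := exists_graph_of_unique_root h0 huniq
  refine ⟨fun z => Sphere.param w (η (conjIf F.anti (Sphere.coord u z))), ?_, ?_, ?_⟩
  · change Sphere.param w (η (conjIf F.anti s₀)) = w
    rw [hη0, Sphere.param_coord_self]
  · refine ContinuousAt.comp (f := fun z => η (conjIf F.anti (Sphere.coord u z)))
      (Sphere.isOpenEmbedding_param w).continuous.continuousAt ?_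
    refine ContinuousAt.comp (f := fun z => conjIf F.anti (Sphere.coord u z)) (g := η) hηd.continuousAt ?_
    exact (continuous_conjIf F.anti).continuousAt.comp (Sphere.continuousAt_coord u)
  · rw [← map_param_nhds_prod, eventually_map]
    have T : Tendsto (fun x : ℂ × ℂ => (conjIf F.anti x.1, x.2)) (𝓝 (s₀, t₀))
        (𝓝 (conjIf F.anti s₀, t₀)) :=
      ((continuous_conjIf F.anti).continuousAt.comp continuousAt_fst).prodMk_nhds continuousAt_snd
    filter_upwards [T.eventually hη] with x hx
    simp only [Prod.map, hmem, Sphere.coord_param]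
    rw [hx]
    exact (Sphere.isOpenEmbedding_param w).injective.eq_iff.symm

/-- Where the second projection of `Γ` is injective, `Γ` is locally the graph of a function of the
second variable that is (anti)differentiable at the base point. -/
theorem exists_graph_of_injOn_snd {u w : Sphere} (ha : (u, w) ∈ F.graph)
    {W : Set (Sphere × Sphere)} (hW : W ∈ 𝓝 (u, w)) (hinj : InjOn Prod.snd (F.graph ∩ W)) :
    ∃ g : Sphere → Sphere, g w = u ∧ ContinuousAt g w ∧
      DifferentiableAt ℂ (fun t => conjIf F.anti (Sphere.coord u (g (Sphere.param w t))))
        (Sphere.coord w w) ∧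
      ∀ᶠ x in 𝓝 (u, w), x ∈ F.graph ↔ x.1 = g x.2 := by
  set s₀ := Sphere.coord u u with hs₀
  set t₀ := Sphere.coord w w with ht₀
  set p := F.chartPoly (F.chartExp 1 w) (F.chartExp 0 u) with hp
  have hmem : ∀ s t, (Sphere.param u s, Sphere.param w t) ∈ F.graph ↔
      biEval p t (conjIf F.anti s) = 0 := fun s t => by
    rw [F.mem_graph_param u w, hp, biEval_chartPoly_swap]
  have h0 : biEval p t₀ (conjIf F.anti s₀) = 0 := by
    rw [← hmem, Sphere.param_coord_self, Sphere.param_coord_self]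
    exact ha
  have hWp : ∀ᶠ x : ℂ × ℂ in 𝓝 (s₀, t₀), (Sphere.param u x.1, Sphere.param w x.2) ∈ W := by
    have := hW
    rw [← map_param_nhds_prod] at this
    exact this
  have huniq : ∀ᶠ x : ℂ × ℂ × ℂ in 𝓝 (t₀, conjIf F.anti s₀, conjIf F.anti s₀),
      biEval p x.1 x.2.1 = 0 → biEval p x.1 x.2.2 = 0 → x.2.1 = x.2.2 := by
    have T1 : Tendsto (fun x : ℂ × ℂ × ℂ => (conjIf F.anti x.2.1, x.1))
        (𝓝 (t₀, conjIf F.anti s₀, conjIf F.anti s₀)) (𝓝 (s₀, t₀)) :=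
      (((continuous_conjIf F.anti).comp (continuous_fst.comp continuous_snd)).prodMk
        continuous_fst).tendsto' _ _ (by simp)
    have T2 : Tendsto (fun x : ℂ × ℂ × ℂ => (conjIf F.anti x.2.2, x.1))
        (𝓝 (t₀, conjIf F.anti s₀, conjIf F.anti s₀)) (𝓝 (s₀, t₀)) :=
      (((continuous_conjIf F.anti).comp (continuous_snd.comp continuous_snd)).prodMk
        continuous_fst).tendsto' _ _ (by simp)
    filter_upwards [T1.eventually hWp, T2.eventually hWp] with x h1 h2 h3 h4
    have e1 := (hmem (conjIf F.anti x.2.1) x.1).2 (by rwa [conjIf_conjIf])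
    have e2 := (hmem (conjIf F.anti x.2.2) x.1).2 (by rwa [conjIf_conjIf])
    have := hinj ⟨e1, h1⟩ ⟨e2, h2⟩ rfl
    exact conjIf_injective _
      ((Sphere.isOpenEmbedding_param u).injective (congrArg Prod.fst this))
  obtain ⟨η, hη0, hηd, hη⟩ := exists_graph_of_unique_root h0 huniq
  refine ⟨fun z => Sphere.param u (conjIf F.anti (η (Sphere.coord w z))), ?_, ?_, ?_, ?_⟩
  · change Sphere.param u (conjIf F.anti (η t₀)) = u
    rw [hη0, conjIf_conjIf, Sphere.param_coord_self]
  · refine ContinuousAt.comp (f := fun z => conjIf F.anti (η (Sphere.coord w z)))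
      (Sphere.isOpenEmbedding_param u).continuous.continuousAt ?_
    refine ContinuousAt.comp (f := fun z => η (Sphere.coord w z))
      (continuous_conjIf F.anti).continuousAt ?_
    exact ContinuousAt.comp (g := η) hηd.continuousAt (Sphere.continuousAt_coord w)
  · simp only [Sphere.coord_param, conjIf_conjIf]
    exact hηd
  · rw [← map_param_nhds_prod, eventually_map]
    have T : Tendsto (fun x : ℂ × ℂ => (x.2, conjIf F.anti x.1)) (𝓝 (s₀, t₀))
        (𝓝 (t₀, conjIf F.anti s₀)) :=
      continuousAt_snd.prodMk_nhds ((continuous_conjIf F.anti).continuousAt.comp continuousAt_fst)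
    filter_upwards [T.eventually hη] with x hx
    simp only [Prod.map, hmem, Sphere.coord_param]
    rw [hx, (Sphere.isOpenEmbedding_param u).injective.eq_iff]
    constructor
    · intro h
      rw [← h, conjIf_conjIf]
    · intro h
      rw [h, conjIf_conjIf]

end Correspondence

/-! ## Holomorphy at a point and change of charts -/

/-- `f` is continuous at `z`, and (anti)differentiable in the coordinates around `z` and `f z`. -/
def HoloAt (anti : Bool) (f : Sphere → Sphere) (z : Sphere) : Prop :=
  ContinuousAt f z ∧
    DifferentiableAt ℂ (fun t => conjIf anti (Sphere.coord (f z) (f (Sphere.param z t))))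
      (Sphere.coord z z)

theorem DifferentiableAt.conjIf_conjIf {f : ℂ → ℂ} {z : ℂ} (anti : Bool)
    (h : DifferentiableAt ℂ f (conjIf anti z)) :
    DifferentiableAt ℂ (fun t => conjIf anti (f (conjIf anti t))) z := by
  cases anti
  · exact h
  · exact differentiableAt_conj_conj_iff.2 h

theorem HoloAt.congr {anti : Bool} {f g : Sphere → Sphere} {z : Sphere} (h : HoloAt anti f z)
    (hfg : g =ᶠ[𝓝 z] f) : HoloAt anti g z := by
  refine ⟨h.1.congr hfg.symm, h.2.congr_of_eventuallyEq ?_⟩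
  rw [hfg.self_of_nhds]
  have hev : ∀ᶠ t in 𝓝 (Sphere.coord z z), g (Sphere.param z t) = f (Sphere.param z t) := by
    have := hfg
    rw [← Sphere.map_param_nhds] at this
    exact this
  filter_upwards [hev] with t ht
  rw [ht]

/-- `HoloAt` uses charts that move with the point; function theory on a disc needs one fixed pair of
charts, with poles off the point and its image. -/
theorem HoloAt.differentiableAt_chart {anti : Bool} {f : Sphere → Sphere} {a b : Sphere} {t₀ : ℂ}
    (h : HoloAt anti f (Sphere.chartInv a t₀)) (hb : f (Sphere.chartInv a t₀) ≠ b) :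
    DifferentiableAt ℂ (fun t => conjIf anti (Sphere.chart b (f (Sphere.chartInv a t)))) t₀ := by
  set z := Sphere.chartInv a t₀ with hz
  have hca : Tendsto (Sphere.chartInv a) (𝓝 t₀) (𝓝 z) := (Sphere.continuous_chartInv a).tendsto t₀
  have h1 : DifferentiableAt ℂ (fun t => Sphere.coord z (Sphere.chartInv a t)) t₀ := by
    rw [Sphere.coord_eq]
    exact Sphere.differentiableAt_chart_chartInv (Sphere.pole_ne z)
  have h2 : DifferentiableAt ℂ
      (fun t => conjIf anti (Sphere.coord (f z) (f (Sphere.chartInv a t)))) t₀ := by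
    have h3 := DifferentiableAt.comp
      (g := fun t => conjIf anti (Sphere.coord (f z) (f (Sphere.param z t)))) t₀ h.2 h1
    refine h3.congr_of_eventuallyEq ?_
    filter_upwards [hca.eventually (Sphere.eventually_param_coord z)] with t ht
    simp only [Function.comp_apply, ht]
  have h4 : DifferentiableAt ℂ (fun s => Sphere.chart b (Sphere.param (f z) s))
      (Sphere.coord (f z) (f z)) := by
    rw [Sphere.param_eq]
    refine Sphere.differentiableAt_chart_chartInv ?_
    rw [← Sphere.param_eq, Sphere.param_coord_self]
    exact hb
  have h4' : DifferentiableAt ℂ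
      (fun s => conjIf anti (Sphere.chart b (Sphere.param (f z) (conjIf anti s))))
      (conjIf anti (Sphere.coord (f z) (f (Sphere.chartInv a t₀)))) := by
    refine DifferentiableAt.conjIf_conjIf (f := fun s => Sphere.chart b (Sphere.param (f z) s)) anti ?_
    rw [_root_.conjIf_conjIf]
    exact h4
  have h5 := DifferentiableAt.comp t₀ h4' h2
  refine h5.congr_of_eventuallyEq ?_
  filter_upwards [(h.1.tendsto.comp hca).eventually (Sphere.eventually_param_coord (f z))] with t ht
  rw [Function.comp_apply] at ht
  simp only [Function.comp_apply, conjIf_conjIf, ht]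

namespace Correspondence

variable (F : Correspondence)

/-- Near a point over which `F` is injective, `Γ` consists of regular points and is the graph of an
(anti)holomorphic function of the second variable. -/
theorem exists_holo_inverse {u w : Sphere} {N : Set Sphere} (hN : N ∈ 𝓝 u)
    (hdisj : ∀ v ∈ N, ∀ v' ∈ N, ∀ y ∈ F.val v, y ∈ F.val v' → v = v') (hw : w ∈ F.val u) :
    ∃ (A B : Set Sphere) (g : Sphere → Sphere), IsOpen A ∧ IsOpen B ∧ u ∈ A ∧ w ∈ B ∧ A ⊆ N ∧
      g w = u ∧ MapsTo g B A ∧ (∀ y ∈ B, HoloAt F.anti g y) ∧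
      ∀ z ∈ A, ∀ y ∈ B, ((z, y) ∈ F.graph ↔ z = g y) := by
  have hinj : InjOn Prod.snd (F.graph ∩ N ×ˢ univ) := by
    rintro ⟨v, y⟩ ⟨h1, h2⟩ ⟨v', y'⟩ ⟨h1', h2'⟩ (rfl : y = y')
    rw [hdisj v h2.1 v' h2'.1 y h1 h1']
  -- The local graph theorem gives differentiability at the base point only. It is therefore
  -- available at every nearby point of Γ, and the resulting functions g' are matched with g by
  -- uniqueness.
  have key : ∀ v ∈ interior N, ∀ y ∈ F.val v, ∃ g : Sphere → Sphere, g y = v ∧ HoloAt F.anti g y ∧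
      ∀ᶠ x in 𝓝 (v, y), x ∈ F.graph ↔ x.1 = g x.2 := by
    intro v hv y hy
    obtain ⟨g, hg, hgc, hgd, hgr⟩ := F.exists_graph_of_injOn_snd hy
      (prod_mem_nhds (mem_interior_iff_mem_nhds.1 hv) univ_mem) hinj
    refine ⟨g, hg, ⟨hgc, ?_⟩, hgr⟩
    rwa [hg]
  obtain ⟨g, hg, hgh, hgr⟩ := key u (mem_interior_iff_mem_nhds.2 hN) w hw
  obtain ⟨A₀, hA₀, B₀, hB₀, hAB⟩ := (eventually_prod_iff.1 (nhds_prod_eq (x := u) (y := w) ▸ hgr))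
  obtain ⟨A, hAs, hA, huA⟩ := mem_nhds_iff.1 (inter_mem hA₀ hN)
  have hgA : ∀ᶠ y in 𝓝 w, g y ∈ A := by
    have := hgh.1.tendsto
    rw [hg] at this
    exact this.eventually (hA.mem_nhds huA)
  obtain ⟨B, hBs, hB, hwB⟩ := mem_nhds_iff.1 (hgA.and hB₀)
  have hiff : ∀ z ∈ A, ∀ y ∈ B, ((z, y) ∈ F.graph ↔ z = g y) := fun z hz y hy =>
    hAB (hAs hz).1 (hBs hy).2
  refine ⟨A, B, g, hA, hB, huA, hwB, fun z hz => (hAs hz).2, hg, fun y hy => (hBs hy).1, ?_, hiff⟩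
  intro y hy
  have hgy : g y ∈ A := (hBs hy).1
  obtain ⟨g', hg', hgh', hgr'⟩ := key (g y)
    (interior_maximal (fun z hz => (hAs hz).2) hA hgy) y ((hiff _ hgy y hy).2 rfl)
  refine hgh'.congr ?_
  have hT : Tendsto (fun y' => (g' y', y')) (𝓝 y) (𝓝 (g y, y)) := by
    have := hgh'.1.tendsto
    rw [hg'] at this
    exact this.prodMk_nhds tendsto_id
  have hA' : ∀ᶠ x : Sphere × Sphere in 𝓝 (g y, y), x.1 ∈ A ∧ x.2 ∈ B :=
    prod_mem_nhds (hA.mem_nhds hgy) (hB.mem_nhds hy)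
  filter_upwards [hT.eventually hgr', hT.eventually hA'] with y' h1 h2
  exact ((hiff _ h2.1 _ h2.2).1 (h1.2 rfl)).symm

/-- Over a point `u` that is not a critical value of `F⁻¹` and near which `F` is injective, every
value of `F` extends to a local (anti)holomorphic branch, which is open. -/
theorem exists_local_branch {u w : Sphere} {N : Set Sphere} (hN : N ∈ 𝓝 u)
    (hdisj : ∀ v ∈ N, ∀ v' ∈ N, ∀ y ∈ F.val v, y ∈ F.val v' → v = v')
    (hcv : u ∉ F.critValInv) (hw : w ∈ F.val u) :
    ∃ h : Sphere → Sphere, h u = w ∧ HoloAt F.anti h u ∧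
      (∀ᶠ x in 𝓝 (u, w), x ∈ F.graph ↔ x.2 = h x.1) ∧ 𝓝 w ≤ map h (𝓝 u) := by
  -- Removing the pole makes the coordinate around u injective on the whole neighbourhood.
  have hN' : N ∩ {Sphere.pole u}ᶜ ∈ 𝓝 u := inter_mem hN (isOpen_ne.mem_nhds (Sphere.pole_ne u))
  obtain ⟨A, B, g, hA, hB, huA, hwB, hAN, hgw, hgm, hgh, hiff⟩ :=
    F.exists_holo_inverse hN' (fun v hv v' hv' => hdisj v hv.1 v' hv'.1) hw
  have hreg : ∀ y ∈ B, (g y, y) ∈ F.regularPoints := fun y hy =>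
    ⟨(hiff _ (hgm hy) y hy).2 rfl, A, B, g, hA, hB, hgm hy, hy, Or.inr ⟨⟨hB, hgh⟩, hiff⟩⟩
  obtain ⟨W, hW, huW, hcomp⟩ : ∃ W : Set (Sphere × Sphere), IsOpen W ∧ (u, w) ∈ W ∧
      ∀ C, F.IsIrredComponent W C → InjOn Prod.fst C := by
    by_contra! hno
    exact hcv ⟨(u, w), ⟨hw, fun W hW huW => hno W hW huW⟩, rfl⟩
  set t₀ := Sphere.coord w w with ht₀
  have hpw : Sphere.param w t₀ = w := Sphere.param_coord_self w
  have hgc : ∀ y ∈ B, ContinuousAt g y := fun y hy => (hgh y hy).1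
  have hev : ∀ᶠ t in 𝓝 t₀, Sphere.param w t ∈ B ∧ (g (Sphere.param w t), Sphere.param w t) ∈ W := by
    have h1 : Tendsto (Sphere.param w) (𝓝 t₀) (𝓝 w) := by
      have := (Sphere.isOpenEmbedding_param w).continuous.tendsto t₀
      rwa [hpw] at this
    have h2 : ∀ᶠ y in 𝓝 w, y ∈ B ∧ (g y, y) ∈ W := by
      refine Filter.Eventually.and (hB.mem_nhds hwB) ?_
      have h3 : Tendsto (fun y => (g y, y)) (𝓝 w) (𝓝 (u, w)) := by
        have := (hgc w hwB).tendsto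
        rw [hgw] at this
        exact this.prodMk_nhds tendsto_id
      exact h3.eventually (hW.mem_nhds huW)
    exact h1.eventually h2
  obtain ⟨r, hr, hball⟩ := Metric.eventually_nhds_iff_ball.1 hev
  set D := Metric.ball t₀ r with hD
  have htD : t₀ ∈ D := Metric.mem_ball_self hr
  -- Near (u, w) the curve Γ is parametrised by its second coordinate and consists of regular
  -- points. The image of the disc is connected, so it lies in one irreducible component, on which
  -- the first projection is injective because u is not a critical value. The branch h is then the
  -- inverse of g.
  have hinj : InjOn (fun t => g (Sphere.param w t)) D := by
    set κ : ℂ → Sphere × Sphere := fun t => (g (Sphere.param w t), Sphere.param w t) with hκ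
    have hκc : ContinuousOn κ D := by
      intro t ht
      have h1 : ContinuousAt (fun t => g (Sphere.param w t)) t :=
        ContinuousAt.comp (hgc _ (hball t ht).1)
          (Sphere.isOpenEmbedding_param w).continuous.continuousAt
      exact (h1.prodMk (Sphere.isOpenEmbedding_param w).continuous.continuousAt).continuousWithinAt
    have hsub : κ '' D ⊆ F.regularPoints ∩ W := by
      rintro _ ⟨t, ht, rfl⟩
      exact ⟨hreg _ (hball t ht).1, (hball t ht).2⟩
    have hcc := ((convex_ball t₀ r).isPreconnected.image κ hκc).subset_connectedComponentIn
      (mem_image_of_mem κ htD) hsub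
    have hCi := hcomp _ ⟨κ t₀, hsub (mem_image_of_mem κ htD), rfl⟩
    have hmem : ∀ t ∈ D, κ t ∈ closure (connectedComponentIn (F.regularPoints ∩ W) (κ t₀)) ∩
        (F.graph ∩ W) := fun t ht =>
      ⟨subset_closure (hcc (mem_image_of_mem κ ht)), (hreg _ (hball t ht).1).1, (hball t ht).2⟩
    intro t ht t' ht' htt
    have := hCi (hmem t ht) (hmem t' ht') htt
    exact (Sphere.isOpenEmbedding_param w).injective (congrArg Prod.snd this)
  have hpole : ∀ z ∈ A, z ≠ Sphere.pole u := fun z hz => (hAN hz).2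
  have hcoordinj : ∀ z ∈ A, ∀ z' ∈ A, Sphere.coord u z = Sphere.coord u z' → z = z' := by
    intro z hz z' hz' h
    rw [Sphere.coord_eq] at h
    rw [← Sphere.chartInv_chart (hpole z hz), h, Sphere.chartInv_chart (hpole z' hz')]
  set γ : ℂ → ℂ := fun t => conjIf F.anti (Sphere.coord u (g (Sphere.param w t))) with hγ
  have hγd : DifferentiableOn ℂ γ D := by
    intro t ht
    refine DifferentiableAt.differentiableWithinAt ?_
    simp only [hγ, Sphere.coord_eq u, Sphere.param_eq w]
    have hB' := (hball t ht).1
    rw [Sphere.param_eq] at hB'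
    exact (hgh _ hB').differentiableAt_chart (hpole _ (hgm hB'))
  have hγi : InjOn γ D := by
    intro t ht t' ht' h
    exact hinj ht ht' (hcoordinj _ (hgm (hball t ht).1) _ (hgm (hball t' ht').1)
      (conjIf_injective _ h))
  set ψ := Function.invFunOn γ D with hψ
  have hγ0 : γ t₀ = conjIf F.anti (Sphere.coord u u) := by
    simp only [hγ, hpw, hgw]
  have hψ0 : ψ (conjIf F.anti (Sphere.coord u u)) = t₀ := by
    rw [← hγ0]
    exact hγi.leftInvOn_invFunOn htD
  have hψd : DifferentiableAt ℂ ψ (conjIf F.anti (Sphere.coord u u)) := by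
    rw [← hγ0]
    exact (hasDerivAt_invFunOn Metric.isOpen_ball hγd hγi htD).differentiableAt
  set h : Sphere → Sphere := fun v => Sphere.param w (ψ (conjIf F.anti (Sphere.coord u v))) with hh
  have hhu : h u = w := by
    simp only [hh, hψ0, hpw]
  have hccoord : ContinuousAt (fun v => conjIf F.anti (Sphere.coord u v)) u :=
    (continuous_conjIf F.anti).continuousAt.comp (Sphere.continuousAt_coord u)
  have hhc : ContinuousAt h u :=
    ContinuousAt.comp (f := fun v => ψ (conjIf F.anti (Sphere.coord u v)))
      (Sphere.isOpenEmbedding_param w).continuous.continuousAt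
      (ContinuousAt.comp (g := ψ) hψd.continuousAt hccoord)
  have hhg : ∀ t ∈ D, h (g (Sphere.param w t)) = Sphere.param w t := by
    intro t ht
    change Sphere.param w (ψ (γ t)) = _
    rw [hψ, hγi.leftInvOn_invFunOn ht]
  have hDw : ∀ᶠ y in 𝓝 w, ∃ t ∈ D, y = Sphere.param w t := by
    have := (Metric.isOpen_ball (x := t₀) (ε := r)).mem_nhds htD
    have h2 := image_mem_map (m := Sphere.param w) this
    rw [Sphere.map_param_nhds] at h2
    filter_upwards [h2] with y hy
    obtain ⟨t, ht, rfl⟩ := hy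
    exact ⟨t, ht, rfl⟩
  have hgt : Tendsto g (𝓝 w) (𝓝 u) := by
    have := (hgc w hwB).tendsto
    rwa [hgw] at this
  refine ⟨h, hhu, ⟨hhc, ?_⟩, ?_, ?_⟩
  · rw [hhu]
    simp only [hh, Sphere.coord_param]
    exact DifferentiableAt.conjIf_conjIf F.anti hψd
  · have h1 : Tendsto Prod.fst (𝓝 (u, w)) (𝓝 u) := continuousAt_fst
    have h2 : Tendsto Prod.snd (𝓝 (u, w)) (𝓝 w) := continuousAt_snd
    have h3 : ∀ᶠ v in 𝓝 u, conjIf F.anti (Sphere.coord u v) ∈ γ '' D :=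
      hccoord.tendsto.eventually ((isOpen_image_of_injOn Metric.isOpen_ball hγd hγi).mem_nhds
        (hγ0 ▸ mem_image_of_mem γ htD))
    filter_upwards [h1.eventually (hA.mem_nhds huA), h2.eventually hDw, h1.eventually h3]
      with x hx1 hx2 hx3
    obtain ⟨v, y⟩ := x
    obtain ⟨t, ht, hyt⟩ := hx2
    dsimp only at hyt hx1 hx3 ⊢
    have htB := (hball t ht).1
    have hiff' := hiff v hx1 y (hyt ▸ htB)
    rw [hiff']
    constructor
    · intro hv
      rw [hv, hyt, hhg t ht]
    · intro hy
      have e1 : ψ (conjIf F.anti (Sphere.coord u v)) = t :=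
        (Sphere.isOpenEmbedding_param w).injective (hy.symm.trans hyt)
      have e2 : γ t = conjIf F.anti (Sphere.coord u v) := by
        rw [← e1]
        exact Function.invFunOn_eq hx3
      rw [hyt]
      exact (hcoordinj _ (hgm htB) _ hx1 (conjIf_injective _ e2)).symm
  -- Openness of h at u follows from its continuous right inverse g.
  · calc 𝓝 w = map (h ∘ g) (𝓝 w) := by
          have : h ∘ g =ᶠ[𝓝 w] id := by
            filter_upwards [hDw] with y hy
            obtain ⟨t, ht, rfl⟩ := hy
            exact hhg t ht
          rw [Filter.map_congr this, Filter.map_id]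
      _ = map h (map g (𝓝 w)) := Filter.map_map.symm
      _ ≤ map h (𝓝 u) := map_mono hgt

end Correspondence

/-! ## Holomorphic curves in the sphere -/

/-- `k` is continuous at `t`, and (anti)differentiable in the coordinate around `k t`. -/
def HoloCurveAt (b : Bool) (k : ℂ → Sphere) (t : ℂ) : Prop :=
  ContinuousAt k t ∧ DifferentiableAt ℂ (fun s => conjIf b (Sphere.coord (k t) (k s))) t

theorem HoloCurveAt.congr {b : Bool} {k k' : ℂ → Sphere} {t : ℂ} (h : HoloCurveAt b k t)
    (hk : k' =ᶠ[𝓝 t] k) : HoloCurveAt b k' t := by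
  refine ⟨h.1.congr hk.symm, h.2.congr_of_eventuallyEq ?_⟩
  rw [hk.self_of_nhds]
  filter_upwards [hk] with s hs
  rw [hs]

theorem holoCurveAt_chartInv (a : Sphere) (t : ℂ) : HoloCurveAt false (Sphere.chartInv a) t := by
  refine ⟨(Sphere.continuous_chartInv a).continuousAt, ?_⟩
  rw [Sphere.coord_eq]
  exact Sphere.differentiableAt_chart_chartInv (Sphere.pole_ne _)

theorem HoloCurveAt.differentiableAt_chart {b : Bool} {k : ℂ → Sphere} {t : ℂ} {c : Sphere}
    (h : HoloCurveAt b k t) (hc : k t ≠ c) :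
    DifferentiableAt ℂ (fun s => conjIf b (Sphere.chart c (k s))) t := by
  have h4 : DifferentiableAt ℂ (fun s => Sphere.chart c (Sphere.param (k t) s))
      (Sphere.coord (k t) (k t)) := by
    rw [Sphere.param_eq]
    refine Sphere.differentiableAt_chart_chartInv ?_
    rw [← Sphere.param_eq, Sphere.param_coord_self]
    exact hc
  have h4' : DifferentiableAt ℂ
      (fun s => conjIf b (Sphere.chart c (Sphere.param (k t) (conjIf b s))))
      (conjIf b (Sphere.coord (k t) (k t))) := by
    refine DifferentiableAt.conjIf_conjIf (f := fun s => Sphere.chart c (Sphere.param (k t) s)) b ?_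
    rw [_root_.conjIf_conjIf]
    exact h4
  refine (DifferentiableAt.comp t h4' h.2).congr_of_eventuallyEq ?_
  filter_upwards [h.1.eventually (Sphere.eventually_param_coord (k t))] with s hs
  simp only [Function.comp_apply, conjIf_conjIf, hs]

theorem conjIf_xor (b b' : Bool) (z : ℂ) : conjIf (xor b b') z = conjIf b (conjIf b' z) := by
  cases b <;> cases b' <;> simp [conjIf]

theorem HoloAt.comp_curve {b b' : Bool} {h : Sphere → Sphere} {k : ℂ → Sphere} {t : ℂ}
    (hh : HoloAt b' h (k t)) (hk : HoloCurveAt b k t) : HoloCurveAt (xor b b') (h ∘ k) t := by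
  refine ⟨hh.1.comp hk.1, ?_⟩
  have h1 : DifferentiableAt ℂ (fun s => conjIf b (conjIf b'
      (Sphere.coord (h (k t)) (h (Sphere.param (k t) (conjIf b s))))))
      (conjIf b (Sphere.coord (k t) (k t))) := by
    refine DifferentiableAt.conjIf_conjIf
      (f := fun s => conjIf b' (Sphere.coord (h (k t)) (h (Sphere.param (k t) s)))) b ?_
    rw [_root_.conjIf_conjIf]
    exact hh.2
  refine (DifferentiableAt.comp t h1 hk.2).congr_of_eventuallyEq ?_
  filter_upwards [hk.1.eventually (Sphere.eventually_param_coord (k t))] with s hs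
  simp only [Function.comp_apply, conjIf_conjIf, conjIf_xor, hs]

namespace Correspondence

variable (F : Correspondence)

/-! ## Lifting through the curve -/

/-- `Γ` is near each point over `u` the graph of a function that is continuous at `u`. -/
def HasContinuousBranches (u : Sphere) : Prop :=
  ∀ w ∈ F.val u, ∃ h : Sphere → Sphere, h u = w ∧ ContinuousAt h u ∧
    ∀ᶠ x in 𝓝 (u, w), x ∈ F.graph ↔ x.2 = h x.1

/-- A local graph makes the projection locally injective. The branch h is known to be continuous
only at u, so openness at a neighbouring point uses the branch based there. -/
theorem isLocalHomeomorphOn_fst {s : Set Sphere} (hs : IsOpen s)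
    (hbr : ∀ u ∈ s, F.HasContinuousBranches u) :
    IsLocalHomeomorphOn (fun e : F.graph => e.1.1) ((fun e : F.graph => e.1.1) ⁻¹' s) := by
  rw [isLocalHomeomorphOn_iff_isOpenEmbedding_restrict]
  rintro ⟨⟨u, w⟩, he⟩ hu
  obtain ⟨h, -, -, hgr⟩ := hbr u hu w he
  have hnear : ∀ᶠ x : Sphere × Sphere in 𝓝 (u, w), (x ∈ F.graph ↔ x.2 = h x.1) ∧ x.1 ∈ s :=
    hgr.and (continuousAt_fst.eventually (hs.mem_nhds hu))
  obtain ⟨O, hO, hOo, huO⟩ := mem_nhds_iff.1 hnear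
  refine ⟨Subtype.val ⁻¹' O, continuous_subtype_val.continuousAt.preimage_mem_nhds
    (hOo.mem_nhds huO), ?_⟩
  refine .of_continuous_injective_isOpenMap
    (continuous_fst.comp (continuous_subtype_val.comp continuous_subtype_val)) ?_ ?_
  · rintro ⟨⟨⟨v, y⟩, h1⟩, h2⟩ ⟨⟨⟨v', y'⟩, h1'⟩, h2'⟩ (rfl : v = v')
    have e1 : y = h v := (hO h2).1.1 h1
    have e2 : y' = h v := (hO h2').1.1 h1'
    subst e1 e2
    rfl
  · rw [isOpenMap_iff_nhds_le]
    rintro ⟨⟨⟨v, y⟩, h1⟩, h2⟩ K hK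
    rw [mem_map, nhds_subtype_eq_comap, nhds_subtype_eq_comap, comap_comap, mem_comap] at hK
    obtain ⟨V, hV, hVK⟩ := hK
    have hvs : v ∈ s := (hO h2).2
    obtain ⟨h', hv', hc', hgr'⟩ := hbr v hvs y h1
    have hT : Tendsto (fun v' => (v', h' v')) (𝓝 v) (𝓝 (v, y)) := by
      have := hc'.tendsto
      rw [hv'] at this
      exact tendsto_id.prodMk_nhds this
    filter_upwards [hT.eventually hgr', hT.eventually hV, hT.eventually (hOo.mem_nhds h2)]
      with v' e1 e2 e3
    exact hVK (a := ⟨⟨(v', h' v'), e1.2 rfl⟩, e3⟩) e2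

/-- Lifting of a map from a disc through `Γ`. -/
theorem exists_lift {s : Set Sphere} (hs : IsOpen s) (hbr : ∀ u ∈ s, F.HasContinuousBranches u)
    {c : ℂ} {r : ℝ} {k : ℂ → Sphere} (hk : ContinuousOn k (Metric.ball c r))
    (hks : ∀ t ∈ Metric.ball c r, k t ∈ s) {t₀ : ℂ} (ht₀ : t₀ ∈ Metric.ball c r) {w : Sphere}
    (hw : w ∈ F.val (k t₀)) :
    ∃ k' : ℂ → Sphere, ContinuousOn k' (Metric.ball c r) ∧ k' t₀ = w ∧
      ∀ t ∈ Metric.ball c r, k' t ∈ F.val (k t) := by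
  classical
  have : CompactSpace F.graph := isCompact_iff_compactSpace.1 F.isClosed_graph.isCompact
  -- Compactness of Γ upgrades the local homeomorphism to a covering over s; a disc is contractible,
  -- so maps from it lift.
  have hcov : IsCoveringMapOn (fun e : F.graph => e.1.1) s :=
    IsCoveringMapOn.of_isLocalHomeomorphOn (continuous_fst.comp continuous_subtype_val)
      (F.isLocalHomeomorphOn_fst hs hbr)
  have : LocallyPathConnectedSpace (Metric.ball c r) :=
    Metric.isOpen_ball.locallyPathConnectedSpace
  have : ContractibleSpace (Metric.ball c r) := (convex_ball c r).contractibleSpace ⟨t₀, ht₀⟩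
  obtain ⟨Φ, ⟨hΦ0, hΦ⟩, -⟩ := hcov.existsUnique_continuousMap_lifts
    (A := Metric.ball c r) ⟨fun t => k t, continuousOn_iff_continuous_domRestrict.1 hk⟩
    (a₀ := ⟨t₀, ht₀⟩) (e₀ := ⟨(k t₀, w), hw⟩) rfl (fun t => hks t t.2)
  have hΦ' : ∀ t, (Φ t).1.1 = k t := fun t => congrFun hΦ t
  refine ⟨fun t => if ht : t ∈ Metric.ball c r then (Φ ⟨t, ht⟩).1.2 else w, ?_, ?_, ?_⟩
  · rw [continuousOn_iff_continuous_domRestrict]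
    have : (Metric.ball c r).domRestrict
        (fun t => if ht : t ∈ Metric.ball c r then (Φ ⟨t, ht⟩).1.2 else w) =
        fun t => (Φ t).1.2 := by
      funext t
      exact dif_pos t.2
    rw [this]
    exact continuous_snd.comp (continuous_subtype_val.comp Φ.continuous)
  · simp only [ht₀, dite_true, hΦ0]
  · intro t ht
    simp only [ht, dite_true]
    have := (Φ ⟨t, ht⟩).2
    rw [← hΦ' ⟨t, ht⟩]
    exact this

/-! ## Towers of sections over discs -/

/-- Over the part of the sphere parametrised by `D` in the chart with pole `a`, all iterates of `F`
are injective and unbranched. -/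
structure IsUnbranchedDisc (a : Sphere) (D : Set ℂ) : Prop where
  isOpen : IsOpen D
  inj : ∀ n, ∀ s ∈ D, ∀ t ∈ D, ∀ w ∈ F.iter n (Sphere.chartInv a s),
    w ∈ F.iter n (Sphere.chartInv a t) → s = t
  notMem_critValInv : ∀ n, ∀ s ∈ D, ∀ u ∈ F.iter n (Sphere.chartInv a s), u ∉ F.critValInv

/-- A continuous choice of orbits of length `n`, starting at the points parametrised by `D`. -/
structure IsTower (a : Sphere) (D : Set ℂ) (n : ℕ) (k : ℕ → ℂ → Sphere) : Prop where
  zero : ∀ t ∈ D, k 0 t = Sphere.chartInv a t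
  succ : ∀ i < n, ∀ t ∈ D, k (i + 1) t ∈ F.val (k i t)
  continuousOn : ∀ i ≤ n, ContinuousOn (k i) D

variable {F}

theorem mem_iter_succ {n : ℕ} {z w : Sphere} :
    w ∈ F.iter (n + 1) z ↔ ∃ y ∈ F.iter n z, w ∈ F.val y := by
  simp [iter]

theorem IsTower.mem_iter {a : Sphere} {D : Set ℂ} {n : ℕ} {k : ℕ → ℂ → Sphere}
    (h : F.IsTower a D n k) {i : ℕ} (hi : i ≤ n) {t : ℂ} (ht : t ∈ D) :
    k i t ∈ F.iter i (Sphere.chartInv a t) := by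
  induction i with
  | zero => exact h.zero t ht
  | succ i ih => exact mem_iter_succ.2 ⟨_, ih (by omega), h.succ i (by omega) t ht⟩

theorem IsTower.injOn {a : Sphere} {D : Set ℂ} {n : ℕ} {k : ℕ → ℂ → Sphere}
    (h : F.IsTower a D n k) (hD : F.IsUnbranchedDisc a D) {i : ℕ} (hi : i ≤ n) :
    InjOn (k i) D := fun s hs t ht hst =>
  hD.inj i s hs t ht _ (h.mem_iter hi hs) (hst ▸ h.mem_iter hi ht)

/-- The image of the disc under k is a neighbourhood of k(t) by openness, and injectivity of the
iterate i + 1 over the disc makes F injective on that image. -/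
theorem IsUnbranchedDisc.exists_local_branch {a : Sphere} {D : Set ℂ}
    (hD : F.IsUnbranchedDisc a D) {i : ℕ} {k : ℂ → Sphere}
    (hk : ∀ t ∈ D, k t ∈ F.iter i (Sphere.chartInv a t)) {t : ℂ} (ht : t ∈ D)
    (hopen : 𝓝 (k t) ≤ map k (𝓝 t)) {w : Sphere} (hw : w ∈ F.val (k t)) :
    ∃ h : Sphere → Sphere, h (k t) = w ∧ HoloAt F.anti h (k t) ∧
      (∀ᶠ x in 𝓝 (k t, w), x ∈ F.graph ↔ x.2 = h x.1) ∧ 𝓝 w ≤ map h (𝓝 (k t)) := by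
  refine F.exists_local_branch (hopen (image_mem_map (hD.isOpen.mem_nhds ht))) ?_
    (hD.notMem_critValInv i t ht _ (hk t ht)) hw
  rintro _ ⟨s, hs, rfl⟩ _ ⟨s', hs', rfl⟩ y hy hy'
  rw [hD.inj (i + 1) s hs s' hs' y (mem_iter_succ.2 ⟨_, hk s hs, hy⟩)
    (mem_iter_succ.2 ⟨_, hk s' hs', hy'⟩)]

/-- Holomorphy and openness must be proved together: openness at level i is what provides a local
branch at k i t, and the next section is this branch composed with k i. -/
theorem IsTower.holo_and_open {a : Sphere} {D : Set ℂ} {n : ℕ} {k : ℕ → ℂ → Sphere}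
    (h : F.IsTower a D n k) (hD : F.IsUnbranchedDisc a D) {i : ℕ} (hi : i ≤ n) :
    ∃ b : Bool, ∀ t ∈ D, HoloCurveAt b (k i) t ∧ 𝓝 (k i t) ≤ map (k i) (𝓝 t) := by
  induction i with
  | zero =>
    refine ⟨false, fun t ht => ?_⟩
    have heq : k 0 =ᶠ[𝓝 t] Sphere.chartInv a := by
      filter_upwards [hD.isOpen.mem_nhds ht] with s hs using h.zero s hs
    refine ⟨(holoCurveAt_chartInv a t).congr heq, ?_⟩
    rw [Filter.map_congr heq, h.zero t ht, (Sphere.isOpenEmbedding_chartInv a).map_nhds_eq]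
  | succ i ih =>
    obtain ⟨b, hb⟩ := ih (by omega)
    -- Each step with an antiholomorphic correspondence flips the type.
    refine ⟨xor b F.anti, fun t ht => ?_⟩
    obtain ⟨g, hg, hgh, hgr, hgo⟩ := hD.exists_local_branch
      (fun t ht => h.mem_iter (by omega : i ≤ n) ht) ht (hb t ht).2 (h.succ i (by omega) t ht)
    have hc : Tendsto (fun s => (k i s, k (i + 1) s)) (𝓝 t) (𝓝 (k i t, k (i + 1) t)) :=
      ((h.continuousOn i (by omega)).continuousAt (hD.isOpen.mem_nhds ht)).prodMk_nhds
        ((h.continuousOn (i + 1) hi).continuousAt (hD.isOpen.mem_nhds ht))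
    have heq : k (i + 1) =ᶠ[𝓝 t] g ∘ k i := by
      filter_upwards [hc.eventually hgr, hD.isOpen.mem_nhds ht] with s hs hsD
      exact hs.1 (h.succ i (by omega) s hsD)
    refine ⟨(hgh.comp_curve (hb t ht).1).congr heq, ?_⟩
    rw [Filter.map_congr heq, ← Filter.map_map]
    exact hgo.trans (map_mono (hb t ht).2)

/-- The image of the last section is open and has continuous branches at every point, so the section
lifts through Γ with any prescribed value at t₀. -/
theorem IsTower.exists_succ {a : Sphere} {c : ℂ} {r : ℝ} {n : ℕ} {k : ℕ → ℂ → Sphere}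
    (h : F.IsTower a (Metric.ball c r) n k) (hD : F.IsUnbranchedDisc a (Metric.ball c r)) {t₀ : ℂ}
    (ht₀ : t₀ ∈ Metric.ball c r) {w : Sphere} (hw : w ∈ F.val (k n t₀)) :
    ∃ k' : ℂ → Sphere, k' t₀ = w ∧
      F.IsTower a (Metric.ball c r) (n + 1) (Function.update k (n + 1) k') := by
  obtain ⟨b, hb⟩ := h.holo_and_open hD le_rfl
  have hopen : IsOpen (k n '' Metric.ball c r) := by
    rw [isOpen_iff_mem_nhds]
    rintro _ ⟨t, ht, rfl⟩
    exact (hb t ht).2 (image_mem_map (hD.isOpen.mem_nhds ht))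
  obtain ⟨k', hk', hk0, hkm⟩ := F.exists_lift hopen (by
    rintro _ ⟨t, ht, rfl⟩ y hy
    obtain ⟨g, hg, hgh, hgr, -⟩ := hD.exists_local_branch
      (fun t ht => h.mem_iter le_rfl ht) ht (hb t ht).2 hy
    exact ⟨g, hg, hgh.1, hgr⟩) (h.continuousOn n le_rfl) (fun t ht => mem_image_of_mem _ ht) ht₀ hw
  refine ⟨k', hk0, ?_, ?_, ?_⟩
  · intro t ht
    rw [Function.update_of_ne (by omega)]
    exact h.zero t ht
  · intro i hi t ht
    rw [Function.update_of_ne (by omega : i ≠ n + 1)]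
    rcases (Nat.lt_succ_iff.1 hi).lt_or_eq with h' | rfl
    · rw [Function.update_of_ne (by omega)]
      exact h.succ i h' t ht
    · rw [Function.update_self]
      exact hkm t ht
  · intro i hi
    rcases hi.lt_or_eq with h' | rfl
    · rw [Function.update_of_ne (by omega)]
      exact h.continuousOn i (by omega)
    · rw [Function.update_self]
      exact hk'

/-- Every orbit of a point of an unbranched disc extends to a tower of sections. -/
theorem IsUnbranchedDisc.exists_tower {a : Sphere} {c : ℂ} {r : ℝ}
    (hD : F.IsUnbranchedDisc a (Metric.ball c r)) {t₀ : ℂ} (ht₀ : t₀ ∈ Metric.ball c r)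
    {v : ℕ → Sphere} (hv0 : v 0 = Sphere.chartInv a t₀) (n : ℕ)
    (hv : ∀ i < n, v (i + 1) ∈ F.val (v i)) :
    ∃ k : ℕ → ℂ → Sphere, F.IsTower a (Metric.ball c r) n k ∧ ∀ i ≤ n, k i t₀ = v i := by
  induction n with
  | zero =>
    refine ⟨fun _ => Sphere.chartInv a, ⟨fun _ _ => rfl, fun i hi => absurd hi (Nat.not_lt_zero i),
      fun _ _ => (Sphere.continuous_chartInv a).continuousOn⟩, fun i hi => ?_⟩
    rw [Nat.le_zero.1 hi, hv0]
  | succ n ih =>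
    obtain ⟨k, hk, hkv⟩ := ih fun i hi => hv i (by omega)
    obtain ⟨k', hk', ht⟩ := hk.exists_succ hD ht₀ (w := v (n + 1))
      (by rw [hkv n le_rfl]; exact hv n (by omega))
    refine ⟨_, ht, fun i hi => ?_⟩
    rcases hi.lt_or_eq with h' | rfl
    · rw [Function.update_of_ne (by omega)]
      exact hkv i (by omega)
    · rw [Function.update_self, hk']

end Correspondence

/-! ## Equicontinuity of univalent curves omitting two points -/

/-- `k` is an injective (anti)holomorphic curve on `D` omitting the points `p` and `q`. -/
structure IsUnivalentCurve (p q : Sphere) (D : Set ℂ) (k : ℂ → Sphere) : Prop where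
  injOn : InjOn k D
  holo : ∃ b, ∀ t ∈ D, HoloCurveAt b k t
  omits : ∀ t ∈ D, k t ≠ p ∧ k t ≠ q

theorem IsUnivalentCurve.symm {p q : Sphere} {D : Set ℂ} {k : ℂ → Sphere}
    (h : IsUnivalentCurve p q D k) : IsUnivalentCurve q p D k :=
  ⟨h.injOn, h.holo, fun t ht => (h.omits t ht).symm⟩

theorem Sphere.injOn_chart (p : Sphere) : InjOn (Sphere.chart p) {p}ᶜ := fun z hz z' hz' h => by
  rw [← Sphere.chartInv_chart hz, h, Sphere.chartInv_chart hz']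

/-- The coordinate representation of an injective (anti)holomorphic curve in the chart with pole
`a`. -/
theorem exists_chart_representation {D : Set ℂ} {k : ℂ → Sphere} {b : Bool} {a : Sphere}
    (hinj : InjOn k D) (hk : ∀ t ∈ D, HoloCurveAt b k t) (ha : ∀ t ∈ D, k t ≠ a) :
    DifferentiableOn ℂ (fun t => conjIf b (Sphere.chart a (k t))) D ∧
      InjOn (fun t => conjIf b (Sphere.chart a (k t))) D := by
  refine ⟨fun t ht => ((hk t ht).differentiableAt_chart (ha t ht)).differentiableWithinAt,
    fun t ht t' ht' h => hinj ht ht' (Sphere.injOn_chart a (ha t ht) (ha t' ht')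
      (conjIf_injective b h))⟩

/-- In the chart with pole p the curve is a univalent function omitting the value of q. Koebe bounds
its derivative, and then its growth, by the distance to that omitted value. -/
theorem IsUnivalentCurve.dist_chart_le {p q : Sphere} (hpq : p ≠ q) {D : Set ℂ} {k : ℂ → Sphere}
    (h : IsUnivalentCurve p q D k) {s t : ℂ} {ρ : ℝ} (hρ : 0 < ρ) (hs : Metric.ball s ρ ⊆ D)
    (ht : dist t s < ρ / 2) :
    dist (Sphere.chart p (k t)) (Sphere.chart p (k s)) ≤
      1600000000 / ρ * dist t s * dist (Sphere.chart p (k s)) (Sphere.chart p q) := by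
  obtain ⟨b, hb⟩ := h.holo
  obtain ⟨hd, hi⟩ := exists_chart_representation (h.injOn.mono hs) (fun t ht => hb t (hs ht))
    (fun t ht => (h.omits t (hs ht)).1)
  set E : ℂ → ℂ := fun t => conjIf b (Sphere.chart p (k t)) with hE
  set e := conjIf b (Sphere.chart p q) with he
  have hom : e ∉ E '' Metric.ball s ρ := by
    rintro ⟨t, ht, hte⟩
    have h1 := conjIf_injective b hte
    exact (h.omits t (hs ht)).2 (Sphere.injOn_chart p (h.omits t (hs ht)).1 hpq.symm h1)
  obtain ⟨hsub, hgr⟩ := koebe_distortion hρ hd hi hom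
  have h1 : ρ * ‖deriv E s‖ ≤ 40000 * dist (E s) e := by
    by_contra! hlt
    refine hom (hsub ?_)
    rw [Metric.mem_ball, dist_comm, lt_div_iff₀ (by norm_num)]
    linarith
  -- 800000000 = 20000 · 40000, doubled in the statement by the Schwarz lemma on radius ρ/2.
  have hmaps : MapsTo E (Metric.ball s (ρ / 2))
      (Metric.closedBall (E s) (800000000 * dist (E s) e)) := by
    intro w hw
    rw [Metric.mem_closedBall, dist_eq_norm]
    refine (hgr w (Metric.ball_subset_closedBall hw)).trans ?_
    linarith
  have h2 := Complex.dist_le_div_mul_dist_of_mapsTo_ball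
    (hd.mono (Metric.ball_subset_ball (half_le_self hρ.le))) hmaps (Metric.mem_ball.2 ht)
  simp only [hE, he, dist_conjIf] at h2
  refine h2.trans (le_of_eq ?_)
  field_simp
  ring

/-- Equicontinuity of univalent curves omitting two points, in the form in which it is used: base
points s i tending to t can be replaced by t in the limit. -/
theorem tendsto_of_tendsto_univalentCurve {ι : Type*} {l : Filter ι} {p q : Sphere} (hpq : p ≠ q)
    {D : Set ℂ} (hD : IsOpen D) {k : ι → ℂ → Sphere}
    (hk : ∀ᶠ i in l, IsUnivalentCurve p q D (k i)) {s : ι → ℂ} {t : ℂ} (ht : t ∈ D)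
    (hs : Tendsto s l (𝓝 t)) {v : Sphere} (hv : Tendsto (fun i => k i (s i)) l (𝓝 v)) :
    Tendsto (fun i => k i t) l (𝓝 v) := by
  -- The chart with pole p sees the limit only if v ≠ p; otherwise v ≠ q and the two omitted points
  -- change roles.
  wlog hvp : v ≠ p generalizing p q
  · have hvq : v ≠ q := fun h' => hpq ((not_not.1 hvp).symm.trans h')
    exact this hpq.symm (hk.mono fun i hi => hi.symm) hvq
  obtain ⟨ε, hε, hb⟩ := Metric.isOpen_iff.1 hD t ht
  set ρ := ε / 2 with hρ
  have hρ0 : 0 < ρ := half_pos hε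
  have hc : Tendsto (fun i => Sphere.chart p (k i (s i))) l (𝓝 (Sphere.chart p v)) :=
    (Sphere.continuousAt_chart hvp).tendsto.comp hv
  have hd0 : Tendsto (fun i => dist t (s i)) l (𝓝 0) := by
    have := (tendsto_const_nhds (x := t)).dist hs
    rwa [dist_self] at this
  have hbound : Tendsto (fun i => 1600000000 / ρ * dist t (s i) *
      dist (Sphere.chart p (k i (s i))) (Sphere.chart p q)) l (𝓝 0) := by
    have := (hd0.const_mul (1600000000 / ρ)).mul (hc.dist (tendsto_const_nhds (x := Sphere.chart p q)))
    simpa using this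
  have hdist : Tendsto (fun i => dist (Sphere.chart p (k i t)) (Sphere.chart p (k i (s i)))) l
      (𝓝 0) := by
    refine squeeze_zero' (.of_forall fun _ => dist_nonneg) ?_ hbound
    filter_upwards [hk, hd0.eventually (gt_mem_nhds (half_pos hρ0))] with i hi hdi
    refine hi.dist_chart_le hpq hρ0 ?_ hdi
    refine (Metric.ball_subset_ball' ?_).trans hb
    rw [dist_comm]
    linarith
  have hct : Tendsto (fun i => Sphere.chart p (k i t)) l (𝓝 (Sphere.chart p v)) := by
    rw [tendsto_iff_dist_tendsto_zero] at hc ⊢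
    refine squeeze_zero (fun _ => dist_nonneg) (fun i => dist_triangle _ (Sphere.chart p (k i (s i))) _) ?_
    simpa using hdist.add hc
  have := (Sphere.continuous_chartInv p).continuousAt.tendsto.comp hct
  rw [Sphere.chartInv_chart hvp] at this
  refine this.congr' ?_
  filter_upwards [hk] with i hi
  exact Sphere.chartInv_chart (hi.omits t ht).1

/-- A version uniform in the curve: a family of counterexamples, followed along an ultrafilter,
would contradict the previous limit theorem. -/
theorem eventually_forall_univalentCurve_mem {p q : Sphere} (hpq : p ≠ q) {D : Set ℂ}
    (hD : IsOpen D) {t : ℂ} (ht : t ∈ D) {K O : Set Sphere} (hK : IsClosed K) (hO : IsOpen O)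
    (hKO : K ⊆ O) :
    ∀ᶠ s in 𝓝 t, ∀ k : ℂ → Sphere, IsUnivalentCurve p q D k → k s ∈ K → k t ∈ O := by
  by_contra hcon
  rw [not_eventually] at hcon
  set bad : Set ((ℂ → Sphere) × ℂ) :=
    {x | IsUnivalentCurve p q D x.1 ∧ x.1 x.2 ∈ K ∧ x.1 t ∉ O} with hbad
  have hne : (comap Prod.snd (𝓝 t) ⊓ 𝓟 bad).NeBot := by
    rw [inf_principal_neBot_iff]
    rintro V ⟨N, hN, hNV⟩
    obtain ⟨s, hs, hsN⟩ := (hcon.and_eventually hN).exists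
    push Not at hs
    obtain ⟨k, hk, hks, hkt⟩ := hs
    exact ⟨(k, s), hNV hsN, hk, hks, hkt⟩
  set 𝒰 := Ultrafilter.of (comap Prod.snd (𝓝 t) ⊓ 𝓟 bad) with h𝒰
  have hle := Ultrafilter.of_le (comap Prod.snd (𝓝 t) ⊓ 𝓟 bad)
  have hbad' : ∀ᶠ x in (𝒰 : Filter ((ℂ → Sphere) × ℂ)), x ∈ bad :=
    (hle.trans inf_le_right) (mem_principal_self bad)
  have hs : Tendsto Prod.snd (𝒰 : Filter ((ℂ → Sphere) × ℂ)) (𝓝 t) :=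
    tendsto_iff_comap.2 (hle.trans inf_le_left)
  set v := (𝒰.map fun x : (ℂ → Sphere) × ℂ => x.1 x.2).lim with hv
  have hlim : Tendsto (fun x : (ℂ → Sphere) × ℂ => x.1 x.2) 𝒰 (𝓝 v) :=
    (𝒰.map fun x : (ℂ → Sphere) × ℂ => x.1 x.2).le_nhds_lim
  have hvK : v ∈ K := hK.mem_of_tendsto hlim (hbad'.mono fun x hx => hx.2.1)
  have := tendsto_of_tendsto_univalentCurve hpq hD (k := fun x : (ℂ → Sphere) × ℂ => x.1)
    (hbad'.mono fun x hx => hx.1) ht hs hlim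
  obtain ⟨x, hx, hx'⟩ := (hbad'.and (this.eventually (hO.mem_nhds (hKO hvK)))).exists
  exact hx.2.2 hx'

/-! ## Dynamics on the limit set -/

namespace Correspondence

variable {F : Correspondence} {x : Sphere}

theorem isClosed_limitSet : IsClosed (F.limitSet x) := isClosed_iInter fun _ => isClosed_closure

theorem iter_one (z : Sphere) : F.iter 1 z = F.val z := by
  simp [iter]

theorem mem_iter_add {m n : ℕ} {z w : Sphere} :
    w ∈ F.iter (m + n) z ↔ ∃ y ∈ F.iter m z, w ∈ F.iter n y := by
  induction n generalizing w with
  | zero => simp [iter]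
  | succ n ih =>
    rw [← add_assoc, mem_iter_succ]
    simp only [ih, mem_iter_succ]
    constructor
    · rintro ⟨y, ⟨y', h1, h2⟩, h3⟩
      exact ⟨y', h1, y, h2, h3⟩
    · rintro ⟨y', h1, y, h2, h3⟩
      exact ⟨y, ⟨y', h1, h2⟩, h3⟩

theorem isClosed_iterGraph (F : Correspondence) (n : ℕ) :
    IsClosed {p : Sphere × Sphere | p.2 ∈ F.iter n p.1} := by
  induction n with
  | zero =>
    have : {p : Sphere × Sphere | p.2 ∈ F.iter 0 p.1} = {p | p.2 = p.1} := rfl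
    rw [this]
    exact isClosed_eq continuous_snd continuous_fst
  | succ n ih =>
    have : {p : Sphere × Sphere | p.2 ∈ F.iter (n + 1) p.1} =
        Prod.fst '' {p : (Sphere × Sphere) × Sphere |
          p.2 ∈ F.iter n p.1.1 ∧ (p.2, p.1.2) ∈ F.graph} := by
      ext ⟨z, w⟩
      simp only [mem_ofPred_eq, mem_iter_succ, mem_image]
      constructor
      · rintro ⟨y, h1, h2⟩
        exact ⟨((z, w), y), ⟨h1, h2⟩, rfl⟩
      · rintro ⟨⟨p, y⟩, ⟨h1, h2⟩, rfl⟩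
        exact ⟨y, h1, h2⟩
    rw [this]
    refine isClosedMap_fst_of_compactSpace _ (IsClosed.inter ?_ ?_)
    · exact ih.preimage ((continuous_fst.comp continuous_fst).prodMk continuous_snd)
    · exact F.isClosed_graph.preimage
        (continuous_snd.prodMk (continuous_snd.comp continuous_fst))

theorem IsInverseLike.mem_of_mem_val (h : F.IsInverseLike (F.limitSet x)) {z w : Sphere}
    (hz : z ∈ F.limitSet x) (hw : w ∈ F.val z) : w ∈ F.limitSet x :=
  h.1 (mem_iUnion₂.2 ⟨z, hz, by rwa [iter_one]⟩)

theorem IsInverseLike.mem_of_mem_iter (h : F.IsInverseLike (F.limitSet x)) {n : ℕ} {z w : Sphere}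
    (hz : z ∈ F.limitSet x) (hw : w ∈ F.iter n z) : w ∈ F.limitSet x := by
  induction n generalizing w with
  | zero =>
    obtain rfl : w = z := hw
    exact hz
  | succ n ih =>
    obtain ⟨y, hy, hwy⟩ := mem_iter_succ.1 hw
    exact h.mem_of_mem_val (ih hy) hwy

/-- At a parabolic point a branch of some F^q exists; elsewhere the image of F(z) under the
extension of g is the singleton {z}, so F(z) is not empty. -/
theorem IsMinimalLimitSet.val_nonempty (h : F.IsMinimalLimitSet x) {z : Sphere}
    (hz : z ∈ F.limitSet x) : (F.val z).Nonempty := by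
  by_cases hp : z ∈ F.parabolicSet x
  · obtain ⟨-, q, hq, W, f, hzW, ⟨M, fs, -, hfs, j, hj⟩, -⟩ := hp
    have h1 : fs j z ∈ F.iter q z := by
      rw [hfs z hzW]
      exact mem_range_self j
    obtain ⟨q', rfl⟩ := Nat.exists_eq_add_of_le hq
    obtain ⟨y, hy, -⟩ := mem_iter_add.1 h1
    rw [iter_one] at hy
    exact ⟨y, hy⟩
  · obtain ⟨U, hU, hext, -⟩ := h.extension z ⟨hz, hp⟩
    obtain ⟨G, -, hG⟩ := hext 1
    have := hG z (mem_of_mem_nhds hU)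
    rw [iter_one] at this
    exact image_nonempty.1 (this ▸ singleton_nonempty z)

/-- F(Λ) is closed by compactness, nonempty and forward invariant, so minimality forces F(Λ) = Λ.
Hence g is defined on the whole limit set. -/
theorem IsMinimalLimitSet.exists_preimage (h : F.IsMinimalLimitSet x) {w : Sphere}
    (hw : w ∈ F.limitSet x) : ∃ z ∈ F.limitSet x, w ∈ F.val z := by
  have heq : F.image 1 (F.limitSet x) = Prod.snd '' (F.graph ∩ F.limitSet x ×ˢ univ) := by
    ext y
    simp only [image, mem_iUnion₂, iter_one, mem_image, exists_prop]
    constructor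
    · rintro ⟨z, hz, hy⟩
      exact ⟨(z, y), ⟨hy, hz, mem_univ _⟩, rfl⟩
    · rintro ⟨⟨z, y'⟩, ⟨hy, hz, -⟩, rfl⟩
      exact ⟨z, hz, hy⟩
  have hA := h.closed_invariant (F.image 1 (F.limitSet x)) h.inverseLike.1 ?_ ?_ ?_
  · rw [← hA] at hw
    obtain ⟨z, hz, hwz⟩ := mem_iUnion₂.1 hw
    rw [iter_one] at hwz
    exact ⟨z, hz, hwz⟩
  · rw [heq]
    exact isClosedMap_snd_of_compactSpace _
      (F.isClosed_graph.inter (isClosed_limitSet.prod isClosed_univ))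
  · obtain ⟨y, hy⟩ := h.val_nonempty hw
    exact ⟨y, mem_iUnion₂.2 ⟨w, hw, by rwa [iter_one]⟩⟩
  · exact biUnion_subset_biUnion_left h.inverseLike.1

theorem IsMinimalLimitSet.invMap_spec (h : F.IsMinimalLimitSet x) {w : Sphere}
    (hw : w ∈ F.limitSet x) :
    F.invMap (F.limitSet x) w ∈ F.limitSet x ∧ w ∈ F.val (F.invMap (F.limitSet x) w) :=
  Classical.epsilon_spec (p := fun z => z ∈ F.limitSet x ∧ w ∈ F.val z) (h.exists_preimage hw)

theorem IsInverseLike.eq_of_mem_val (h : F.IsInverseLike (F.limitSet x)) {z z' w : Sphere}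
    (hz : z ∈ F.limitSet x) (hz' : z' ∈ F.limitSet x) (hw : w ∈ F.val z) (hw' : w ∈ F.val z') :
    z = z' :=
  (h.2 w (mem_iUnion₂.2 ⟨z, hz, by rwa [iter_one]⟩)).unique ⟨hz, hw⟩ ⟨hz', hw'⟩

theorem IsMinimalLimitSet.iterate_invMap_spec (h : F.IsMinimalLimitSet x) (n : ℕ) {w : Sphere}
    (hw : w ∈ F.limitSet x) : (F.invMap (F.limitSet x))^[n] w ∈ F.limitSet x ∧
      w ∈ F.iter n ((F.invMap (F.limitSet x))^[n] w) := by
  induction n generalizing w with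
  | zero => exact ⟨hw, rfl⟩
  | succ n ih =>
    rw [Function.iterate_succ_apply]
    have h1 := h.invMap_spec hw
    exact ⟨(ih h1.1).1, mem_iter_succ.2 ⟨_, (ih h1.1).2, h1.2⟩⟩

theorem IsMinimalLimitSet.iterate_invMap_eq (h : F.IsMinimalLimitSet x) {n : ℕ} {z w : Sphere}
    (hz : z ∈ F.limitSet x) (hw : w ∈ F.iter n z) : (F.invMap (F.limitSet x))^[n] w = z := by
  induction n generalizing w with
  | zero => exact hw
  | succ n ih =>
    obtain ⟨y, hy, hwy⟩ := mem_iter_succ.1 hw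
    have hyL := h.inverseLike.mem_of_mem_iter hz hy
    have hwL := h.inverseLike.mem_of_mem_val hyL hwy
    have h1 := h.invMap_spec hwL
    rw [Function.iterate_succ_apply, h.inverseLike.eq_of_mem_val h1.1 hyL h1.2 hwy, ih hy]

/-- A map to a compact space with closed graph: every limit of preimages in Λ is again a preimage in
Λ, and preimages in Λ are unique. -/
theorem IsMinimalLimitSet.continuousWithinAt_invMap (h : F.IsMinimalLimitSet x) {w : Sphere}
    (hw : w ∈ F.limitSet x) :
    ContinuousWithinAt (F.invMap (F.limitSet x)) (F.limitSet x) w := by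
  rw [ContinuousWithinAt, tendsto_iff_ultrafilter]
  intro 𝒰 h𝒰
  set v := (𝒰.map (F.invMap (F.limitSet x))).lim with hv
  have hlim : Tendsto (F.invMap (F.limitSet x)) 𝒰 (𝓝 v) :=
    (𝒰.map (F.invMap (F.limitSet x))).le_nhds_lim
  have hid : Tendsto id (𝒰 : Filter Sphere) (𝓝 w) := h𝒰.trans nhdsWithin_le_nhds
  have hL : ∀ᶠ y in (𝒰 : Filter Sphere), y ∈ F.limitSet x := h𝒰 self_mem_nhdsWithin
  have hvL : v ∈ F.limitSet x :=
    isClosed_limitSet.mem_of_tendsto hlim (hL.mono fun y hy => (h.invMap_spec hy).1)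
  have hvw : (v, w) ∈ F.graph :=
    F.isClosed_graph.mem_of_tendsto (hlim.prodMk_nhds hid)
      (hL.mono fun y hy => (h.invMap_spec hy).2)
  have h1 := h.invMap_spec hw
  rw [h.inverseLike.eq_of_mem_val h1.1 hvL h1.2 hvw]
  exact hlim

theorem IsMinimalLimitSet.continuousOn_iterate_invMap (h : F.IsMinimalLimitSet x) (n : ℕ) :
    ContinuousOn (F.invMap (F.limitSet x))^[n] (F.limitSet x) := by
  have h1 : ContinuousOn (F.invMap (F.limitSet x)) (F.limitSet x) := fun w hw =>
    h.continuousWithinAt_invMap hw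
  exact h1.iterate (fun w hw => (h.invMap_spec hw).1) n

/-- Points of Λ are neither critical values nor other singular points, so the first projection is
injective near every point of Γ over Λ. -/
theorem hasContinuousBranches_of_mem (hrel : F.IsRelativelyHyperbolic x)
    (hmin : F.IsMinimalLimitSet x) {u : Sphere} (hu : u ∈ F.limitSet x) :
    F.HasContinuousBranches u := by
  have hcv : u ∉ F.critValInv := fun h => (hrel.nonbranched.subset ⟨hu, h⟩ : u ∈ (∅ : Set Sphere))
  have hs : u ∉ F.sing := fun h => (hmin.nonsingular.subset ⟨hu, h, hcv⟩ : u ∈ (∅ : Set Sphere))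
  intro w hw
  obtain ⟨W, hW, hinj⟩ : ∃ W ∈ 𝓝 (u, w), InjOn Prod.fst (F.graph ∩ W) := by
    by_contra! hno
    exact hs ⟨(u, w), ⟨hw, hno⟩, rfl⟩
  exact F.exists_graph_of_injOn_fst hw hW hinj

theorem HasContinuousBranches.finite_val {u : Sphere} (h : F.HasContinuousBranches u) :
    (F.val u).Finite := by
  have hc : IsCompact (F.val u) :=
    (F.isClosed_graph.preimage (Continuous.prodMk_right u)).isCompact
  refine hc.finite ?_
  rw [isDiscrete_iff_forall_mem_exists_isOpen]
  intro w hw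
  obtain ⟨g, hg, -, hgr⟩ := h w hw
  have h1 : ∀ᶠ y in 𝓝 w, (u, y) ∈ F.graph ↔ y = g u :=
    ((Continuous.prodMk_right u).tendsto w).eventually hgr
  obtain ⟨V, hV, hVo, hwV⟩ := mem_nhds_iff.1 h1
  refine ⟨V, hVo, ?_⟩
  ext y
  constructor
  · rintro ⟨hy1, hy2⟩
    exact ((hV hy1).1 hy2).trans hg
  · rintro rfl
    exact ⟨hwV, hw⟩

/-- The closure of the orbit is forward invariant because each value of F at a limit point is
carried to nearby orbit points by a continuous branch; minimality then makes it all of Λ. -/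
theorem limitSet_subset_closure_orbit (hrel : F.IsRelativelyHyperbolic x)
    (hmin : F.IsMinimalLimitSet x) {ω : Sphere} (hω : ω ∈ F.limitSet x) :
    F.limitSet x ⊆ closure (⋃ n, F.iter n ω) := by
  have hsub : closure (⋃ n, F.iter n ω) ⊆ F.limitSet x :=
    isClosed_limitSet.closure_subset_iff.2 (iUnion_subset fun n w hw =>
      hmin.inverseLike.mem_of_mem_iter hω hw)
  refine (hmin.closed_invariant _ hsub isClosed_closure ?_ ?_).ge
  · exact ⟨ω, subset_closure (mem_iUnion.2 ⟨0, rfl⟩)⟩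
  · intro w hw
    obtain ⟨v, hv, hwv⟩ := mem_iUnion₂.1 hw
    rw [iter_one] at hwv
    obtain ⟨g, hg, hgc, hgr⟩ := hasContinuousBranches_of_mem hrel hmin (hsub hv) w hwv
    have hT : Tendsto (fun v' => (v', g v')) (𝓝 v) (𝓝 (v, w)) := by
      have := hgc.tendsto
      rw [hg] at this
      exact tendsto_id.prodMk_nhds this
    rw [mem_closure_iff_frequently] at hv ⊢
    rw [← hg]
    refine hgc.tendsto.frequently (hv.and_eventually (hT.eventually hgr) |>.mono ?_)
    rintro v' ⟨h1, h2⟩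
    obtain ⟨n, hn⟩ := mem_iUnion.1 h1
    exact mem_iUnion.2 ⟨n + 1, mem_iter_succ.2 ⟨v', hn, h2.2 rfl⟩⟩

end Correspondence

namespace Correspondence

variable {F : Correspondence} {x : Sphere}

/-! ## Discs around the nonparabolic points of the limit set -/

/-- A disc over which the orbits are univalent, omit two points, and meet the limit set only if
they start in it. -/
structure IsUnivalentDisc (F : Correspondence) (x a p q : Sphere) (D : Set ℂ) : Prop where
  unbranched : F.IsUnbranchedDisc a D
  ne : p ≠ q
  omits : ∀ n, ∀ t ∈ D, ∀ w ∈ F.iter n (Sphere.chartInv a t), w ≠ p ∧ w ≠ q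
  limitSet_subset : ∀ t ∈ D, F.limitSet (Sphere.chartInv a t) ⊆ F.limitSet x
  iterate_invMap_eq : ∀ n, ∀ t ∈ D, ∀ w ∈ F.iter n (Sphere.chartInv a t), w ∈ F.limitSet x →
    (F.invMap (F.limitSet x))^[n] w = Sphere.chartInv a t

/-- A nonparabolic point of Λ is off the closed postcritical set, so the neighbourhood from the
extension property can be cut down to avoid it. The extended inverse gives injectivity and agreement
with g on Λ, and the values never reached by the neighbourhood provide p and q. -/
theorem exists_isUnivalentDisc (hrel : F.IsRelativelyHyperbolic x) (hmin : F.IsMinimalLimitSet x)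
    {y : Sphere} (hy : y ∈ F.limitSet x \ F.parabolicSet x) :
    ∃ p q, ∃ r > 0, F.IsUnivalentDisc x (Sphere.pole y) p q
      (Metric.ball (Sphere.coord y y) r) := by
  obtain ⟨U, hU, hG, hlim, h3⟩ := hmin.extension y hy
  have hpc : y ∉ F.postcritInv := fun h => hy.2 (hrel.postcrit ⟨hy.1, h⟩)
  have hN : U ∩ F.postcritInvᶜ ∈ 𝓝 y := inter_mem hU (isClosed_closure.isOpen_compl.mem_nhds hpc)
  have hN' : Sphere.chartInv (Sphere.pole y) ⁻¹' (U ∩ F.postcritInvᶜ) ∈ 𝓝 (Sphere.coord y y) := by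
    refine (Sphere.continuous_chartInv _).continuousAt ?_
    rw [← Sphere.param_eq, Sphere.param_coord_self]
    exact hN
  obtain ⟨r, hr, hball⟩ := Metric.mem_nhds_iff.1 hN'
  obtain ⟨p, q, hp, hq, hpq⟩ : ∃ p q, p ∈ (⋃ n : ℕ, F.image n U)ᶜ ∧
      q ∈ (⋃ n : ℕ, F.image n U)ᶜ ∧ p ≠ q := by
    have h1 : 1 < (⋃ n : ℕ, F.image n U)ᶜ.encard := lt_of_lt_of_le (by norm_num) h3
    obtain ⟨p, q, hp, hq, hpq⟩ := Set.one_lt_encard_iff.1 h1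
    exact ⟨p, q, hp, hq, hpq⟩
  have hmem : ∀ n, ∀ t ∈ Metric.ball (Sphere.coord y y) r,
      ∀ w ∈ F.iter n (Sphere.chartInv (Sphere.pole y) t), w ∈ ⋃ n : ℕ, F.image n U :=
    fun n t ht w hw => mem_iUnion.2 ⟨n, mem_iUnion₂.2 ⟨_, (hball ht).1, hw⟩⟩
  refine ⟨p, q, r, hr, ⟨Metric.isOpen_ball, ?_, ?_⟩, hpq, ?_, ?_, ?_⟩
  · intro n s hs t ht w hw hw'
    obtain ⟨G, -, hG⟩ := hG n
    have h1 : G w ∈ G '' _ := mem_image_of_mem G hw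
    have h2 : G w ∈ G '' _ := mem_image_of_mem G hw'
    rw [hG _ (hball hs).1, mem_singleton_iff] at h1
    rw [hG _ (hball ht).1, mem_singleton_iff] at h2
    exact Sphere.chartInv_injective _ (h1.symm.trans h2)
  · intro n s hs u hu hcv
    exact (hball hs).2 (subset_closure (mem_iUnion.2 ⟨n, u, hu, hcv⟩))
  · intro n t ht w hw
    refine ⟨?_, ?_⟩
    · rintro rfl
      exact hp (hmem n t ht w hw)
    · rintro rfl
      exact hq (hmem n t ht w hw)
  · exact fun t ht => hlim _ (hball ht).1
  · intro n t ht w hw hwL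
    obtain ⟨G, hGeq, hG⟩ := hG n
    have h1 : G w ∈ G '' _ := mem_image_of_mem G hw
    rw [hG _ (hball ht).1, mem_singleton_iff] at h1
    have h2 := hmin.iterate_invMap_spec n hwL
    rw [← h1, hGeq (mem_iUnion₂.2 ⟨_, h2.1, h2.2⟩)]

theorem IsUnivalentDisc.isUnivalentCurve {a p q : Sphere} {D : Set ℂ}
    (hD : F.IsUnivalentDisc x a p q D) {n : ℕ} {k : ℕ → ℂ → Sphere} (hk : F.IsTower a D n k)
    {i : ℕ} (hi : i ≤ n) : IsUnivalentCurve p q D (k i) := by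
  obtain ⟨b, hb⟩ := hk.holo_and_open hD.unbranched hi
  exact ⟨hk.injOn hD.unbranched hi, ⟨b, fun t ht => (hb t ht).1⟩,
    fun t ht => hD.omits i t ht _ (hk.mem_iter hi ht)⟩

/-- The branch along a given backward orbit in the limit set. -/
theorem IsUnivalentDisc.exists_tower (hmin : F.IsMinimalLimitSet x) {a p q : Sphere} {c : ℂ}
    {r : ℝ} (hD : F.IsUnivalentDisc x a p q (Metric.ball c r)) {t : ℂ} (ht : t ∈ Metric.ball c r)
    {n : ℕ} {w : Sphere} (hw : w ∈ F.limitSet x)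
    (hwt : (F.invMap (F.limitSet x))^[n] w = Sphere.chartInv a t) :
    ∃ k : ℕ → ℂ → Sphere, F.IsTower a (Metric.ball c r) n k ∧
      ∀ i ≤ n, k i t = (F.invMap (F.limitSet x))^[n - i] w := by
  refine hD.unbranched.exists_tower (v := fun i => (F.invMap (F.limitSet x))^[n - i] w) ht hwt n
    fun i hi => ?_
  have h1 := (hmin.invMap_spec (hmin.iterate_invMap_spec (n - (i + 1)) hw).1).2
  show (F.invMap (F.limitSet x))^[n - (i + 1)] w ∈ F.val ((F.invMap (F.limitSet x))^[n - i] w)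
  rw [show n - i = n - (i + 1) + 1 by omega, Function.iterate_succ_apply']
  exact h1

/-! ## Local uniqueness of the branches at the limit set -/

/-- Consider two orbits from a common point near v with distinct ends near w. Their penultimate
points have limits in Λ with the common image w, hence a common limit; they agree by induction, and
so do their images under the single local branch there. -/
theorem eventually_eq_of_mem_iter (hrel : F.IsRelativelyHyperbolic x)
    (hmin : F.IsMinimalLimitSet x) (n : ℕ) {v w : Sphere} (hv : v ∈ F.limitSet x)
    (hw : w ∈ F.iter n v) : ∀ᶠ e : Sphere × Sphere × Sphere in 𝓝 (v, w, w),
      e.2.1 ∈ F.iter n e.1 → e.2.2 ∈ F.iter n e.1 → e.2.1 = e.2.2 := by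
  induction n generalizing w with
  | zero =>
    refine .of_forall fun e h1 h2 => ?_
    exact (show e.2.1 = e.1 from h1).trans (show e.2.2 = e.1 from h2).symm
  | succ n ih =>
    by_contra hcon
    rw [not_eventually, frequently_iff_neBot] at hcon
    set bad : Set (Sphere × Sphere × Sphere) :=
      {e | ¬(e.2.1 ∈ F.iter (n + 1) e.1 → e.2.2 ∈ F.iter (n + 1) e.1 → e.2.1 = e.2.2)} with hbad
    set 𝒰 := Ultrafilter.of (𝓝 (v, w, w) ⊓ 𝓟 bad) with h𝒰
    have hle := Ultrafilter.of_le (𝓝 (v, w, w) ⊓ 𝓟 bad)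
    have hnhds : Tendsto id (𝒰 : Filter (Sphere × Sphere × Sphere)) (𝓝 (v, w, w)) :=
      hle.trans inf_le_left
    have hb : ∀ᶠ e in (𝒰 : Filter (Sphere × Sphere × Sphere)), ∃ y, (y ∈ F.iter n e.1 ∧
        (y, e.2.1) ∈ F.graph) ∧ ∃ y', (y' ∈ F.iter n e.1 ∧ (y', e.2.2) ∈ F.graph) ∧
        e.2.1 ≠ e.2.2 := by
      filter_upwards [(hle.trans inf_le_right) (mem_principal_self bad)] with e he
      rw [hbad, mem_ofPred_eq] at he
      push Not at he
      obtain ⟨y, hy⟩ := mem_iter_succ.1 he.1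
      obtain ⟨y', hy'⟩ := mem_iter_succ.1 he.2.1
      exact ⟨y, hy, y', hy', he.2.2⟩
    obtain ⟨y, hy⟩ := hb.choice
    obtain ⟨y', hy'⟩ := (hy.mono fun e he => he.2).choice
    have h1 : Tendsto (fun e : Sphere × Sphere × Sphere => e.1) 𝒰 (𝓝 v) :=
      (continuous_fst.tendsto _).comp hnhds
    have h2 : Tendsto (fun e : Sphere × Sphere × Sphere => e.2.1) 𝒰 (𝓝 w) :=
      ((continuous_fst.comp continuous_snd).tendsto _).comp hnhds
    have h3 : Tendsto (fun e : Sphere × Sphere × Sphere => e.2.2) 𝒰 (𝓝 w) :=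
      ((continuous_snd.comp continuous_snd).tendsto _).comp hnhds
    have hlim : Tendsto y 𝒰 (𝓝 (𝒰.map y).lim) := (𝒰.map y).le_nhds_lim
    have hlim' : Tendsto y' 𝒰 (𝓝 (𝒰.map y').lim) := (𝒰.map y').le_nhds_lim
    set Y := (𝒰.map y).lim
    set Y' := (𝒰.map y').lim
    have hY : Y ∈ F.iter n v := (F.isClosed_iterGraph n).mem_of_tendsto (h1.prodMk_nhds hlim)
      (hy.mono fun e he => he.1.1)
    have hY' : Y' ∈ F.iter n v := (F.isClosed_iterGraph n).mem_of_tendsto (h1.prodMk_nhds hlim')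
      (hy'.mono fun e he => he.1.1)
    have hYw : (Y, w) ∈ F.graph := F.isClosed_graph.mem_of_tendsto (hlim.prodMk_nhds h2)
      (hy.mono fun e he => he.1.2)
    have hYw' : (Y', w) ∈ F.graph := F.isClosed_graph.mem_of_tendsto (hlim'.prodMk_nhds h3)
      (hy'.mono fun e he => he.1.2)
    have hYL := hmin.inverseLike.mem_of_mem_iter hv hY
    have hYY : Y' = Y := hmin.inverseLike.eq_of_mem_val
      (hmin.inverseLike.mem_of_mem_iter hv hY') hYL hYw' hYw
    rw [hYY] at hlim'
    have heq := (h1.prodMk_nhds (hlim.prodMk_nhds hlim')).eventually (ih hY)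
    obtain ⟨h, hh, -, hgr⟩ := hasContinuousBranches_of_mem hrel hmin hYL w hYw
    obtain ⟨e, he1, he2, he3, he4, he5⟩ := (heq.and (hy.and (hy'.and
      (((hlim.prodMk_nhds h2).eventually hgr).and ((hlim'.prodMk_nhds h3).eventually hgr))))).exists
    have hyy := he1 he2.1.1 he3.1.1
    refine he3.2 ?_
    have e4 := he4.1 he2.1.2
    have e5 := he5.1 he3.1.2
    simp only at e4 e5 hyy
    rw [e4, e5, hyy]

/-! ## Local inverses at the parabolic points -/

/-- `g^N` fixes `ω`, and has a local inverse on the limit set near `ω`, whose iterates converge to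
`ω`. -/
structure HasAttractingInverse (F : Correspondence) (x ω : Sphere) (N : ℕ) (T : Sphere → Sphere)
    (V : Set Sphere) : Prop where
  pos : 0 < N
  mem_nhds : V ∈ 𝓝 ω
  fixed : (F.invMap (F.limitSet x))^[N] ω = ω
  apply_iterate : ∀ p ∈ F.limitSet x ∩ V, T ((F.invMap (F.limitSet x))^[N] p) = p
  tendsto : ∀ p ∈ F.limitSet x ∩ V, Tendsto (fun n => T^[n] p) atTop (𝓝 ω)

/-- For p in Λ near ω, both p and T(g^q p) belong to F^q(g^q p) and are close to ω, so local
uniqueness of the branches identifies them. -/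
theorem exists_hasAttractingInverse (hrel : F.IsRelativelyHyperbolic x)
    (hmin : F.IsMinimalLimitSet x) {ω : Sphere} (hω : ω ∈ F.parabolicSet x) :
    ∃ N T V, F.HasAttractingInverse x ω N T V := by
  obtain ⟨q, hq, W, f, hωW, hf, hfω, -⟩ := hω.2
  obtain ⟨W', T, U, hωW', ⟨M, fs, hfs, hiter, j, hj⟩, hTf, -, hU, hconv⟩ :=
    hrel.attracting ω hω q hq W f hωW hf hfω
  have hTω : T ω = ω := hTf.self_of_nhds.trans hfω
  have hTmem : ∀ z ∈ W', T z ∈ F.iter q z := fun z hz => by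
    rw [hiter z hz, hj hz]
    exact mem_range_self j
  have hWn : W' ∈ 𝓝 ω := (hfs j).1.mem_nhds hωW'
  have hTc : ContinuousAt T ω :=
    ((hfs j).2 ω hωW').1.congr (hj.symm.eventuallyEq_of_mem hWn)
  have hωω : ω ∈ F.iter q ω := by
    have := hTmem ω hωW'
    rwa [hTω] at this
  have hfix := hmin.iterate_invMap_eq hω.1 hωω
  have hGc : Tendsto (F.invMap (F.limitSet x))^[q] (𝓝[F.limitSet x] ω) (𝓝 ω) := by
    have := hmin.continuousOn_iterate_invMap q ω hω.1
    rwa [ContinuousWithinAt, hfix] at this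
  have hTG : Tendsto (fun p => T ((F.invMap (F.limitSet x))^[q] p)) (𝓝[F.limitSet x] ω) (𝓝 ω) := by
    have h1 := hTc.tendsto
    rw [hTω] at h1
    exact h1.comp hGc
  have hid : Tendsto id (𝓝[F.limitSet x] ω) (𝓝 ω) := nhdsWithin_le_nhds
  have hev : ∀ᶠ p in 𝓝[F.limitSet x] ω, T ((F.invMap (F.limitSet x))^[q] p) = p := by
    filter_upwards [(hGc.prodMk_nhds (hTG.prodMk_nhds hid)).eventually
      (eventually_eq_of_mem_iter hrel hmin q hω.1 hωω), hGc.eventually hWn,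
      self_mem_nhdsWithin] with p hp hpW hpL
    exact hp (hTmem _ hpW) (hmin.iterate_invMap_spec q hpL).2
  rw [eventually_nhdsWithin_iff] at hev
  obtain ⟨V, hV, hVU⟩ := eventually_smallSets.1 hU
  refine ⟨q, T, _, hq, inter_mem hev hV, hfix, fun p hp => hp.2.1 hp.1, fun p hp => ?_⟩
  have : p ∈ F.limitSet x ∩ V ∩ U := hVU V subset_rfl ▸ ⟨hp.1, hp.2.2⟩
  exact (hconv p this.2).2

/-- Allows one common period for all the finitely many parabolic points. -/
theorem HasAttractingInverse.mul (hmin : F.IsMinimalLimitSet x) {ω : Sphere}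
    (hω : ω ∈ F.limitSet x) {N : ℕ} {T : Sphere → Sphere} {V : Set Sphere}
    (h : F.HasAttractingInverse x ω N T V) {m : ℕ} (hm : 0 < m) :
    ∃ V', F.HasAttractingInverse x ω (N * m) T^[m] V' := by
  have hfix : ∀ i, (F.invMap (F.limitSet x))^[N * i] ω = ω := fun i => by
    rw [Function.iterate_mul]
    exact Function.iterate_fixed h.fixed i
  have hev : ∀ᶠ p in 𝓝[F.limitSet x] ω, ∀ i ∈ Finset.range m,
      (F.invMap (F.limitSet x))^[N * i] p ∈ V := by
    rw [Filter.eventually_all_finset]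
    intro i _
    have := hmin.continuousOn_iterate_invMap (N * i) ω hω
    rw [ContinuousWithinAt, hfix] at this
    exact this.eventually h.mem_nhds
  rw [eventually_nhdsWithin_iff] at hev
  refine ⟨_, Nat.mul_pos h.pos hm, inter_mem hev h.mem_nhds, hfix m, fun p hp => ?_, fun p hp => ?_⟩
  · have key : ∀ i ≤ m, T^[i] ((F.invMap (F.limitSet x))^[N * i] p) = p := by
      intro i hi
      induction i with
      | zero => rfl
      | succ i ih =>
        rw [Function.iterate_succ_apply, Nat.mul_succ, add_comm, Function.iterate_add_apply,
          h.apply_iterate _ ⟨(hmin.iterate_invMap_spec _ hp.1).1,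
            hp.2.1 hp.1 i (Finset.mem_range.2 hi)⟩]
        exact ih (by omega)
    exact key m le_rfl
  · have := (h.tendsto p ⟨hp.1, hp.2.2⟩).comp (tendsto_id.const_mul_atTop' hm)
    refine this.congr fun n => ?_
    simp [Function.iterate_mul]

end Correspondence

/-! ### Backward orbits converging to a parabolic point -/

namespace Correspondence

variable {F : Correspondence} {x : Sphere}

theorem IsTower.mem_iter_add {a : Sphere} {D : Set ℂ} {n : ℕ} {k : ℕ → ℂ → Sphere}
    (h : F.IsTower a D n k) {i l : ℕ} (hi : i + l ≤ n) {t : ℂ} (ht : t ∈ D) :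
    k (i + l) t ∈ F.iter l (k i t) := by
  induction l with
  | zero => rfl
  | succ l ih => exact mem_iter_succ.2 ⟨_, ih (by omega), h.succ (i + l) (by omega) t ht⟩

/-- The orbit of a point of the forward orbit of `ω` under the inverse map leaves each small
neighbourhood of `ω`. -/
theorem HasAttractingInverse.exists_exit (hmin : F.IsMinimalLimitSet x) {ω : Sphere}
    (hω : ω ∈ F.limitSet x) {N : ℕ} {T : Sphere → Sphere} {V V₀ : Set Sphere}
    (h : F.HasAttractingInverse x ω N T V) (hV : V₀ ⊆ V)
    (hV' : ∀ i < N, (F.invMap (F.limitSet x))^[i] ω ∈ V₀ → (F.invMap (F.limitSet x))^[i] ω = ω)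
    {y : Sphere} (hyω : y ≠ ω) (hy : y ∈ ⋃ n, F.iter n ω) (hyV : y ∈ V₀) :
    ∃ m, ((F.invMap (F.limitSet x))^[N])^[m + 1] y ∉ V₀ ∧
      ∀ j ≤ m, ((F.invMap (F.limitSet x))^[N])^[j] y ∈ V₀ := by
  classical
  set g := F.invMap (F.limitSet x) with hg
  obtain ⟨n, hn⟩ := mem_iUnion.1 hy
  have hyL : y ∈ F.limitSet x := hmin.inverseLike.mem_of_mem_iter hω hn
  have hgn : g^[n] y = ω := hmin.iterate_invMap_eq hω hn
  have hex : ∃ m, (g^[N])^[m] y ∉ V₀ := by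
    by_contra! hall
    have hT : ∀ i, T^[i] ((g^[N])^[i] y) = y := by
      intro i
      induction i with
      | zero => rfl
      | succ i ih =>
        rw [Function.iterate_succ_apply, Function.iterate_succ_apply', h.apply_iterate, ih]
        refine ⟨?_, hV (hall i)⟩
        rw [← Function.iterate_mul]
        exact (hmin.iterate_invMap_spec _ hyL).1
    have hTω : T ω = ω := by
      have := h.apply_iterate ω ⟨hω, mem_of_mem_nhds h.mem_nhds⟩
      rwa [h.fixed] at this
    -- As gⁿ(y) = ω, the point g^{Nn}(y) lies on the cycle of ω. Staying in V₀ forces it to be ω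
    -- itself, and applying Tⁿ gives y = ω.
    have hle : n ≤ N * n := Nat.le_mul_of_pos_left n h.pos
    have hGn : (g^[N])^[n] y = g^[(N * n - n) % N] ω := by
      rw [Function.IsPeriodicPt.iterate_mod_apply (show Function.IsPeriodicPt g N ω from h.fixed),
        ← hgn, ← Function.iterate_add_apply, Nat.sub_add_cancel hle, Function.iterate_mul]
    have h1 := hall n
    rw [hGn] at h1
    have h2 := hV' _ (Nat.mod_lt _ h.pos) h1
    have h3 := hT n
    rw [hGn, h2, Function.iterate_fixed hTω] at h3
    exact hyω h3.symm
  have hpos : Nat.find hex ≠ 0 := fun h0 => by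
    have := Nat.find_spec hex
    rw [h0] at this
    exact this hyV
  obtain ⟨m, hm⟩ := Nat.exists_eq_succ_of_ne_zero hpos
  have hspec := Nat.find_spec hex
  rw [hm] at hspec
  refine ⟨m, hspec, fun j hj => ?_⟩
  exact not_not.1 (Nat.find_min hex (show j < Nat.find hex by omega))

/-- The tower at t stays near ω at multiples of N, so by equicontinuity it also does at the centre
c. There g^N inverts each block of N steps, and near ω the inverse of g^N on Λ is T. -/
theorem IsUnivalentDisc.iterate_eq_of_tower (hmin : F.IsMinimalLimitSet x) {ω : Sphere}
    {N : ℕ} {T : Sphere → Sphere} {V V₀ O : Set Sphere}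
    (h : F.HasAttractingInverse x ω N T V) (hO : O ⊆ V) {a p q : Sphere} {D : Set ℂ} {c t : ℂ}
    (hD : F.IsUnivalentDisc x a p q D) (hc : c ∈ D) (hcL : Sphere.chartInv a c ∈ F.limitSet x)
    {m : ℕ} {k : ℕ → ℂ → Sphere} (hk : F.IsTower a D (N * m) k)
    (hmaps : ∀ k : ℂ → Sphere, IsUnivalentCurve p q D k → k t ∈ V₀ → k c ∈ O)
    (hkV : ∀ j < m, k (N * (j + 1)) t ∈ V₀) :
    k (N * m) c = T^[m] (Sphere.chartInv a c) := by
  have key : ∀ j ≤ m, k (N * j) c = T^[j] (Sphere.chartInv a c) := by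
    intro j hj
    induction j with
    | zero => exact hk.zero c hc
    | succ j ih =>
      have hle : N * j + N ≤ N * m := by
        rw [← Nat.mul_succ]
        exact Nat.mul_le_mul_left N hj
      have hV : k (N * (j + 1)) c ∈ V :=
        hO (hmaps _ (hD.isUnivalentCurve hk (i := N * (j + 1)) hle) (hkV j (by omega)))
      have hL : ∀ i ≤ N * m, k i c ∈ F.limitSet x := fun i hi =>
        hmin.inverseLike.mem_of_mem_iter hcL (hk.mem_iter hi hc)
      have h1 := hmin.iterate_invMap_eq (hL (N * j) (by omega)) (hk.mem_iter_add hle hc)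
      rw [Function.iterate_succ_apply', ← ih (by omega), ← h1]
      exact (h.apply_iterate _ ⟨hL _ hle, hV⟩).symm
  exact key m le_rfl

/-- A backward orbit in the limit set converges to a parabolic point only if it ends there. -/
theorem HasAttractingInverse.exists_iterate_eq (hrel : F.IsRelativelyHyperbolic x)
    (hmin : F.IsMinimalLimitSet x) {ω : Sphere} (hω : ω ∈ F.limitSet x) {N : ℕ}
    {T : Sphere → Sphere} {V : Set Sphere} (h : F.HasAttractingInverse x ω N T V) {z : Sphere}
    (hz : z ∈ F.limitSet x)
    (hconv : Tendsto (fun k => (F.invMap (F.limitSet x))^[N * k] z) atTop (𝓝 ω)) :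
    ∃ k, (F.invMap (F.limitSet x))^[N * k] z = ω := by
  by_contra! hne
  set g := F.invMap (F.limitSet x) with hg
  have hgL : ∀ (i : ℕ) {y}, y ∈ F.limitSet x → (g^[N])^[i] y ∈ F.limitSet x := fun i y hy => by
    rw [← Function.iterate_mul]
    exact (hmin.iterate_invMap_spec _ hy).1
  -- The points to be kept away from: the other parabolic points, so that exit points accumulate at
  -- a nonparabolic point, and the rest of the cycle of ω, as required by `exists_exit`.
  set B : Set Sphere := (F.parabolicSet x ∪ (fun i => g^[i] ω) '' Iio N) \ {ω} with hB
  have hBfin : B.Finite := (hmin.finite_parabolic.union ((finite_Iio N).image _)).subset sdiff_subset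
  have hBn : Bᶜ ∈ 𝓝 ω := hBfin.isClosed.isOpen_compl.mem_nhds fun hmem => hmem.2 rfl
  obtain ⟨V₁, hV₁, hV₁c, hV₁s⟩ := exists_mem_nhds_isClosed_subset (inter_mem h.mem_nhds hBn)
  -- Ensures that the first point outside V₀ is still in V₁.
  have hGc : ∀ᶠ y in 𝓝 ω, y ∈ F.limitSet x → g^[N] y ∈ V₁ := by
    have := hmin.continuousOn_iterate_invMap N ω hω
    rw [ContinuousWithinAt, ← hg, h.fixed] at this
    exact eventually_nhdsWithin_iff.1 (this.eventually hV₁)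
  obtain ⟨V₀, hV₀, hV₀c, hV₀s⟩ := exists_mem_nhds_isClosed_subset
    (inter_mem (interior_mem_nhds.2 hV₁) hGc)
  have hV₀V : V₀ ⊆ V := fun y hy => (hV₁s (interior_subset (hV₀s hy).1)).1
  obtain ⟨k₀, hk₀⟩ := (hconv.eventually (interior_mem_nhds.2 hV₀)).exists_forall_of_atTop
  set p := g^[N * k₀] z with hp
  have hpL : p ∈ F.limitSet x := (hmin.iterate_invMap_spec _ hz).1
  have hpω : p ≠ ω := hne k₀
  have hpV : ∀ k, (g^[N])^[k] p ∈ interior V₀ := fun k => by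
    rw [hp, ← Function.iterate_mul, ← Function.iterate_add_apply, ← Nat.mul_add]
    exact hk₀ (k + k₀) (by omega)
  -- p is approximated by points y of the forward orbit of ω. Unlike p, they do leave V₀ under
  -- backward iteration.
  have hcl := limitSet_subset_closure_orbit hrel hmin hω hpL
  rw [mem_closure_iff_nhdsWithin_neBot] at hcl
  set 𝒰 := Ultrafilter.of (𝓝[⋃ n, F.iter n ω] p)
  have hle : (𝒰 : Filter Sphere) ≤ 𝓝[⋃ n, F.iter n ω] p := Ultrafilter.of_le _
  have hOL : (⋃ n, F.iter n ω) ⊆ F.limitSet x := iUnion_subset fun n w hw =>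
    hmin.inverseLike.mem_of_mem_iter hω hw
  have hleL : (𝒰 : Filter Sphere) ≤ 𝓝[F.limitSet x] p := hle.trans (nhdsWithin_mono p hOL)
  have hid : Tendsto id (𝒰 : Filter Sphere) (𝓝 p) := hle.trans nhdsWithin_le_nhds
  have hL : ∀ᶠ y in (𝒰 : Filter Sphere), y ∈ F.limitSet x := hleL self_mem_nhdsWithin
  have hstay : ∀ k, ∀ᶠ y in (𝒰 : Filter Sphere), (g^[N])^[k] y ∈ V₀ := fun k => by
    have := hmin.continuousOn_iterate_invMap (N * k) p hpL
    rw [ContinuousWithinAt, Function.iterate_mul] at this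
    exact hleL (this.eventually (mem_interior_iff_mem_nhds.1 (hpV k)))
  have hexit : ∀ᶠ y in (𝒰 : Filter Sphere), ∃ m, (g^[N])^[m + 1] y ∉ V₀ ∧
      ∀ j ≤ m, (g^[N])^[j] y ∈ V₀ := by
    filter_upwards [hid.eventually (isOpen_ne.mem_nhds hpω), hle self_mem_nhdsWithin, hstay 0]
      with y hy1 hy2 hy3
    refine h.exists_exit hmin hω hV₀V (fun i hi hi' => ?_) hy1 hy2 hy3
    by_contra hiω
    exact (hV₁s (interior_subset (hV₀s hi').1)).2 ⟨Or.inr ⟨i, hi, rfl⟩, hiω⟩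
  obtain ⟨m, hm⟩ := hexit.choice
  -- The backward orbit of p never leaves the interior of V₀, so by continuity the exit times tend
  -- to infinity.
  have hmT : Tendsto (fun y => m y + 1) (𝒰 : Filter Sphere) atTop := by
    refine tendsto_atTop.2 fun b => ?_
    have := (Filter.eventually_all_finset (Finset.range (b + 1))
      (p := fun k y => (g^[N])^[k] y ∈ V₀) (l := (𝒰 : Filter Sphere))).2 fun k _ => hstay k
    filter_upwards [this, hm] with y hy1 hy2
    by_contra! hlt
    exact hy2.1 (hy1 (m y + 1) (Finset.mem_range.2 (by omega)))
  set y' : Sphere → Sphere := fun y => (g^[N])^[m y + 1] y with hy'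
  set ys := (𝒰.map y').lim
  have hlim : Tendsto y' 𝒰 (𝓝 ys) := (𝒰.map y').le_nhds_lim
  have hys₁ : ys ∈ V₁ := by
    refine hV₁c.mem_of_tendsto hlim ?_
    filter_upwards [hm, hL] with y hy hyL
    simp only [hy', Function.iterate_succ_apply']
    exact (hV₀s (hy.2 _ le_rfl)).2 (hgL _ hyL)
  have hys₀ : ys ∈ (interior V₀)ᶜ := by
    refine isOpen_interior.isClosed_compl.mem_of_tendsto hlim ?_
    filter_upwards [hm] with y hy hy2
    exact hy.1 (interior_subset hy2)
  have hysL : ys ∈ F.limitSet x := isClosed_limitSet.mem_of_tendsto hlim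
    (hL.mono fun y hy => hgL _ hy)
  have hysω : ys ≠ ω := by
    rintro heq
    rw [heq] at hys₀
    exact hys₀ (mem_interior_iff_mem_nhds.2 hV₀)
  have hysΩ : ys ∉ F.parabolicSet x := fun hmem => (hV₁s hys₁).2 ⟨Or.inl hmem, hysω⟩
  obtain ⟨p', q', r, hr, hD⟩ := exists_isUnivalentDisc hrel hmin ⟨hysL, hysΩ⟩
  set a := Sphere.pole ys with ha
  set c := Sphere.coord ys ys with hc
  have hac : Sphere.chartInv a c = ys := by rw [ha, hc, ← Sphere.param_eq, Sphere.param_coord_self]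
  have ht : Tendsto (fun y => Sphere.chart a (y' y)) 𝒰 (𝓝 c) := by
    rw [hc, Sphere.coord_eq]
    exact (Sphere.continuousAt_chart (Sphere.pole_ne ys)).tendsto.comp hlim
  have hta : ∀ᶠ y in (𝒰 : Filter Sphere),
      Sphere.chartInv a (Sphere.chart a (y' y)) = y' y := by
    filter_upwards [hlim.eventually (isOpen_ne.mem_nhds (Sphere.pole_ne ys))] with y hy
    exact Sphere.chartInv_chart hy
  have hcD : c ∈ Metric.ball c r := Metric.mem_ball_self hr
  have hmaps := ht.eventually (eventually_forall_univalentCurve_mem hD.ne hD.unbranched.isOpen hcD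
    hV₀c isOpen_interior (hV₀s.trans inter_subset_left))
  have htow : ∀ᶠ y in (𝒰 : Filter Sphere), ∃ k : ℕ → ℂ → Sphere,
      F.IsTower a (Metric.ball c r) (N * (m y + 1)) k ∧
      ∀ i ≤ N * (m y + 1), k i (Sphere.chart a (y' y)) = g^[N * (m y + 1) - i] y := by
    filter_upwards [hL, hta, ht.eventually (hD.unbranched.isOpen.mem_nhds hcD)] with y hyL hyt hyD
    refine hD.exists_tower hmin hyD hyL ?_
    rw [hyt, Function.iterate_mul]
  obtain ⟨k, hk⟩ := htow.choice
  -- The tower over the disc at ys follows the orbit from the exit point back to y, whose entries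
  -- after the start lie in V₀ at multiples of N.
  have heq : ∀ᶠ y in (𝒰 : Filter Sphere),
      k y (N * (m y + 1)) c = T^[m y + 1] ys := by
    filter_upwards [hk, hmaps, hm] with y hky hmy hmy'
    rw [← hac]
    refine hD.iterate_eq_of_tower hmin h (fun w hw => (hV₁s (interior_subset hw)).1) hcD
      (hac ▸ hysL) hky.1 hmy fun j hj => ?_
    rw [hky.2 _ (Nat.mul_le_mul_left N hj), ← Nat.mul_sub, Function.iterate_mul]
    exact hmy'.2 _ (by omega)
  -- The two limits: at the exit point the branch takes the value y, which tends to p; at ys it is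
  -- an iterate of T, which tends to ω.
  have hlim1 : Tendsto (fun y => k y (N * (m y + 1)) c) 𝒰 (𝓝 p) := by
    refine tendsto_of_tendsto_univalentCurve hD.ne hD.unbranched.isOpen
      (k := fun y => k y (N * (m y + 1)))
      (hk.mono fun y hy => hD.isUnivalentCurve hy.1 le_rfl) hcD ht (hid.congr' ?_)
    filter_upwards [hk] with y hy
    rw [hy.2 _ le_rfl, Nat.sub_self]
    rfl
  have hlim2 : Tendsto (fun y => k y (N * (m y + 1)) c) 𝒰 (𝓝 ω) :=
    ((h.tendsto ys ⟨hysL, (hV₁s hys₁).1⟩).comp hmT).congr' (heq.mono fun y hy => hy.symm)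
  exact hpω (tendsto_nhds_unique hlim1 hlim2)

/-- The backward orbits of the nonparabolic part accumulate outside the parabolic points. -/
theorem exists_mapClusterPt (hrel : F.IsRelativelyHyperbolic x) (hmin : F.IsMinimalLimitSet x)
    {z : Sphere} (hz : z ∈ F.nonParabolicPart x) :
    ∃ y ∈ F.limitSet x \ F.parabolicSet x,
      MapClusterPt y atTop fun n => (F.invMap (F.limitSet x))^[n] z := by
  set g := F.invMap (F.limitSet x) with hg
  by_contra! hno
  have hinv : ∀ ω ∈ F.parabolicSet x, ∃ N T V, F.HasAttractingInverse x ω N T V :=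
    fun ω hω => exists_hasAttractingInverse hrel hmin hω
  choose! N T V hNTV using hinv
  -- A common multiple of the periods, so that g^M fixes every parabolic point.
  set M := ∏ ω ∈ hmin.finite_parabolic.toFinset, N ω with hM
  have hMpos : 0 < M := Finset.prod_pos fun ω hω =>
    (hNTV ω (hmin.finite_parabolic.mem_toFinset.1 hω)).pos
  have hMinv : ∀ ω ∈ F.parabolicSet x, ∃ T V, F.HasAttractingInverse x ω M T V := by
    intro ω hω
    obtain ⟨m, hm⟩ : N ω ∣ M :=
      Finset.dvd_prod_of_mem N (hmin.finite_parabolic.mem_toFinset.2 hω)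
    have hmpos : 0 < m := Nat.pos_of_ne_zero fun h0 => by simp [hm, h0] at hMpos
    obtain ⟨V', hV'⟩ := (hNTV ω hω).mul hmin hω.1 hmpos
    exact ⟨_, V', hm ▸ hV'⟩
  have hcl : ∀ y, MapClusterPt y atTop (fun k => g^[M * k] z) → y ∈ F.parabolicSet x := by
    intro y hy
    have hyL : y ∈ F.limitSet x := isClosed_limitSet.mem_of_mapClusterPt hy
      (.of_forall fun k => (hmin.iterate_invMap_spec _ hz.1).1)
    by_contra hyΩ
    exact hno y ⟨hyL, hyΩ⟩ (MapClusterPt.of_comp (φ := fun k => M * k)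
      (tendsto_id.const_mul_atTop' hMpos) hy)
  obtain ⟨ω, -, hω⟩ := isCompact_univ.exists_mapClusterPt (f := atTop)
    (u := fun k => g^[M * k] z) (by simp)
  have hωΩ := hcl ω hω
  obtain ⟨T', V', hinv⟩ := hMinv ω hωΩ
  have hconv : Tendsto (fun k => g^[M * k] z) atTop (𝓝 ω) := by
    rw [tendsto_def]
    intro O hO
    have hfin : (F.parabolicSet x \ {ω}).Finite := hmin.finite_parabolic.subset sdiff_subset
    obtain ⟨C, hC, hCc, hCs⟩ := exists_mem_nhds_isClosed_subset
      (inter_mem hO (hfin.isClosed.isOpen_compl.mem_nhds fun hmem => hmem.2 rfl))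
    have hGc : ∀ᶠ y in 𝓝 ω, y ∈ F.limitSet x → g^[M] y ∈ C := by
      have := hmin.continuousOn_iterate_invMap M ω hωΩ.1
      rw [ContinuousWithinAt, ← hg, hinv.fixed] at this
      exact eventually_nhdsWithin_iff.1 (this.eventually hC)
    obtain ⟨W, hWC, hWo, hωW⟩ := mem_nhds_iff.1 (inter_mem hC hGc)
    -- C contains no other possible cluster point, and g^M maps W ∩ Λ into C. Once in W, the
    -- sequence could leave W only through C \ W, which it eventually avoids; so it converges to ω.
    have hK : ∀ᶠ k in atTop, g^[M * k] z ∉ C \ W := by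
      by_contra hcon
      obtain ⟨y, hy, hycl⟩ := (hCc.sdiff hWo).isCompact.exists_mapClusterPt_of_frequently
        (not_eventually.1 hcon |>.mono fun k hk => not_not.1 hk)
      have hyω : y = ω := by
        by_contra hyω
        exact (hCs hy.1).2 ⟨hcl y hycl, hyω⟩
      exact hy.2 (hyω ▸ hωW)
    obtain ⟨k₀, hk₀⟩ := hK.exists_forall_of_atTop
    obtain ⟨k₁, hk₁, hk₁W⟩ := (frequently_atTop.1 (hω.frequently (hWo.mem_nhds hωW))) k₀
    refine mem_atTop_sets.2 ⟨k₁, fun k hk => (hCs (hWC ?_).1).1⟩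
    induction k, hk using Nat.le_induction with
    | base => exact hk₁W
    | succ k hk ih =>
      by_contra hkW
      refine hk₀ (k + 1) (by omega) ⟨?_, hkW⟩
      rw [Nat.mul_succ, add_comm, Function.iterate_add_apply]
      exact (hWC ih).2 (hmin.iterate_invMap_spec _ hz.1).1
  obtain ⟨k, hk⟩ := hinv.exists_iterate_eq hrel hmin hωΩ.1 hz.1 hconv
  refine hz.2 (mem_iUnion.2 ⟨M * k, mem_iUnion₂.2 ⟨ω, hωΩ, ?_⟩⟩)
  rw [← hk]
  exact (hmin.iterate_invMap_spec _ hz.1).2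

end Correspondence

/-! ### Shrinking of univalent branches and porosity -/

theorem IsUnivalentCurve.koebe_distortion {p q : Sphere} (hpq : p ≠ q) {D : Set ℂ}
    {k : ℂ → Sphere} (h : IsUnivalentCurve p q D k) {s : ℂ} (hD : D ∈ 𝓝 s) :
    ∃ d > 0, ∀ ρ > 0, Metric.ball s ρ ⊆ D →
      Metric.ball (Sphere.chart p (k s)) (ρ * d / 40000) ⊆
        (fun t => Sphere.chart p (k t)) '' Metric.ball s ρ ∧
      ∀ t ∈ Metric.closedBall s (ρ / 2),
        dist (Sphere.chart p (k t)) (Sphere.chart p (k s)) ≤ 20000 * (ρ * d) := by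
  obtain ⟨b, hb⟩ := h.holo
  obtain ⟨U, hU, hUo, hsU⟩ := mem_nhds_iff.1 hD
  obtain ⟨hd, hi⟩ := exists_chart_representation h.injOn hb (fun t ht => (h.omits t ht).1)
  -- One constant d, independent of ρ, serves two radii at the same centre; this is what makes hole
  -- and distance comparable.
  refine ⟨‖deriv (fun t => conjIf b (Sphere.chart p (k t))) s‖, norm_pos_iff.2
    (deriv_ne_zero_of_injOn hUo (hd.mono hU) (hi.mono hU) hsU), fun ρ hρ hs => ?_⟩
  have hom : conjIf b (Sphere.chart p q) ∉
      (fun t => conjIf b (Sphere.chart p (k t))) '' Metric.ball s ρ := by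
    rintro ⟨t, ht, hte⟩
    have h1 := conjIf_injective b hte
    exact (h.omits t (hs ht)).2 (Sphere.injOn_chart p (h.omits t (hs ht)).1 hpq.symm h1)
  obtain ⟨h1, h2⟩ := _root_.koebe_distortion hρ (hd.mono hs) (hi.mono hs) hom
  refine ⟨fun w hw => ?_, fun t ht => ?_⟩
  · rw [Metric.mem_ball, ← dist_conjIf b] at hw
    obtain ⟨t, ht, htw⟩ := h1 hw
    exact ⟨t, ht, conjIf_injective b htw⟩
  · have := h2 t ht
    rwa [← dist_eq_norm, dist_conjIf] at this

namespace Correspondence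

variable {F : Correspondence} {x : Sphere}

theorem mem_limitSet_of_tendsto {l : Filter ℕ} [l.NeBot] (hl : l ≤ atTop) {u : ℕ → Sphere}
    {y w : Sphere} (hu : ∀ᶠ n in l, u n ∈ F.iter n y) (hw : Tendsto u l (𝓝 w)) :
    w ∈ F.limitSet y := by
  refine mem_iInter.2 fun n => mem_closure_of_tendsto hw ?_
  filter_upwards [hu, hl (eventually_ge_atTop n)] with i hi hin
  exact mem_iUnion₂.2 ⟨i, hin, hi⟩

/-- Univalent branches taking a fixed value shrink the disc. -/
theorem eventually_mapsTo_of_isUnivalentCurve (hint : interior (F.limitSet x) = ∅)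
    {a p q : Sphere} (hpq : p ≠ q) {c : ℂ} {r : ℝ} (hr : 0 < r)
    (hlim : ∀ t ∈ Metric.ball c r, F.limitSet (Sphere.chartInv a t) ⊆ F.limitSet x)
    {l : Ultrafilter ℕ} (hl : (l : Filter ℕ) ≤ atTop) {f : ℕ → ℂ → Sphere}
    (hf : ∀ᶠ n in (l : Filter ℕ), IsUnivalentCurve p q (Metric.ball c r) (f n))
    (hfi : ∀ᶠ n in (l : Filter ℕ), ∀ t ∈ Metric.ball c r, f n t ∈ F.iter n (Sphere.chartInv a t))
    {s : ℕ → ℂ} (hs : Tendsto s l (𝓝 c)) {z : Sphere}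
    (hz : ∀ᶠ n in (l : Filter ℕ), f n (s n) = z) {O : Set Sphere} (hO : O ∈ 𝓝 z) :
    ∀ᶠ n in (l : Filter ℕ), MapsTo (f n) (Metric.ball c (r / 8)) O := by
  wlog hzp : z ≠ p generalizing p q
  · have hzq : z ≠ q := fun h' => hpq ((not_not.1 hzp).symm.trans h')
    exact this hpq.symm (hf.mono fun n hn => hn.symm) hzq
  have hO' : Sphere.chartInv p ⁻¹' O ∈ 𝓝 (Sphere.chart p z) := by
    refine (Sphere.continuous_chartInv p).continuousAt ?_
    rwa [Sphere.chartInv_chart hzp]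
  obtain ⟨η, hη, hηO⟩ := Metric.mem_nhds_iff.1 hO'
  have hsr : ∀ᶠ n in (l : Filter ℕ), s n ∈ Metric.ball c (r / 8) :=
    hs.eventually (Metric.ball_mem_nhds c (by positivity))
  have hkoebe : ∀ᶠ n in (l : Filter ℕ), ∃ d > 0,
      Metric.ball (Sphere.chart p z) (r / 2 * d / 40000) ⊆
        (fun t => Sphere.chart p (f n t)) '' Metric.ball (s n) (r / 2) ∧
      ∀ t ∈ Metric.closedBall (s n) (r / 2 / 2),
        dist (Sphere.chart p (f n t)) (Sphere.chart p z) ≤ 20000 * (r / 2 * d) := by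
    filter_upwards [hf, hz, hsr] with n hn hzn hsn
    obtain ⟨d, hd, h⟩ := hn.koebe_distortion hpq (Metric.isOpen_ball.mem_nhds
      (Metric.ball_subset_ball (by linarith) hsn))
    have := h (r / 2) (by positivity) (Metric.ball_subset_ball' (by
      rw [Metric.mem_ball] at hsn
      linarith))
    rw [hzn] at this
    exact ⟨d, hd, this⟩
  obtain ⟨d, hd⟩ := hkoebe.choice
  -- Either the derivatives are small along the ultrafilter and the images shrink into O, or they
  -- are bounded below and the images contain a fixed disc around z.
  rcases l.eventually_or.1 (.of_forall fun n => lt_or_ge (20000 * (r / 2 * d n)) η) with h | h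
  · filter_upwards [h, hd, hf, hsr] with n hn hdn hfn hsn t ht
    have htD : t ∈ Metric.ball c r := Metric.ball_subset_ball (by linarith) ht
    have h1 : Sphere.chart p (f n t) ∈ Sphere.chartInv p ⁻¹' O := by
      refine hηO (lt_of_le_of_lt (hdn.2.2 t ?_) hn)
      rw [Metric.mem_ball] at ht hsn
      rw [Metric.mem_closedBall]
      linarith [dist_triangle_right t (s n) c]
    rwa [mem_preimage, Sphere.chartInv_chart (hfn.omits t htD).1] at h1
  · exfalso
    -- A point of the fixed disc is f n (t n) with t n in a compact part of the disc. If t n tends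
    -- to b, equicontinuity gives f n b → the same point, which is therefore in Λ₊(b) ⊆ Λ.
    have hsub : Sphere.chartInv p '' Metric.ball (Sphere.chart p z) (η / 20000 / 40000) ⊆
        F.limitSet x := by
      rintro _ ⟨w, hw, rfl⟩
      have hex : ∀ᶠ n in (l : Filter ℕ), ∃ t ∈ Metric.ball (s n) (r / 2),
          f n t = Sphere.chartInv p w := by
        filter_upwards [h, hd, hf, hsr] with n hn hdn hfn hsn
        obtain ⟨t, ht, htw⟩ := hdn.2.1 (Metric.ball_subset_ball (by linarith) hw)
        refine ⟨t, ht, ?_⟩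
        rw [← htw, Sphere.chartInv_chart (hfn.omits t ?_).1]
        rw [Metric.mem_ball] at ht hsn ⊢
        linarith [dist_triangle t (s n) c]
      obtain ⟨t, ht⟩ := hex.choice
      have htK : ∀ᶠ n in (l : Filter ℕ), t n ∈ Metric.closedBall c (3 * r / 4) := by
        filter_upwards [ht, hsr] with n hn hsn
        have h1 := hn.1
        rw [Metric.mem_ball] at h1 hsn
        rw [Metric.mem_closedBall]
        linarith [dist_triangle (t n) (s n) c]
      obtain ⟨b, hb, hbt⟩ := (isCompact_closedBall c (3 * r / 4)).ultrafilter_le_nhds (l.map t)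
        (le_principal_iff.2 htK)
      have hbD : b ∈ Metric.ball c r := Metric.closedBall_subset_ball (by linarith) hb
      refine hlim b hbD (mem_limitSet_of_tendsto hl (hfi.mono fun n hn => hn b hbD) ?_)
      exact tendsto_of_tendsto_univalentCurve hpq Metric.isOpen_ball hf hbD hbt
        (tendsto_const_nhds.congr' (ht.mono fun n hn => hn.2.symm))
    have hopen := (Sphere.isOpenEmbedding_chartInv p).isOpenMap _
      (Metric.isOpen_ball (x := Sphere.chart p z) (ε := η / 20000 / 40000))
    have := interior_maximal hsub hopen
    rw [hint] at this
    exact this (mem_image_of_mem _ (Metric.mem_ball_self (by positivity)))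

theorem porousAt_of_mem_nonParabolicPart (hrel : F.IsRelativelyHyperbolic x)
    (hmin : F.IsMinimalLimitSet x) {z : Sphere} (hz : z ∈ F.nonParabolicPart x) :
    PorousAt (F.limitSet x) z := by
  obtain ⟨y, hy, hcl⟩ := exists_mapClusterPt hrel hmin hz
  obtain ⟨l, hl, hlim⟩ := mapClusterPt_iff_ultrafilter.1 hcl
  obtain ⟨p, q, r, hr, hD⟩ := exists_isUnivalentDisc hrel hmin hy
  set a := Sphere.pole y with ha
  set c := Sphere.coord y y with hc
  have hac : Sphere.chartInv a c = y := by rw [ha, hc, ← Sphere.param_eq, Sphere.param_coord_self]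
  set s : ℕ → ℂ := fun n => Sphere.chart a ((F.invMap (F.limitSet x))^[n] z) with hs
  have ht : Tendsto s l (𝓝 c) := by
    rw [hc, Sphere.coord_eq]
    exact (Sphere.continuousAt_chart (Sphere.pole_ne y)).tendsto.comp hlim
  have htow : ∀ᶠ n in (l : Filter ℕ), ∃ k : ℕ → ℂ → Sphere,
      F.IsTower a (Metric.ball c r) n k ∧ k n (s n) = z := by
    filter_upwards [hlim.eventually (isOpen_ne.mem_nhds (Sphere.pole_ne y)),
      ht.eventually (Metric.ball_mem_nhds c hr)] with n hn hnD
    obtain ⟨k, hk, hkz⟩ := hD.exists_tower hmin hnD hz.1 (Sphere.chartInv_chart hn).symm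
    refine ⟨k, hk, ?_⟩
    rw [hkz n le_rfl, Nat.sub_self]
    rfl
  obtain ⟨k, hk⟩ := htow.choice
  have hf : ∀ᶠ n in (l : Filter ℕ), IsUnivalentCurve p q (Metric.ball c r) (k n n) :=
    hk.mono fun n hn => hD.isUnivalentCurve hn.1 le_rfl
  have hfi : ∀ᶠ n in (l : Filter ℕ), ∀ t ∈ Metric.ball c r,
      k n n t ∈ F.iter n (Sphere.chartInv a t) :=
    hk.mono fun n hn t ht => hn.1.mem_iter le_rfl ht
  have hshrink : ∀ O ∈ 𝓝 z, ∀ᶠ n in (l : Filter ℕ), MapsTo (k n n) (Metric.ball c (r / 8)) O :=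
    fun O hO => eventually_mapsTo_of_isUnivalentCurve hmin.interior_eq hD.ne hr hD.limitSet_subset
      hl hf hfi ht (hk.mono fun n hn => hn.2) hO
  -- Distortion is measured in the coordinate at z, so the pole of that coordinate must be omitted:
  -- this holds on the smaller disc once the images are near z. The second omitted point e is
  -- whichever of p, q differs from the pole.
  obtain ⟨e, hez, he⟩ : ∃ e, Sphere.pole z ≠ e ∧ ∀ᶠ n in (l : Filter ℕ),
      InjOn (k n n) (Metric.ball c r) ∧ (∃ b, ∀ t ∈ Metric.ball c r, HoloCurveAt b (k n n) t) ∧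
      ∀ t ∈ Metric.ball c r, k n n t ≠ e := by
    by_cases hp : Sphere.pole z = p
    · exact ⟨q, hp ▸ hD.ne, hf.mono fun n hn => ⟨hn.injOn, hn.holo, fun t ht => (hn.omits t ht).2⟩⟩
    · exact ⟨p, hp, hf.mono fun n hn => ⟨hn.injOn, hn.holo, fun t ht => (hn.omits t ht).1⟩⟩
  set R := r / 16 with hR
  have hR0 : 0 < R := by positivity
  -- A hole of Λ near y. With R = r/16, the points d and s n are both within R/4 of c, so s n is
  -- within R/2 of d, and the R-disc around d stays in the disc of radius r/8.
  obtain ⟨d, hdc, σ, hσ, hσR, hhole⟩ : ∃ d ∈ Metric.ball c (R / 4), ∃ σ > 0, σ ≤ R ∧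
      ∀ t ∈ Metric.ball d σ, Sphere.chartInv a t ∉ F.limitSet x := by
    have hnsub : ¬ Sphere.chartInv a '' Metric.ball c (R / 4) ⊆ F.limitSet x := by
      intro hsub
      have := interior_maximal hsub
        ((Sphere.isOpenEmbedding_chartInv a).isOpenMap _ Metric.isOpen_ball)
      rw [hmin.interior_eq] at this
      exact this (mem_image_of_mem _ (Metric.mem_ball_self (by positivity)))
    obtain ⟨_, ⟨d, hd, rfl⟩, hdL⟩ := not_subset.1 hnsub
    obtain ⟨σ, hσ, hσs⟩ := Metric.isOpen_iff.1
      ((isClosed_limitSet (F := F) (x := x)).isOpen_compl.preimage (Sphere.continuous_chartInv a))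
      d hdL
    exact ⟨d, hd, min σ R, lt_min hσ hR0, min_le_right _ _,
      fun t ht => hσs (Metric.ball_subset_ball (min_le_left _ _) ht)⟩
  rw [Metric.mem_ball] at hdc
  have hdD : Metric.ball d R ⊆ Metric.ball c (r / 8) := Metric.ball_subset_ball' (by linarith)
  -- With m the derivative at d, z is at distance at most 20000Rm from the image τ of d, and the
  -- image of the hole contains a disc of radius σm/40000. Both fit in radius Cm around z.
  set C := 20000 * R + σ with hC
  have hC0 : 0 < C := by positivity
  refine ⟨σ / 40000 / C, by positivity, fun ε hε => ?_⟩
  -- The image hole, of radius a fixed ratio times Cm, lies in this small disc around z; comparing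
  -- radii gives Cm < ε.
  have hmem : {w | Sphere.coord z w ∈ Metric.ball (Sphere.coord z z) (ε * (σ / 40000 / C) / 8)} ∩
      {w | w ≠ Sphere.pole z} ∈ 𝓝 z :=
    inter_mem ((Sphere.continuousAt_coord z) (Metric.ball_mem_nhds _ (by positivity)))
      (isOpen_ne.mem_nhds (Sphere.pole_ne z))
  obtain ⟨n, hn1, hn2, hn3, hn4, hn5⟩ := ((hshrink _ hmem).and (he.and (hk.and (hfi.and
    (ht.eventually (Metric.ball_mem_nhds c (show 0 < R / 4 by positivity))))))).exists
  have hsub : Metric.ball c (r / 8) ⊆ Metric.ball c r := Metric.ball_subset_ball (by linarith)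
  have hcurve : IsUnivalentCurve (Sphere.pole z) e (Metric.ball c (r / 8)) (k n n) :=
    ⟨hn2.1.mono hsub, hn2.2.1.imp fun b hb t ht => hb t (hsub ht),
      fun t ht => ⟨(hn1 ht).2, hn2.2.2 t (hsub ht)⟩⟩
  obtain ⟨m, hm, hkoebe⟩ := hcurve.koebe_distortion hez (s := d)
    (Metric.isOpen_ball.mem_nhds (hdD (Metric.mem_ball_self hR0)))
  have h1 := (hkoebe σ hσ ((Metric.ball_subset_ball hσR).trans hdD)).1
  have h2 := (hkoebe R hR0 hdD).2 (s n) (by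
    rw [Metric.mem_closedBall]
    linarith [dist_triangle_right (s n) d c])
  rw [hn3.2, ← Sphere.coord_eq] at h2
  rw [← Sphere.coord_eq] at h1
  set τ := Sphere.coord z (k n n d) with hτ
  have hrad : σ / 40000 / C * (C * m) = σ * m / 40000 := by field_simp
  have hball : Metric.ball τ (σ * m / 40000) ⊆
      Metric.ball (Sphere.coord z z) (ε * (σ / 40000 / C) / 8) := fun w hw => by
    obtain ⟨t, ht, rfl⟩ := h1 hw
    exact (hn1 (hdD (Metric.ball_subset_ball hσR ht))).1
  have hρ0 : 0 < σ * m / 40000 := by positivity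
  refine ⟨C * m, by positivity, ?_, τ, ?_, ?_⟩
  · have h3 : τ + ((σ * m / 40000 / 2 : ℝ) : ℂ) ∈ Metric.ball τ (σ * m / 40000) := by
      rw [Metric.mem_ball, dist_eq_norm, add_sub_cancel_left, Complex.norm_real, Real.norm_eq_abs,
        abs_of_pos (by positivity)]
      linarith
    have h4 := hball h3
    have h5 := hball (Metric.mem_ball_self hρ0)
    have h6 : dist (τ + ((σ * m / 40000 / 2 : ℝ) : ℂ)) τ = σ * m / 40000 / 2 := by
      rw [dist_eq_norm, add_sub_cancel_left, Complex.norm_real, Real.norm_eq_abs,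
        abs_of_pos (by positivity)]
    rw [Metric.mem_ball] at h4 h5
    have h7 := dist_triangle_right (τ + ((σ * m / 40000 / 2 : ℝ) : ℂ)) τ (Sphere.coord z z)
    have h8 : σ / 40000 / C * (C * m) < σ / 40000 / C * ε := by
      rw [hrad]
      nlinarith
    exact lt_of_mul_lt_mul_left h8 (by positivity)
  · rw [hrad]
    refine Metric.ball_subset_ball' ?_
    rw [dist_comm]
    have : 0 < σ * m := by positivity
    rw [hC]
    linarith
  · intro w hw hwL
    rw [hrad] at hw
    obtain ⟨t, ht, rfl⟩ := h1 hw
    have htD := hdD (Metric.ball_subset_ball hσR ht)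
    -- A point of Λ in the image would be brought back by gⁿ to a point of Λ in the original hole.
    simp only [Sphere.param_eq, Sphere.coord_eq, Sphere.chartInv_chart (hn1 htD).2] at hwL
    refine hhole t ht ?_
    rw [← hD.iterate_invMap_eq n t (hsub htD) _ (hn4 t (hsub htD)) hwL]
    exact (hmin.iterate_invMap_spec n hwL).1

end Correspondence

/-- A closed subset of the sphere is null if it is porous at all but countably many points. -/
theorem area_eq_zero_of_porousAt {S X : Set Sphere} (hS : IsClosed S) (hX : (S \ X).Countable)
    (hp : ∀ z ∈ X, PorousAt S z) : area S = 0 := by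
  set A : Set ℂ := {z : ℂ | (z : Sphere) ∈ S} with hA
  have hAc : IsClosed A := hS.preimage OnePoint.continuous_coe
  -- Lebesgue density along discs that need not be centred at z; all K are treated at once because
  -- the porosity constant depends on z.
  have hdens : ∀ᵐ z ∂(volume.restrict A), ∀ K : ℕ, ∀ (w : ℕ → ℂ) (δ : ℕ → ℝ),
      Tendsto δ atTop (𝓝[>] 0) → (∀ᶠ j in atTop, z ∈ Metric.closedBall (w j) (K * δ j)) →
      Tendsto (fun j => volume (A ∩ Metric.closedBall (w j) (δ j)) /
        volume (Metric.closedBall (w j) (δ j))) atTop (𝓝 1) := by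
    rw [ae_all_iff]
    intro K
    filter_upwards [IsUnifLocDoublingMeasure.ae_tendsto_measure_inter_div volume A K] with z hz w δ
    exact hz w δ
  rw [ae_restrict_iff' hAc.measurableSet] at hdens
  have hcount : ({z : ℂ | (z : Sphere) ∈ S \ X}).Countable :=
    hX.preimage_of_injOn OnePoint.coe_injective.injOn
  have hnull : ∀ᵐ z : ℂ, (z : Sphere) ∉ S \ X := hcount.ae_notMem volume
  have : ∀ᵐ z : ℂ, z ∉ A := by
    filter_upwards [hdens, hnull] with z hz hzX hzA
    have hzmem : (z : Sphere) ∈ X := by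
      by_contra hno
      exact hzX ⟨hzA, hno⟩
    obtain ⟨c, hc, hpor⟩ := hp _ hzmem
    -- Then r j ≤ K · (c · r j / 2), so z lies in the K-fold enlargement of the closed hole of
    -- radius c · r j / 2, where A has density 0 instead of 1.
    obtain ⟨K, hK⟩ := exists_nat_ge (2 / c)
    choose r hr0 hr t htb htS using fun j : ℕ => hpor (1 / ((j : ℝ) + 1)) Nat.one_div_pos_of_nat
    have hcoord : Sphere.coord (z : Sphere) (z : Sphere) = z := by
      simp [Sphere.coord, Sphere.toC]
    have hparam : ∀ s, Sphere.param (z : Sphere) s = (s : Sphere) := fun s => by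
      simp [Sphere.param]
    have hr' : Tendsto r atTop (𝓝 0) := squeeze_zero (fun j => (hr0 j).le) (fun j => (hr j).le)
      tendsto_one_div_add_atTop_nhds_zero_nat
    have h1 := hz hzA K t (fun j => c * r j / 2) ?_ ?_
    · have h0 : ∀ j, volume (A ∩ Metric.closedBall (t j) (c * r j / 2)) /
          volume (Metric.closedBall (t j) (c * r j / 2)) = 0 := by
        intro j
        have : A ∩ Metric.closedBall (t j) (c * r j / 2) = ∅ := by
          refine eq_empty_of_forall_notMem fun s hs => htS j s ?_ ?_
          · have := mul_pos hc (hr0 j)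
            exact Metric.closedBall_subset_ball (by linarith) hs.2
          · rw [hparam]
            exact hs.1
        rw [this, measure_empty, ENNReal.zero_div]
      simp only [h0] at h1
      exact zero_ne_one (tendsto_nhds_unique tendsto_const_nhds h1)
    · refine tendsto_nhdsWithin_iff.2 ⟨?_, .of_forall fun j => ?_⟩
      · simpa using (hr'.const_mul c).div_const 2
      · have := mul_pos hc (hr0 j)
        exact half_pos this
    · refine .of_forall fun j => ?_
      have h2 : t j ∈ Metric.ball z (r j) := by
        have := htb j (Metric.mem_ball_self (mul_pos hc (hr0 j)))
        rwa [hcoord] at this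
      rw [Metric.mem_ball, dist_comm] at h2
      rw [Metric.mem_closedBall]
      refine h2.le.trans ?_
      have h3 : 2 ≤ K * c := (div_le_iff₀ hc).1 hK
      nlinarith [hr0 j]
  rw [area, measure_eq_zero_iff_ae_notMem]
  exact this

/-! ### Countability of the exceptional set, and the conclusion -/

namespace Correspondence

variable {F : Correspondence} {x : Sphere}

/-- Over Λ the values of F are isolated by the local branches and form a compact set, hence are
finite in number. -/
theorem finite_iter_of_mem (hrel : F.IsRelativelyHyperbolic x) (hmin : F.IsMinimalLimitSet x)
    {z : Sphere} (hz : z ∈ F.limitSet x) (n : ℕ) : (F.iter n z).Finite := by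
  induction n with
  | zero => exact finite_singleton z
  | succ n ih =>
    exact ih.biUnion fun y hy => (hasContinuousBranches_of_mem hrel hmin
      (hmin.inverseLike.mem_of_mem_iter hz hy)).finite_val

theorem countable_limitSet_diff_nonParabolicPart (hrel : F.IsRelativelyHyperbolic x)
    (hmin : F.IsMinimalLimitSet x) : (F.limitSet x \ F.nonParabolicPart x).Countable := by
  rw [nonParabolicPart, sdiff_sdiff_right_self]
  refine Countable.mono inter_subset_right (countable_iUnion fun n => ?_)
  exact (hmin.finite_parabolic.biUnion fun ω hω =>
    finite_iter_of_mem hrel hmin hω.1 n).countable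

end Correspondence

theorem mainTheorem9 (F : Correspondence) (x : Sphere)
    (hrel : F.IsRelativelyHyperbolic x) (hmin : F.IsMinimalLimitSet x) :
    area (F.limitSet x) = 0 ∧
      ∀ z ∈ F.nonParabolicPart x, PorousAt (F.limitSet x) z := by
  have hpor : ∀ z ∈ F.nonParabolicPart x, PorousAt (F.limitSet x) z := fun z hz =>
    Correspondence.porousAt_of_mem_nonParabolicPart hrel hmin hz
  exact ⟨area_eq_zero_of_porousAt Correspondence.isClosed_limitSet
    (Correspondence.countable_limitSet_diff_nonParabolicPart hrel hmin) hpor, hpor⟩
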